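/- Let $T$ be a complete first-order theory with infinite models in a language $L$. "Definable" means definable without parameters, and a definable linear order of $T$ is an $L$-formula in two free variables that defines a strict linear order on every model of $T$. Definitions. Let $(M,<)$ be a linear order. A set $D\subseteq M$ is $<$-convex if $a,b\in D$ and $a<c<b$ imply $c\in D$; an equivalence relation is $<$-convex if all its classes are. For a $<$-convex equivalence relation $E$, the linear order $<_E$ reverses $<$ inside each $E$-class and agrees with $<$ between elements of different classes. A finite sequence $\vec E=(E_0,\dots,E_{n-1})$ of equivalence relations on $M$ is $<$-admissible if $E_0$ is $<$-convex, $E_1$ is $<_{E_0}$-convex, $E_2$ is $(<_{E_0})_{E_1}$-convex, etc., and then $<_{\vec E}$ denotes $(\dots((<_{E_0})_{E_1})\dots)_{E_{n-1}}$. It is decreasing if $E_{i+1}$ refines $E_i$ for all $i$ (decreasing sequences of $<$-convex equivalence relations are admissible). For a linear order $\lhd$ on $M$, a relation $R\subseteq M\times M$ is $(<,\lhd)$-monotone if $a\le a'$, $a'\,R\,b'$ and $b'\trianglelefteq b$ imply $a\,R\,b$. Let $<$ be a definable linear order of $T$. * $T$ is weakly quasi-o-minimal with respect to $<$ if every parametrically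 definable subset of a model of $T$ is a finite Boolean combination of (not necessarily definable) $<$-convex sets and $L$-definable sets. * $T$ is weakly monotone (weakly special) with respect to $<$ if it has an $\aleph_0$-saturated model $M$ such that, for every finite $A\subseteq M$, the following two structures on $M$ are definitionally equivalent, i.e. have the same definable sets in all finite numbers of variables: the full binary reduct, naming all $A$-definable unary and binary sets; and the reduct naming all $A$-definable unary sets and all $A$-definable binary relations that are $(<,<_{\vec E})$-monotone for some decreasing admissible (respectively, some admissible) sequence $\vec E$ of $A$-definable equivalence relations. * $T$ is weakly quasi-o-minimal (weakly monotone) if it is so with respect to some definable linear order. Theorem. (i) For every definable linear order $<$ of $T$ the following are equivalent: (1) $T$ is weakly quasi-o-minimal with respect to $<$; (2) $T$ is weakly monotone with respect to $<$; (3) $T$ is weakly special with respect to $<$. In particular, $T$ is weakly quasi-o-minimal if and only if it is weakly monotone. (ii) Weak quasi-o-minimality and weak monotonicity do not depend on the choice of the definable linear order: if $<$ and $\lhd$ are definable linear orders of $T$, then $T$ is weakly quasi-o-minimal with respect to $<$ if and only if it is weakly quasi-o-minimal with respect to $\lhd$, and $T$ is weakly monotone with respect to $<$ if and only if it is weakly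 monotone with respect to $\lhd$. -/

import Mathlib

universe u v w

namespace BinaryReducts

open FirstOrder

/-! ### Relations on a set: convexity, the orders `<_E`, monotone relations

Throughout this part `lt` and `lt'` stand for strict linear orders. -/

section Orders

variable {M : Type w}

/-- `D` is convex with respect to the strict order `lt`. -/
def IsConvex (lt : M → M → Prop) (D : Set M) : Prop :=
  ∀ a ∈ D, ∀ b ∈ D, ∀ c, lt a c → lt c b → c ∈ D

/-- `E` is an equivalence relation all of whose classes are `lt`-convex. -/
def IsConvexEquivalence (lt : M → M → Prop) (E : M → M → Prop) : Prop :=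
  Equivalence E ∧ ∀ a, IsConvex lt {b | E a b}

/-- The order `<_E`: it reverses `<` inside each `E`-class and agrees with `<` between elements
of different classes. -/
def reverseOn (lt E : M → M → Prop) : M → M → Prop :=
  fun x y => (E x y ∧ lt y x) ∨ (¬ E x y ∧ lt x y)

/-- The order `(…((<_{E₀})_{E₁})…)_{Eₙ₋₁}` for the finite sequence `(E₀, E₁, …, Eₙ₋₁)`. -/
def reverseAlong (lt : M → M → Prop) (Es : List (M → M → Prop)) : M → M → Prop :=
  Es.foldl reverseOn lt

/-- The finite sequence `(E₀, E₁, …, Eₙ₋₁)` is `<`-admissible: `E₀` is a `<`-convex equivalence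
relation, `E₁` is a `<_{E₀}`-convex one, `E₂` is a `(<_{E₀})_{E₁}`-convex one, and so on. -/
def IsAdmissible : (M → M → Prop) → List (M → M → Prop) → Prop
  | _, [] => True
  | lt, E :: Es => IsConvexEquivalence lt E ∧ IsAdmissible (reverseOn lt E) Es

/-- Every later relation of the sequence refines every earlier one. -/
def IsDecreasing (Es : List (M → M → Prop)) : Prop :=
  Es.Pairwise fun E F => ∀ x y, F x y → E x y

/-- `R` is a monotone(-increasing) relation between `(M, lt)` and `(M, lt')`:
`a ≤ a'`, `a' R b'` and `b' ≤' b` imply `a R b`. -/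
def IsMonotoneRel (lt lt' : M → M → Prop) (R : M → M → Prop) : Prop :=
  ∀ a a' b b', (a = a' ∨ lt a a') → R a' b' → (b' = b ∨ lt' b' b) → R a b

end Orders

/-! ### Binary reducts -/

section Reducts

variable {M : Type w}

/-- The relation symbols of `reductLanguage U B`: a unary one for each member of `U` and a binary
one for each member of `B`. -/
inductive ReductRel (U : Set (Set M)) (B : Set (M → M → Prop)) : ℕ → Type w
  | unary (C : U) : ReductRel U B 1
  | binary (R : B) : ReductRel U B 2

/-- The relational language that names the subsets in `U` and the binary relations in `B`. -/
def reductLanguage (U : Set (Set M)) (B : Set (M → M → Prop)) : FirstOrder.Language.{0, w} :=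
  ⟨fun _ => Empty, ReductRel U B⟩

/-- The structure `(M, C, R)_{C ∈ U, R ∈ B}`. -/
instance reductStructure (U : Set (Set M)) (B : Set (M → M → Prop)) :
    (reductLanguage U B).Structure M where
  funMap := fun f _ => Empty.elim f
  RelMap := fun R x =>
    match R, x with
    | .unary C, x => x 0 ∈ C.1
    | .binary R, x => R.1 (x 0) (x 1)

/-- Two structures with the same universe are definitionally equivalent: they have the same
sets definable without parameters, in every finite number of variables. -/
def DefinitionallyEquivalent (L₁ : FirstOrder.Language.{0, w}) (L₂ : FirstOrder.Language.{0, w}) (M : Type w)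
    [L₁.Structure M] [L₂.Structure M] : Prop :=
  ∀ (n : ℕ) (S : Set (Fin n → M)),
    (∅ : Set M).Definable L₁ S ↔ (∅ : Set M).Definable L₂ S

variable (L : FirstOrder.Language.{u, v}) [L.Structure M] (A : Set M)

/-- The `A`-definable subsets of `M`. -/
def unarySets : Set (Set M) := {C | A.Definable₁ L C}

/-- The `A`-definable binary relations on `M`. -/
def binaryRels : Set (M → M → Prop) := {R | A.Definable₂ L {p : M × M | R p.1 p.2}}

/-- The orders `<_E⃗` for `<`-admissible sequences `E⃗` of `A`-definable equivalence relations. -/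
def specialOrders (lt : M → M → Prop) : Set (M → M → Prop) :=
  {r | ∃ Es : List (M → M → Prop), (∀ E ∈ Es, E ∈ binaryRels L A) ∧
    IsAdmissible lt Es ∧ r = reverseAlong lt Es}

/-- The orders `<_E⃗` for decreasing `<`-admissible sequences `E⃗` of `A`-definable equivalence
relations. -/
def weakOrders (lt : M → M → Prop) : Set (M → M → Prop) :=
  {r | ∃ Es : List (M → M → Prop), (∀ E ∈ Es, E ∈ binaryRels L A) ∧
    IsAdmissible lt Es ∧ IsDecreasing Es ∧ r = reverseAlong lt Es}

/-- The `A`-definable relations that are `(<, ◁)`-monotone for some order `◁` in `F`. -/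
def monotoneRels (lt : M → M → Prop) (F : Set (M → M → Prop)) : Set (M → M → Prop) :=
  {R ∈ binaryRels L A | ∃ lt' ∈ F, IsMonotoneRel lt lt' R}

/-- The language of the full binary reduct of `(M, a)_{a ∈ A}`. -/
abbrev fullBinaryReduct : FirstOrder.Language.{0, w} :=
  reductLanguage (unarySets L A) (binaryRels L A)

/-- The language of the monotone `F`-reduct of `(M, a)_{a ∈ A}`. When `lt` is `A`-definable and
belongs to `F`, it is itself one of the named monotone relations. -/
abbrev monotoneReduct (lt : M → M → Prop) (F : Set (M → M → Prop)) : FirstOrder.Language.{0, w} :=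
  reductLanguage (unarySets L A) (monotoneRels L A lt F)

/-- After naming the elements of any finite set `A` of parameters, the full binary reduct of `M` is
definitionally equivalent to the monotone reduct given by the orders `<_E⃗` for decreasing
sequences `E⃗` of convex equivalence relations. -/
def IsWeaklyMonotoneStructure (M : Type w) [L.Structure M] (lt : M → M → Prop) : Prop :=
  ∀ A : Set M, A.Finite → DefinitionallyEquivalent
    (fullBinaryReduct L A) (monotoneReduct L A lt (weakOrders L A lt)) M

/-- The same with all admissible sequences `E⃗`. -/
def IsWeaklySpecialStructure (M : Type w) [L.Structure M] (lt : M → M → Prop) : Prop :=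
  ∀ A : Set M, A.Finite → DefinitionallyEquivalent
    (fullBinaryReduct L A) (monotoneReduct L A lt (specialOrders L A lt)) M

/-- `M` is `ℵ₀`-saturated: for every finite `A ⊆ M`, every set of formulas in one free variable
with parameters from `A` that is finitely satisfiable in `M` is realized in `M`. -/
def IsAleph0Saturated (M : Type w) [L.Structure M] : Prop :=
  ∀ A : Set M, A.Finite → ∀ p : Set (L[[A]].Formula (Fin 1)),
    (∀ q : Finset (L[[A]].Formula (Fin 1)), (q : Set (L[[A]].Formula (Fin 1))) ⊆ p →
      ∃ a : M, ∀ φ ∈ q, φ.Realize (fun _ => a)) →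
    ∃ a : M, ∀ φ ∈ p, φ.Realize (fun _ => a)

end Reducts

/-! ### Theories -/

section Theories

variable {L : FirstOrder.Language.{u, v}}

/-- The binary relation on a structure that is defined by a formula in two free variables. -/
def relOf (φ : L.Formula (Fin 2)) (M : Type w) [L.Structure M] : M → M → Prop :=
  fun a b => φ.Realize ![a, b]

variable (T : L.Theory) (lt : L.Formula (Fin 2))

/-- The formula `lt` defines a strict linear order on every model of `T`. -/
def DefinesLinearOrder : Prop :=
  ∀ M : FirstOrder.Language.Theory.ModelType.{u, v, max u v w} T, IsStrictTotalOrder M (relOf lt M)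

/-- `T` is weakly quasi-o-minimal with respect to `lt`: every parametrically definable subset of a
model of `T` is a finite Boolean combination of convex sets (definable or not) and sets definable
without parameters. -/
def IsWeaklyQuasiOMinimalWrt : Prop :=
  ∀ (M : FirstOrder.Language.Theory.ModelType.{u, v, max u v w} T) (D : Set M),
    (Set.univ : Set M).Definable₁ L D →
    D ∈ BooleanSubalgebra.closure
      {C : Set M | IsConvex (relOf lt M) C ∨ (∅ : Set M).Definable₁ L C}

/-- `T` is weakly monotone with respect to `lt`. -/
def IsWeaklyMonotoneWrt : Prop :=
  ∃ M : FirstOrder.Language.Theory.ModelType.{u, v, max u v w} T,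
    IsAleph0Saturated L M ∧ IsWeaklyMonotoneStructure L M (relOf lt M)

/-- `T` is weakly special with respect to `lt`. -/
def IsWeaklySpecialWrt : Prop :=
  ∃ M : FirstOrder.Language.Theory.ModelType.{u, v, max u v w} T,
    IsAleph0Saturated L M ∧ IsWeaklySpecialStructure L M (relOf lt M)

/-- `T` is weakly quasi-o-minimal (with respect to some definable linear order). -/
def IsWeaklyQuasiOMinimal : Prop :=
  ∃ lt : L.Formula (Fin 2), DefinesLinearOrder.{u, v, w} T lt ∧
    IsWeaklyQuasiOMinimalWrt.{u, v, w} T lt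

/-- `T` is weakly monotone (with respect to some definable linear order). -/
def IsWeaklyMonotone : Prop :=
  ∃ lt : L.Formula (Fin 2), DefinesLinearOrder.{u, v, w} T lt ∧
    IsWeaklyMonotoneWrt.{u, v, w} T lt

end Theories

end BinaryReducts

/-! The common currency is alternation. A set is a Boolean combination of convex sets and members of
a Boolean algebra `B` exactly when, on each piece of some finite cover by members of `B`, it changes
membership boundedly often along the order (`mem_closure_convex_iff`). In an `ℵ₀`-saturated model
compactness makes the cover and the bound uniform in the fibres of a definable relation
(`exists_uniform_bound`). Such a bound is first-order, so it passes to all models of a complete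
theory; an `ℵ₀`-saturated model is the union of an elementary chain of length `ω`.

From weak quasi-o-minimality to weak monotonicity: a definable relation with bounded alternation is
recovered from relations whose fibres are initial segments. Ordering points by inclusion of such
fibres gives a second definable linear order `◁`. The geometric core,
`isAlignable_of_not_hasInversionChain`, cuts `M` into finitely many definable pieces on which `◁` is
`<` reversed along a decreasing sequence of convex equivalence relations. It identifies `x < y` when
some point at or above `y` precedes `x` in `◁`. After removing obstructions to transitivity, this
yields a convex equivalence relation outside which the orders agree, and inside which the reversed
order has shorter chains of inversions. On each piece the relation extends to a monotone one.

Weakly monotone implies weakly special because more relations are named. From weakly special back to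
weakly quasi-o-minimal: the special reduct eliminates quantifiers. The fibres of a named relation
are nested initial segments, so an existential statement concerns one point inside a smallest fibre
and outside a largest one. This gives a relation monotone between two special orders, and
`detBy_specialPairs` moves the reversals of the first order to the second until the first is `<`.
The resulting atoms have fibres that are Boolean combinations of convex and definable sets.

Independence of the order uses the same alignment: on each piece, convexity for either order is
expressible through convexity for the other, since every reversal can be undone. -/

namespace BinaryReducts
open FirstOrder Set

/-! ### Definable predicates -/

section DefPred

variable {M : Type w} (L : FirstOrder.Language.{u, v}) [L.Structure M] (A : Set M)

/-- The predicate `P` on tuples indexed by `α` is definable over `A`. -/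
def DefPred {α : Type*} (P : (α → M) → Prop) : Prop := A.Definable L {v | P v}

variable {L A} {α β : Type*}

theorem DefPred.congr {P Q : (α → M) → Prop} (h : DefPred L A P) (hPQ : ∀ v, P v ↔ Q v) :
    DefPred L A Q := by
  have : P = Q := funext fun v => propext (hPQ v)
  exact this ▸ h

theorem DefPred.and {P Q : (α → M) → Prop} (hP : DefPred L A P) (hQ : DefPred L A Q) :
    DefPred L A fun v => P v ∧ Q v := Set.Definable.inter hP hQ

theorem DefPred.or {P Q : (α → M) → Prop} (hP : DefPred L A P) (hQ : DefPred L A Q) :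
    DefPred L A fun v => P v ∨ Q v := Set.Definable.union hP hQ

theorem DefPred.not {P : (α → M) → Prop} (hP : DefPred L A P) :
    DefPred L A fun v => ¬ P v := Set.Definable.compl hP

theorem DefPred.imp {P Q : (α → M) → Prop} (hP : DefPred L A P) (hQ : DefPred L A Q) :
    DefPred L A fun v => P v → Q v :=
  (hP.not.or hQ).congr fun _ => imp_iff_not_or.symm

theorem DefPred.iff {P Q : (α → M) → Prop} (hP : DefPred L A P) (hQ : DefPred L A Q) :
    DefPred L A fun v => P v ↔ Q v :=
  ((hP.imp hQ).and (hQ.imp hP)).congr fun _ => iff_def.symm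

theorem DefPred.const (p : Prop) : DefPred L A fun _ : α → M => p := by
  by_cases hp : p
  · simp [DefPred, hp]
  · simp [DefPred, hp]

theorem DefPred.comp {P : (α → M) → Prop} (hP : DefPred L A P) (f : α → β) :
    DefPred L A fun v : β → M => P fun i => v (f i) :=
  Set.Definable.preimage_comp f hP

theorem DefPred.ex {P : (α → M) → M → Prop}
    (hP : DefPred L A fun w : α ⊕ Unit → M => P (fun i => w (Sum.inl i)) (w (Sum.inr ()))) :
    DefPred L A fun v => ∃ z, P v z := by
  have h := Set.Definable.exists_of_finite (L := L) (A := A) (α := α) (β := Unit) hP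
  refine DefPred.congr (P := _) h fun v => ?_
  constructor
  · rintro ⟨u, hu⟩
    exact ⟨u (), hu⟩
  · rintro ⟨z, hz⟩
    exact ⟨fun _ => z, hz⟩

theorem DefPred.all {P : (α → M) → M → Prop}
    (hP : DefPred L A fun w : α ⊕ Unit → M => P (fun i => w (Sum.inl i)) (w (Sum.inr ()))) :
    DefPred L A fun v => ∀ z, P v z :=
  (DefPred.ex (P := fun v z => ¬ P v z) hP.not).not.congr fun _ => by push Not; rfl

theorem DefPred.eq (i j : α) : DefPred L A fun v : α → M => v i = v j :=
  ⟨(Language.var i).equal (Language.var j), by ext v; simp⟩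

theorem DefPred.finset_or {ι : Type*} (s : Finset ι) {P : ι → (α → M) → Prop}
    (h : ∀ i ∈ s, DefPred L A (P i)) : DefPred L A fun v => ∃ i ∈ s, P i v := by
  classical
  induction s using Finset.induction_on with
  | empty => exact (DefPred.const False).congr (by simp)
  | insert a s _ ih =>
    exact ((h a (by simp)).or (ih fun i hi => h i (by simp [hi]))).congr (by simp)

theorem DefPred.finset_and {ι : Type*} (s : Finset ι) {P : ι → (α → M) → Prop}
    (h : ∀ i ∈ s, DefPred L A (P i)) : DefPred L A fun v => ∀ i ∈ s, P i v :=
  (DefPred.finset_or s fun i hi => (h i hi).not).not.congr fun v => by push Not; rfl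

theorem mem_unarySets_iff {C : Set M} :
    C ∈ unarySets L A ↔ DefPred L A fun v : Fin 1 → M => v 0 ∈ C := Iff.rfl

theorem mem_binaryRels_iff {R : M → M → Prop} :
    R ∈ binaryRels L A ↔ DefPred L A fun v : Fin 2 → M => R (v 0) (v 1) := Iff.rfl

theorem defPred_unary {C : Set M} (hC : C ∈ unarySets L A) (i : α) :
    DefPred L A fun v : α → M => v i ∈ C :=
  (mem_unarySets_iff.1 hC).comp fun _ => i

theorem defPred_binary {R : M → M → Prop} (hR : R ∈ binaryRels L A) (i j : α) :
    DefPred L A fun v : α → M => R (v i) (v j) :=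
  (mem_binaryRels_iff.1 hR).comp ![i, j]

theorem unarySets_mono {B : Set M} (h : A ⊆ B) : unarySets L A ⊆ unarySets L B :=
  fun _ hC => Set.Definable.mono hC h

theorem binaryRels_mono {B : Set M} (h : A ⊆ B) : binaryRels L A ⊆ binaryRels L B :=
  fun _ hC => Set.Definable.mono hC h

theorem DefPred.iff_formula {P : (α → M) → Prop} :
    DefPred L A P ↔ ∃ φ : L.Formula (A ⊕ α), ∀ v, φ.Realize (Sum.elim (↑) v) ↔ P v := by
  rw [DefPred, Set.definable_iff_exists_formula_sum]
  refine exists_congr fun φ => ?_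
  rw [Set.ext_iff]
  exact forall_congr' fun v => ⟨fun h => h.symm, fun h => h.symm⟩

/-- Substituting a parameter for a variable. -/
theorem DefPred.subst {P : (α → M) → Prop} (hP : DefPred L A P) {B : Set M} (hAB : A ⊆ B)
    (f : α → B ⊕ β) : DefPred L B fun v : β → M => P fun i => Sum.elim (↑) v (f i) := by
  obtain ⟨φ, hφ⟩ := DefPred.iff_formula.1 hP
  refine DefPred.iff_formula.2
    ⟨φ.relabel (Sum.elim (fun a : A => Sum.inl ⟨a, hAB a.2⟩) f), fun v => ?_⟩
  rw [Language.Formula.realize_relabel, ← hφ]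
  refine iff_of_eq (congrArg _ ?_)
  ext (i | i) <;> simp

/-- A parameter can be replaced by a new variable. -/
theorem DefPred.exists_extension {P : (α → M) → Prop} {a : M} (hP : DefPred L (insert a A) P) :
    ∃ Q : (α ⊕ Unit → M) → Prop, DefPred L A Q ∧ ∀ v, Q (Sum.elim v fun _ => a) ↔ P v := by
  classical
  obtain ⟨φ, hφ⟩ := DefPred.iff_formula.1 hP
  let g : ↥(insert a A) ⊕ α → A ⊕ (α ⊕ Unit) := Sum.elim
    (fun x => if h : (x : M) ∈ A then Sum.inl ⟨x, h⟩ else Sum.inr (Sum.inr ()))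
    (fun i => Sum.inr (Sum.inl i))
  refine ⟨_, DefPred.iff_formula.2 ⟨φ.relabel g, fun v => Iff.rfl⟩, fun v => ?_⟩
  rw [Language.Formula.realize_relabel, ← hφ]
  refine iff_of_eq (congrArg _ ?_)
  ext (i | i)
  · by_cases h : (i : M) ∈ A
    · simp [g, h]
    · have : (i : M) = a := (Set.mem_insert_iff.1 i.2).resolve_right h
      simp only [g, Function.comp_apply, Sum.elim_inl, h, dif_neg, not_false_eq_true]
      exact this.symm
  · simp [g]

end DefPred

/-! ### Uniformly definable predicates -/

section UnifDef

variable (L : FirstOrder.Language.{u, v}) {α β : Type*}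

/-- The predicate `P` on tuples of nonempty structures is defined by one formula, uniformly in all
structures. -/
def UnifDef (P : ∀ (M : Type w) [L.Structure M], (α → M) → Prop) : Prop :=
  ∃ φ : L.Formula α, ∀ (M : Type w) [L.Structure M] (v : α → M), φ.Realize v ↔ P M v

variable {L}
variable {P Q : ∀ (M : Type w) [L.Structure M], (α → M) → Prop}

theorem UnifDef.congr (hP : UnifDef L P) (h : ∀ (M : Type w) [L.Structure M] v, P M v ↔ Q M v) :
    UnifDef L Q :=
  let ⟨φ, hφ⟩ := hP
  ⟨φ, fun M _ v => (hφ M v).trans (h M v)⟩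

theorem UnifDef.and (hP : UnifDef L P) (hQ : UnifDef L Q) :
    UnifDef.{u, v, w} L fun M _ v => P M v ∧ Q M v :=
  let ⟨φ, hφ⟩ := hP
  let ⟨ψ, hψ⟩ := hQ
  ⟨φ ⊓ ψ, fun M _ v => by rw [Language.Formula.realize_inf, hφ, hψ]⟩

theorem UnifDef.not (hP : UnifDef L P) : UnifDef.{u, v, w} L fun M _ v => ¬ P M v :=
  let ⟨φ, hφ⟩ := hP
  ⟨φ.not, fun M _ v => by rw [Language.Formula.realize_not, hφ]⟩

theorem UnifDef.iff (hP : UnifDef L P) (hQ : UnifDef L Q) :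
    UnifDef.{u, v, w} L fun M _ v => (P M v ↔ Q M v) :=
  let ⟨φ, hφ⟩ := hP
  let ⟨ψ, hψ⟩ := hQ
  ⟨φ.iff ψ, fun M _ v => by rw [Language.Formula.realize_iff, hφ, hψ]⟩

theorem UnifDef.const (p : Prop) : UnifDef.{u, v, w} L fun M _ (_ : α → M) => p := by
  by_cases hp : p
  · exact ⟨⊤, fun M _ v => by simp [hp]⟩
  · exact ⟨⊥, fun M _ v => by simp [hp]⟩

theorem unifDef_formula (φ : L.Formula β) (f : β → α) :
    UnifDef.{u, v, w} L fun M _ (v : α → M) => φ.Realize fun i => v (f i) :=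
  ⟨φ.relabel f, fun M _ v => by rw [Language.Formula.realize_relabel]; rfl⟩

theorem UnifDef.ex {P : ∀ (M : Type w) [L.Structure M], (α → M) → M → Prop}
    (hP : UnifDef.{u, v, w} L fun M _ (w : α ⊕ Unit → M) =>
      P M (fun i => w (Sum.inl i)) (w (Sum.inr ()))) :
    UnifDef.{u, v, w} L fun M _ v => ∃ z, P M v z := by
  obtain ⟨φ, hφ⟩ := hP
  refine ⟨φ.iExs Unit, fun M _ v => ?_⟩
  rw [Language.Formula.realize_iExs]
  constructor
  · rintro ⟨u, hu⟩
    exact ⟨u (), (hφ M _).1 hu⟩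
  · rintro ⟨z, hz⟩
    exact ⟨fun _ => z, (hφ M _).2 hz⟩

theorem UnifDef.comp {P : ∀ (M : Type w) [L.Structure M], (α → M) → Prop} (hP : UnifDef L P)
    (f : α → β) : UnifDef.{u, v, w} L fun M _ (v : β → M) => P M fun i => v (f i) :=
  let ⟨φ, hφ⟩ := hP
  ⟨φ.relabel f, fun M _ v => by rw [Language.Formula.realize_relabel, hφ]; rfl⟩

theorem UnifDef.list_all {ι : Type*} (l : List ι)
    {P : ι → ∀ (M : Type w) [L.Structure M], (α → M) → Prop} (h : ∀ i ∈ l, UnifDef L (P i)) :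
    UnifDef.{u, v, w} L fun M _ v => ∀ i ∈ l, P i M v := by
  induction l with
  | nil => exact (UnifDef.const True).congr (by simp)
  | cons a l ih =>
    exact ((h a (by simp)).and (ih fun i hi => h i (by simp [hi]))).congr (by simp)

/-- A sentence that is uniformly definable has the same truth value in all models of a complete
theory. -/
theorem UnifDef.transfer {T : L.Theory} (hT : T.IsComplete)
    {P : ∀ (M : Type w) [L.Structure M], (Empty → M) → Prop} (hP : UnifDef L P)
    (M N : Language.Theory.ModelType.{u, v, w} T) (hM : P M Empty.elim) :
    P N Empty.elim := by
  obtain ⟨φ, hφ⟩ := hP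
  have h : ∀ (K : Language.Theory.ModelType.{u, v, w} T),
      P K Empty.elim ↔ K ⊨ (φ : L.Sentence) := by
    intro K
    rw [← hφ, Language.Sentence.Realize]
    exact iff_of_eq (congrArg _ (Subsingleton.elim _ _))
  rw [h] at hM ⊢
  exact (hT.realize_sentence_iff _ N).2 ((hT.realize_sentence_iff _ M).1 hM)

end UnifDef
end BinaryReducts

namespace BinaryReducts
open FirstOrder Set

/-! ### Sets determined by finitely many members of a Boolean algebra -/

/-- Such a `D` is a union of cells of the finite partition generated by `F`. This criterion replaces
explicit Boolean combinations in what follows. -/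
theorem mem_booleanSubalgebra_of_determined {M : Type*} (B : BooleanSubalgebra (Set M))
    (F : Finset (Set M)) (hF : ∀ C ∈ F, C ∈ B) (D : Set M)
    (h : ∀ x y, (∀ C ∈ F, x ∈ C ↔ y ∈ C) → x ∈ D → y ∈ D) : D ∈ B := by
  classical
  induction F using Finset.induction_on generalizing D with
  | empty =>
    rcases D.eq_empty_or_nonempty with rfl | ⟨x, hx⟩
    · exact B.bot_mem
    · have : D = ⊤ := by ext y; exact iff_of_true (h x y (by simp) hx) trivial
      exact this ▸ B.top_mem
  | insert C F _ ih =>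
    have hC : C ∈ B := hF C (by simp)
    have hF' : ∀ C ∈ F, C ∈ B := fun C' h' => hF C' (by simp [h'])
    -- The saturation of `D ∩ C` under the remaining members of `F`; intersecting it with `C` gives
    -- `D ∩ C` back.
    have h1 : {y | ∃ x ∈ D, x ∈ C ∧ ∀ C' ∈ F, x ∈ C' ↔ y ∈ C'} ∈ B := by
      refine ih hF' _ ?_
      rintro y z hyz ⟨x, hx, hxC, hxy⟩
      exact ⟨x, hx, hxC, fun C' h' => (hxy C' h').trans (hyz C' h')⟩
    have h2 : {y | ∃ x ∈ D, x ∉ C ∧ ∀ C' ∈ F, x ∈ C' ↔ y ∈ C'} ∈ B := by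
      refine ih hF' _ ?_
      rintro y z hyz ⟨x, hx, hxC, hxy⟩
      exact ⟨x, hx, hxC, fun C' h' => (hxy C' h').trans (hyz C' h')⟩
    have : D = (C ⊓ {y | ∃ x ∈ D, x ∈ C ∧ ∀ C' ∈ F, x ∈ C' ↔ y ∈ C'}) ⊔
        (Cᶜ ⊓ {y | ∃ x ∈ D, x ∉ C ∧ ∀ C' ∈ F, x ∈ C' ↔ y ∈ C'}) := by
      ext y
      constructor
      · intro hy
        by_cases hyC : y ∈ C
        · exact Or.inl ⟨hyC, y, hy, hyC, fun _ _ => Iff.rfl⟩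
        · exact Or.inr ⟨hyC, y, hy, hyC, fun _ _ => Iff.rfl⟩
      · rintro (⟨hyC, x, hx, hxC, hxy⟩ | ⟨hyC, x, hx, hxC, hxy⟩)
        · refine h x y ?_ hx
          intro C' h'
          rcases Finset.mem_insert.1 h' with rfl | h'
          · exact iff_of_true hxC hyC
          · exact hxy C' h'
        · refine h x y ?_ hx
          intro C' h'
          rcases Finset.mem_insert.1 h' with rfl | h'
          · exact iff_of_false hxC hyC
          · exact hxy C' h'
    rw [this]
    exact B.sup_mem (B.inf_mem hC h1) (B.inf_mem (B.compl_mem hC) h2)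

/-! ### Alternations of a set along a linear order -/

section Alternation

variable {M : Type w}

/-- There is a chain `x = x₀ < x₁ < … < xₖ` in `X` along which membership in `S` alternates. -/
def altOn (lt : M → M → Prop) (X S : Set M) : ℕ → M → Prop
  | 0, x => x ∈ X
  | k + 1, x => x ∈ X ∧ ∃ y, lt x y ∧ (y ∈ S ↔ x ∉ S) ∧ altOn lt X S k y

variable {lt : M → M → Prop} {X Y S D : Set M} {k l : ℕ} {x y : M}

theorem altOn.mem (h : altOn lt X S k x) : x ∈ X := by
  cases k with
  | zero => exact h
  | succ k => exact h.1

theorem altOn.pred (h : altOn lt X S (k + 1) x) : altOn lt X S k x := by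
  induction k generalizing x with
  | zero => exact h.1
  | succ k ih =>
    obtain ⟨hx, y, hxy, hS, hy⟩ := h
    exact ⟨hx, y, hxy, hS, ih hy⟩

theorem altOn.anti (h : altOn lt X S k x) (hl : l ≤ k) : altOn lt X S l x := by
  induction hl with
  | refl => exact h
  | step _ ih => exact ih h.pred

theorem altOn.mono (h : altOn lt X S k x) (hXY : X ⊆ Y) : altOn lt Y S k x := by
  induction k generalizing x with
  | zero => exact hXY h
  | succ k ih =>
    obtain ⟨hx, y, hxy, hS, hy⟩ := h
    exact ⟨hXY hx, y, hxy, hS, ih hy⟩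

theorem altOn.compl (h : altOn lt X S k x) : altOn lt X Sᶜ k x := by
  induction k generalizing x with
  | zero => exact h
  | succ k ih =>
    obtain ⟨hx, y, hxy, hS, hy⟩ := h
    exact ⟨hx, y, hxy, by simp only [Set.mem_compl_iff]; tauto, ih hy⟩

/-- Among four alternating points, three consecutive ones have the outer two in `S` and the middle
one outside. -/
theorem altOn.not_of_convex (hS : IsConvex lt S) : ¬ altOn lt X S 3 x := by
  rintro ⟨_, y, hxy, h1, _, z, hyz, h2, _, t, hzt, h3, _⟩
  by_cases hx : x ∈ S
  · exact (h1.not.2 (not_not.2 hx)) (hS x hx z (by tauto) y hxy hyz)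
  · have hy : y ∈ S := h1.2 hx
    exact (h2.not.2 (not_not.2 hy)) (hS y hy t (by tauto) z hyz hzt)

variable [IsStrictTotalOrder M lt]

/-- If `S` separates `x` from `y`, put `x` in front of the chain and drop the last point; otherwise
`x` takes the place of `y`. -/
theorem altOn.of_le (hx : x ∈ X) (hxy : x = y ∨ lt x y) (h : altOn lt X S k y) :
    altOn lt X S k x := by
  rcases hxy with rfl | hxy
  · exact h
  by_cases hS : y ∈ S ↔ x ∉ S
  · exact altOn.pred ⟨hx, y, hxy, hS, h⟩
  · cases k with
    | zero => exact hx
    | succ k =>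
      obtain ⟨_, z, hyz, hS', hz⟩ := h
      exact ⟨hx, z, _root_.trans hxy hyz, by tauto, hz⟩

/-- Each change of membership in `S ∪ D` is a change in `S` or in `D`, so the two counts add up to
at least `k`. -/
theorem altOn.of_union (h : altOn lt X (S ∪ D) k x) :
    ∃ i j, k ≤ i + j ∧ altOn lt X S i x ∧ altOn lt X D j x := by
  induction k generalizing x with
  | zero => exact ⟨0, 0, le_rfl, h, h⟩
  | succ k ih =>
    obtain ⟨hx, y, hxy, hS, hy⟩ := h
    obtain ⟨i, j, hij, hi, hj⟩ := ih hy
    by_cases h1 : y ∈ S ↔ x ∉ S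
    · exact ⟨i + 1, j, by omega, ⟨hx, y, hxy, h1, hi⟩, hj.of_le hx (Or.inr hxy)⟩
    · refine ⟨i, j + 1, by omega, hi.of_le hx (Or.inr hxy), ⟨hx, y, hxy, ?_, hj⟩⟩
      simp only [Set.mem_union] at hS
      tauto

/-- A set alternates finitely often on each piece of some finite cover by members of `B` if and
only if it is a Boolean combination of convex sets and members of `B`. -/
theorem mem_closure_convex_iff {B : BooleanSubalgebra (Set M)} :
    D ∈ BooleanSubalgebra.closure {C : Set M | IsConvex lt C ∨ C ∈ B} ↔
      ∃ (F : Finset (Set M)) (n : ℕ), (∀ X ∈ F, X ∈ B) ∧ (∀ x, ∃ X ∈ F, x ∈ X) ∧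
        ∀ X ∈ F, ∀ x, ¬ altOn lt X D n x := by
  classical
  constructor
  · intro hD
    induction hD using BooleanSubalgebra.closure_bot_sup_induction with
    | mem C hC =>
      rcases hC with hC | hC
      · exact ⟨{⊤}, 3, by simpa using B.top_mem, by simp, fun X _ x => altOn.not_of_convex hC⟩
      · refine ⟨{C, Cᶜ}, 1, ?_, ?_, ?_⟩
        · simpa using hC
        · intro x
          by_cases hx : x ∈ C
          · exact ⟨C, by simp, hx⟩
          · exact ⟨Cᶜ, by simp, hx⟩
        · rintro X hX x ⟨hx, y, _, h, hy⟩
          have hy := hy.mem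
          simp only [Finset.mem_insert, Finset.mem_singleton] at hX
          rcases hX with rfl | rfl
          · tauto
          · simp only [Set.mem_compl_iff] at hx hy
            tauto
    | bot =>
      refine ⟨{⊤}, 1, by simpa using B.top_mem, by simp, ?_⟩
      rintro X - x ⟨_, y, _, h, _⟩
      exact (h.2 (fun h => h)).elim
    | sup C hC D hD ihC ihD =>
      obtain ⟨F, n, hF, hFc, hFn⟩ := ihC
      obtain ⟨G, m, hG, hGc, hGm⟩ := ihD
      refine ⟨(F ×ˢ G).image fun p => p.1 ∩ p.2, n + m, ?_, ?_, ?_⟩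
      · intro X hX
        obtain ⟨⟨U, V⟩, hUV, rfl⟩ := Finset.mem_image.1 hX
        obtain ⟨hU, hV⟩ := Finset.mem_product.1 hUV
        exact B.inf_mem (hF _ hU) (hG _ hV)
      · intro x
        obtain ⟨U, hU, hxU⟩ := hFc x
        obtain ⟨V, hV, hxV⟩ := hGc x
        exact ⟨U ∩ V, Finset.mem_image.2 ⟨(U, V), Finset.mem_product.2 ⟨hU, hV⟩, rfl⟩, hxU, hxV⟩
      · intro X hX x hx
        obtain ⟨⟨U, V⟩, hUV, rfl⟩ := Finset.mem_image.1 hX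
        obtain ⟨hU, hV⟩ := Finset.mem_product.1 hUV
        obtain ⟨i, j, hij, hi, hj⟩ := altOn.of_union hx
        rcases le_or_gt n i with hn | hn
        · exact hFn U hU x ((hi.mono Set.inter_subset_left).anti hn)
        · exact hGm V hV x ((hj.mono Set.inter_subset_right).anti (by omega))
    | compl C hC ih =>
      obtain ⟨F, n, hF, hFc, hFn⟩ := ih
      exact ⟨F, n, hF, hFc, fun X hX x hx => hFn X hX x (by simpa using hx.compl)⟩
  · rintro ⟨F, n, hF, hFc, hFn⟩
    -- The generators are the pieces and, for `k < n`, the initial segments below the points that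
    -- start `k` alternations. By `altOn.of_le`, two points of one piece with the same generators
    -- start chains of the same lengths below `n`.
    refine mem_booleanSubalgebra_of_determined _
      (F ∪ (F ×ˢ Finset.range n).image
        fun p => {x | ∃ y, (x = y ∨ lt x y) ∧ altOn lt p.1 D p.2 y}) ?_ D ?_
    · intro C hC
      rcases Finset.mem_union.1 hC with hC | hC
      · exact BooleanSubalgebra.subset_closure (Or.inr (hF C hC))
      · obtain ⟨⟨X, k⟩, -, rfl⟩ := Finset.mem_image.1 hC
        refine BooleanSubalgebra.subset_closure (Or.inl ?_)
        rintro a - b ⟨y, hby, hy⟩ c - hcb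
        refine ⟨y, Or.inr ?_, hy⟩
        rcases hby with rfl | hby
        · exact hcb
        · exact _root_.trans hcb hby
    · intro x y hxy hx
      obtain ⟨X, hX, hxX⟩ := hFc x
      have hyX : y ∈ X := (hxy X (Finset.mem_union_left _ hX)).1 hxX
      have key : ∀ k < n, altOn lt X D k x ↔ altOn lt X D k y := by
        intro k hk
        have := hxy {x | ∃ y, (x = y ∨ lt x y) ∧ altOn lt X D k y}
          (Finset.mem_union_right _ (Finset.mem_image.2 ⟨(X, k), by simp [hX, hk], rfl⟩))
        constructor
        · intro h
          obtain ⟨z, hyz, hz⟩ := this.1 ⟨x, Or.inl rfl, h⟩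
          exact hz.of_le hyX hyz
        · intro h
          obtain ⟨z, hyz, hz⟩ := this.2 ⟨y, Or.inl rfl, h⟩
          exact hz.of_le hxX hyz
      by_contra hy
      -- Since `D` separates `x` from `y`, the smaller of the two can be put in front of a chain
      -- starting at the larger one. The common length thus climbs until it reaches the forbidden
      -- value `n`.
      have step : ∀ k, k ≤ n → altOn lt X D k x := by
        intro k
        induction k with
        | zero => exact fun _ => hxX
        | succ k ih =>
          intro hk
          have h1 := ih (by omega)
          have h2 := (key k (by omega)).1 h1
          rcases trichotomous_of lt x y with h | h | h
          · exact ⟨hxX, y, h, by tauto, h2⟩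
          · exact (hy (h ▸ hx)).elim
          · have : altOn lt X D (k + 1) y := ⟨hyX, x, h, by tauto, h1⟩
            rcases Nat.lt_or_ge (k + 1) n with hk' | hk'
            · exact (key _ hk').2 this
            · exact (hFn X hX y (this.anti hk')).elim
      exact hFn X hX x (step n le_rfl)

end Alternation

/-! ### Weak quasi-o-minimality of a single structure -/

section Structure

variable {M : Type w} (L : FirstOrder.Language.{u, v}) [L.Structure M] (A : Set M)

/-- The Boolean algebra of the `A`-definable subsets of `M`. -/
def definableAlgebra : BooleanSubalgebra (Set M) where
  carrier := unarySets L A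
  supClosed' := fun _ h _ h' => DefPred.or (mem_unarySets_iff.1 h) (mem_unarySets_iff.1 h')
  infClosed' := fun _ h _ h' => DefPred.and (mem_unarySets_iff.1 h) (mem_unarySets_iff.1 h')
  compl_mem' := fun h => DefPred.not (mem_unarySets_iff.1 h)
  bot_mem' := (DefPred.const False : DefPred L A fun _ : Fin 1 → M => False)

theorem mem_definableAlgebra {C : Set M} : C ∈ definableAlgebra L A ↔ C ∈ unarySets L A := Iff.rfl

/-- Every parametrically definable subset of `M` is a finite Boolean combination of convex sets and
sets definable without parameters. -/
def IsWeaklyQuasiOMinimalStructure (M : Type w) [L.Structure M] (lt : M → M → Prop) : Prop :=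
  ∀ D : Set M, (Set.univ : Set M).Definable₁ L D →
    D ∈ BooleanSubalgebra.closure {C : Set M | IsConvex lt C ∨ C ∈ definableAlgebra L ∅}

end Structure
end BinaryReducts

namespace BinaryReducts
open FirstOrder Set

/-! ### Compactness in an `ℵ₀`-saturated structure -/

section Saturation

variable {M : Type w} {L : FirstOrder.Language.{u, v}} [L.Structure M] {A : Set M}

theorem DefPred.all_tuple {α β : Type*} [Finite β] {P : (α → M) → (β → M) → Prop}
    (hP : DefPred L A fun w : α ⊕ β → M => P (fun i => w (Sum.inl i)) (fun i => w (Sum.inr i))) :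
    DefPred L A fun v => ∀ u, P v u :=
  Set.Definable.forall_of_finite (L := L) (A := A) hP

/-- Otherwise the complements form a type over `A`, finitely satisfiable by directedness, and a
realization would lie in no `Ψ i`. -/
theorem IsAleph0Saturated.exists_eq_univ (hM : IsAleph0Saturated L M) (hA : A.Finite)
    {ι : Type*} [Nonempty ι] (Ψ : ι → Set M) (hdir : Directed (· ⊆ ·) Ψ)
    (hdef : ∀ i, Ψ i ∈ unarySets L A) (hcov : ∀ x, ∃ i, x ∈ Ψ i) : ∃ i, ∀ x, x ∈ Ψ i := by
  classical
  by_contra! hne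
  choose φ hφ using hdef
  have hφ' : ∀ i a, (φ i).Realize (fun _ => a) ↔ a ∈ Ψ i := fun i a =>
    (Set.ext_iff.1 (hφ i) fun _ => a).symm
  obtain ⟨a, ha⟩ := hM A hA (Set.range fun i => (φ i).not) fun q hq => by
    choose! idx hidx using hq
    obtain ⟨i, hi⟩ := hdir.finset_le (q.image idx)
    obtain ⟨a, ha⟩ := hne i
    refine ⟨a, fun ψ hψ => ?_⟩
    rw [← hidx hψ, Language.Formula.realize_not, hφ']
    exact fun h => ha (hi _ (Finset.mem_image_of_mem _ hψ) h)
  obtain ⟨i, hi⟩ := hcov a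
  have := ha _ (Set.mem_range_self i)
  rw [Language.Formula.realize_not, hφ'] at this
  exact this hi

/-- With the first coordinate `a` fixed, the induction hypothesis over `A ∪ {a}` finds an index that
works for all tails. The sets of those `a` for which a given index works are then a directed
definable cover. -/
theorem IsAleph0Saturated.exists_eq_univ_tuple (hM : IsAleph0Saturated L M) {k : ℕ}
    (hA : A.Finite) {ι : Type*} [Nonempty ι] (Ψ : ι → (Fin k → M) → Prop)
    (hdir : ∀ i j, ∃ l, ∀ v, (Ψ i v ∨ Ψ j v) → Ψ l v)
    (hdef : ∀ i, DefPred L A (Ψ i)) (hcov : ∀ v, ∃ i, Ψ i v) : ∃ i, ∀ v, Ψ i v := by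
  induction k generalizing A with
  | zero =>
    obtain ⟨i, hi⟩ := hcov Fin.elim0
    exact ⟨i, fun v => Subsingleton.elim Fin.elim0 v ▸ hi⟩
  | succ k ih =>
    suffices h : ∃ i, ∀ a, a ∈ {a | ∀ v : Fin k → M, Ψ i (Fin.cons a v)} by
      obtain ⟨i, hi⟩ := h
      exact ⟨i, fun v => by simpa using hi (v 0) (Fin.tail v)⟩
    refine hM.exists_eq_univ hA
      (fun i => {a | ∀ v : Fin k → M, Ψ i (Fin.cons a v)}) ?_ ?_ ?_
    · intro i j
      obtain ⟨l, hl⟩ := hdir i j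
      exact ⟨l, fun a ha v => hl _ (Or.inl (ha v)), fun a ha v => hl _ (Or.inr (ha v))⟩
    · intro i
      refine DefPred.all_tuple (α := Fin 1) (β := Fin k)
        (P := fun u v => Ψ i (Fin.cons (u 0) v)) ?_
      refine ((hdef i).comp (Fin.cons (Sum.inl 0) Sum.inr)).congr fun v => ?_
      refine iff_of_eq (congrArg _ (funext fun j => ?_))
      refine Fin.cases ?_ (fun j => ?_) j <;> simp
    · intro a
      refine ih (hA.insert a) (fun i v => Ψ i (Fin.cons a v)) (fun i j => ?_) (fun i => ?_)
        fun v => hcov _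
      · obtain ⟨l, hl⟩ := hdir i j
        exact ⟨l, fun v => hl _⟩
      · refine ((hdef i).subst (Set.subset_insert a A)
          (Fin.cons (Sum.inl ⟨a, Set.mem_insert a A⟩) Sum.inr)).congr fun v => ?_
        refine iff_of_eq (congrArg _ (funext fun j => ?_))
        refine Fin.cases ?_ (fun j => ?_) j <;> simp

theorem DefPred.altOn {α : Type*} {lt : M → M → Prop} (hlt : lt ∈ binaryRels L A) {X : Set M}
    (hX : X ∈ unarySets L A) {R : (α → M) → M → Prop}
    (hR : DefPred L A fun w : α ⊕ Unit → M => R (fun i => w (Sum.inl i)) (w (Sum.inr ()))) (n : ℕ) :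
    DefPred L A fun w : α ⊕ Unit → M =>
      altOn lt X {x | R (fun i => w (Sum.inl i)) x} n (w (Sum.inr ())) := by
  induction n with
  | zero => exact defPred_unary hX _
  | succ n ih =>
    refine (defPred_unary hX _).and (DefPred.ex ((defPred_binary hlt _ _).and (DefPred.and ?_ ?_)))
    · exact DefPred.iff (hR.comp (Sum.elim (fun i => Sum.inl (Sum.inl i)) fun _ => Sum.inr ()))
        (hR.comp Sum.inl).not
    · exact ih.comp (Sum.elim (fun i => Sum.inl (Sum.inl i)) fun _ => Sum.inr ())

/-- In an `ℵ₀`-saturated weakly quasi-o-minimal structure, the fibres of a definable relation have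
uniformly bounded alternation on the pieces of a single finite cover. -/
theorem exists_uniform_bound {lt : M → M → Prop} [IsStrictTotalOrder M lt]
    (hlt : lt ∈ binaryRels L (∅ : Set M)) (hM : IsAleph0Saturated L M)
    (hW : IsWeaklyQuasiOMinimalStructure L M lt) (hA : A.Finite) {k : ℕ}
    {R : (Fin k → M) → M → Prop}
    (hR : DefPred L A fun w : Fin k ⊕ Unit → M => R (fun i => w (Sum.inl i)) (w (Sum.inr ()))) :
    ∃ (F : Finset (Set M)) (n : ℕ), (∀ X ∈ F, X ∈ unarySets L (∅ : Set M)) ∧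
      (∀ x, ∃ X ∈ F, x ∈ X) ∧ ∀ b, ∀ X ∈ F, ∀ x, ¬ altOn lt X {x | R b x} n x := by
  classical
  -- An index is a finite cover by `∅`-definable sets with a bound. Common refinements and maxima
  -- make the family directed, since alternation can only drop on smaller pieces.
  let ι := {F : Finset (Set M) // (∀ X ∈ F, X ∈ definableAlgebra L (∅ : Set M)) ∧
    (∀ x, ∃ X ∈ F, x ∈ X)} × ℕ
  have : Nonempty ι := ⟨⟨{⊤}, by simpa using (definableAlgebra L (∅ : Set M)).top_mem,
    by simp⟩, 0⟩
  suffices h : ∃ i : ι, ∀ b, ∀ X ∈ i.1.1, ∀ x, ¬ altOn lt X {x | R b x} i.2 x by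
    obtain ⟨⟨F, n⟩, h⟩ := h
    exact ⟨F.1, n, F.2.1, F.2.2, h⟩
  refine hM.exists_eq_univ_tuple hA
    (fun (i : ι) b => ∀ X ∈ i.1.1, ∀ x, ¬ altOn lt X {x | R b x} i.2 x) ?_ ?_ ?_
  · rintro ⟨⟨F, hF, hFc⟩, n⟩ ⟨⟨G, hG, hGc⟩, m⟩
    refine ⟨⟨⟨(F ×ˢ G).image fun p => p.1 ∩ p.2, ?_, ?_⟩, max n m⟩, ?_⟩
    · intro X hX
      obtain ⟨⟨U, V⟩, hUV, rfl⟩ := Finset.mem_image.1 hX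
      obtain ⟨hU, hV⟩ := Finset.mem_product.1 hUV
      exact (definableAlgebra L (∅ : Set M)).inf_mem (hF _ hU) (hG _ hV)
    · intro x
      obtain ⟨U, hU, hxU⟩ := hFc x
      obtain ⟨V, hV, hxV⟩ := hGc x
      exact ⟨U ∩ V, Finset.mem_image.2 ⟨(U, V), Finset.mem_product.2 ⟨hU, hV⟩, rfl⟩, hxU, hxV⟩
    · intro b hb X hX x hx
      obtain ⟨⟨U, V⟩, hUV, rfl⟩ := Finset.mem_image.1 hX
      obtain ⟨hU, hV⟩ := Finset.mem_product.1 hUV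
      rcases hb with hb | hb
      · exact hb U hU x ((hx.mono Set.inter_subset_left).anti (le_max_left _ _))
      · exact hb V hV x ((hx.mono Set.inter_subset_right).anti (le_max_right _ _))
  · rintro ⟨⟨F, hF, hFc⟩, n⟩
    refine DefPred.finset_and F fun X hX => ?_
    exact DefPred.all (DefPred.altOn (binaryRels_mono (Set.empty_subset A) hlt)
      (unarySets_mono (Set.empty_subset A) (hF X hX)) hR n).not
  · intro b
    have hD : (Set.univ : Set M).Definable₁ L {x | R b x} :=
      hR.subst (B := Set.univ) (β := Fin 1) (Set.subset_univ A)
        (Sum.elim (fun i => Sum.inl ⟨b i, Set.mem_univ _⟩) fun _ => Sum.inr 0)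
    obtain ⟨F, n, hF, hFc, hFn⟩ := mem_closure_convex_iff.1 (hW _ hD)
    exact ⟨⟨⟨F, hF, hFc⟩, n⟩, hFn⟩

theorem exists_uniform_bound_binary {lt : M → M → Prop} [IsStrictTotalOrder M lt]
    (hlt : lt ∈ binaryRels L (∅ : Set M)) (hM : IsAleph0Saturated L M)
    (hW : IsWeaklyQuasiOMinimalStructure L M lt) (hA : A.Finite) {R : M → M → Prop}
    (hR : R ∈ binaryRels L A) :
    ∃ (F : Finset (Set M)) (n : ℕ), (∀ X ∈ F, X ∈ unarySets L (∅ : Set M)) ∧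
      (∀ x, ∃ X ∈ F, x ∈ X) ∧ ∀ X ∈ F, ∀ b x, ¬ altOn lt X {x | R x b} n x := by
  obtain ⟨F, n, hF, hFc, h⟩ := exists_uniform_bound (k := 1) (R := fun b x => R x (b 0)) hlt hM hW
    hA (defPred_binary hR _ _)
  exact ⟨F, n, hF, hFc, fun X hX b => h (fun _ => b) X hX⟩

end Saturation
end BinaryReducts

namespace BinaryReducts
open FirstOrder Set

/-! ### Orders reversed along convex equivalence relations -/

section ReverseOrders

variable {M : Type w} {lt r E F : M → M → Prop}

theorem isStrictTotalOrder_of (hi : ∀ a, ¬ r a a) (ht : ∀ a b c, r a b → r b c → r a c)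
    (hc : ∀ a b, r a b ∨ a = b ∨ r b a) : IsStrictTotalOrder M r where
  trichotomous a b h h' := by
    have := hc a b
    tauto
  irrefl := hi
  trans := ht

theorem isStrictTotalOrder_flip [IsStrictTotalOrder M r] :
    IsStrictTotalOrder M fun x y => r y x :=
  isStrictTotalOrder_of (fun a => irrefl_of r a) (fun _ _ _ h h' => _root_.trans h' h)
    fun a b => by have := trichotomous_of r a b; tauto

theorem IsConvexEquivalence.equiv_of_between (hE : IsConvexEquivalence lt E) {a b c : M}
    (hab : lt a b) (hbc : lt b c) (hac : E a c) : E a b :=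
  hE.2 a a (hE.1.refl a) c hac b hab hbc

theorem IsConvexEquivalence.equiv_of_between' (hE : IsConvexEquivalence lt E) {a b c : M}
    (hab : lt a b) (hbc : lt b c) (hac : E a c) : E b c :=
  hE.1.trans (hE.1.symm (hE.equiv_of_between hab hbc hac)) hac

theorem isConvexEquivalence_of (h : Equivalence E)
    (hc : ∀ a b c, lt a b → lt b c → E a c → E a b) : IsConvexEquivalence lt E :=
  ⟨h, fun _ x hx _ hy c hxc hcy => h.trans hx (hc x c _ hxc hcy (h.trans (h.symm hx) hy))⟩

theorem isStrictTotalOrder_reverseOn [IsStrictTotalOrder M lt] (hE : IsConvexEquivalence lt E) :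
    IsStrictTotalOrder M (reverseOn lt E) := by
  refine isStrictTotalOrder_of ?_ ?_ ?_
  · rintro a (⟨-, h⟩ | ⟨-, h⟩) <;> exact irrefl_of lt a h
  · rintro a b c (⟨hab, h⟩ | ⟨hab, h⟩) (⟨hbc, h'⟩ | ⟨hbc, h'⟩)
    · exact Or.inl ⟨hE.1.trans hab hbc, _root_.trans h' h⟩
    · have hac : ¬ E a c := fun hac => hbc (hE.1.trans (hE.1.symm hab) hac)
      refine Or.inr ⟨hac, ?_⟩
      rcases trichotomous_of lt a c with h1 | rfl | h1
      · exact h1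
      · exact (hac (hE.1.refl a)).elim
      · exact (hbc (hE.equiv_of_between h' h1 (hE.1.symm hab))).elim
    · have hac : ¬ E a c := fun hac => hab (hE.1.trans hac (hE.1.symm hbc))
      refine Or.inr ⟨hac, ?_⟩
      rcases trichotomous_of lt a c with h1 | rfl | h1
      · exact h1
      · exact (hac (hE.1.refl a)).elim
      · exact (hac (hE.1.symm (hE.equiv_of_between h1 h (hE.1.symm hbc)))).elim
    · have hac : ¬ E a c := fun hac => hab (hE.equiv_of_between h h' hac)
      exact Or.inr ⟨hac, _root_.trans h h'⟩
  · intro a b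
    by_cases hab : E a b
    · rcases trichotomous_of lt a b with h | h | h
      · exact Or.inr (Or.inr (Or.inl ⟨hE.1.symm hab, h⟩))
      · exact Or.inr (Or.inl h)
      · exact Or.inl (Or.inl ⟨hab, h⟩)
    · rcases trichotomous_of lt a b with h | h | h
      · exact Or.inl (Or.inr ⟨hab, h⟩)
      · exact Or.inr (Or.inl h)
      · exact Or.inr (Or.inr (Or.inr ⟨fun h => hab (hE.1.symm h), h⟩))

theorem reverseAlong_cons (Es : List (M → M → Prop)) :
    reverseAlong lt (E :: Es) = reverseAlong (reverseOn lt E) Es := rfl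

theorem reverseAlong_concat (Es : List (M → M → Prop)) :
    reverseAlong lt (Es ++ [E]) = reverseOn (reverseAlong lt Es) E := by
  simp [reverseAlong]

theorem isAdmissible_concat_iff {Es : List (M → M → Prop)} :
    IsAdmissible lt (Es ++ [E]) ↔
      IsAdmissible lt Es ∧ IsConvexEquivalence (reverseAlong lt Es) E := by
  induction Es generalizing lt with
  | nil => simp [IsAdmissible, reverseAlong]
  | cons F Es ih => simp only [List.cons_append, IsAdmissible, ih, reverseAlong_cons, and_assoc]

theorem isStrictTotalOrder_reverseAlong [hlt : IsStrictTotalOrder M lt]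
    {Es : List (M → M → Prop)} (h : IsAdmissible lt Es) :
    IsStrictTotalOrder M (reverseAlong lt Es) := by
  induction Es generalizing lt with
  | nil => exact hlt
  | cons E Es ih =>
    have := isStrictTotalOrder_reverseOn h.1
    exact ih h.2

/-- `F`-equivalent endpoints share an `E`-class, and flipping the order inside that class does not
affect betweenness. -/
theorem IsConvexEquivalence.reverseOn_of_refines (hE : IsConvexEquivalence lt E)
    (hF : IsConvexEquivalence lt F) (hFE : ∀ x y, F x y → E x y) :
    IsConvexEquivalence (reverseOn lt E) F := by
  refine isConvexEquivalence_of hF.1 ?_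
  rintro a b c (⟨hab, h⟩ | ⟨hab, h⟩) (⟨hbc, h'⟩ | ⟨hbc, h'⟩) hac
  · exact hF.1.trans hac (hF.equiv_of_between h' h (hF.1.symm hac))
  · exact (hbc (hE.1.trans (hE.1.symm hab) (hFE _ _ hac))).elim
  · exact (hab (hE.1.trans (hFE _ _ hac) (hE.1.symm hbc))).elim
  · exact hF.equiv_of_between h h' hac

theorem isAdmissible_of_isDecreasing {Es : List (M → M → Prop)}
    (hEs : ∀ E ∈ Es, IsConvexEquivalence lt E) (hd : IsDecreasing Es) : IsAdmissible lt Es := by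
  induction Es generalizing lt with
  | nil => trivial
  | cons E Es ih =>
    have hE := hEs E (by simp)
    obtain ⟨h1, h2⟩ := List.pairwise_cons.1 hd
    exact ⟨hE, ih (fun F hF => hE.reverseOn_of_refines (hEs F (by simp [hF])) (h1 F hF)) h2⟩

theorem reverseAlong_congr {Es : List (M → M → Prop)} (hE : ∀ E ∈ Es, Equivalence E)
    {x y : M} {lt' : M → M → Prop} (h1 : lt x y ↔ lt' x y) (h2 : lt y x ↔ lt' y x) :
    reverseAlong lt Es x y ↔ reverseAlong lt' Es x y := by
  induction Es generalizing lt lt' with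
  | nil => exact h1
  | cons E Es ih =>
    refine ih (fun F hF => hE F (by simp [hF])) ?_ ?_ <;> simp only [reverseOn, h1, h2]

theorem reverseAlong_flip {Es : List (M → M → Prop)} (hE : ∀ E ∈ Es, Equivalence E) {x y : M} :
    reverseAlong (fun x y => lt y x) Es x y ↔ reverseAlong lt Es y x := by
  induction Es generalizing lt with
  | nil => exact Iff.rfl
  | cons E Es ih =>
    rw [reverseAlong_cons, reverseAlong_cons, ← ih fun F hF => hE F (by simp [hF])]
    have hs : ∀ x y, E x y ↔ E y x := fun x y =>
      ⟨(hE E (by simp)).symm, (hE E (by simp)).symm⟩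
    have : reverseOn (fun x y => lt y x) E = fun x y => reverseOn lt E y x := by
      funext x y
      simp only [reverseOn, hs x y]
    rw [this]

theorem reverseAlong_of_not {Es : List (M → M → Prop)} {x y : M} (h : ∀ E ∈ Es, ¬ E x y) :
    reverseAlong lt Es x y ↔ lt x y := by
  induction Es generalizing lt with
  | nil => exact Iff.rfl
  | cons E Es ih =>
    rw [reverseAlong_cons, ih fun F hF => h F (by simp [hF])]
    simp [reverseOn, h E (by simp)]

/-! ### Definability of the reversed orders -/

variable {L : FirstOrder.Language.{u, v}} [L.Structure M] {A : Set M}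

theorem reverseOn_mem_binaryRels (hlt : lt ∈ binaryRels L A) (hE : E ∈ binaryRels L A) :
    reverseOn lt E ∈ binaryRels L A :=
  ((defPred_binary hE _ _).and (defPred_binary hlt 1 0)).or
    ((defPred_binary hE _ _).not.and (defPred_binary hlt 0 1))

theorem reverseAlong_mem_binaryRels (hlt : lt ∈ binaryRels L A) {Es : List (M → M → Prop)}
    (hE : ∀ E ∈ Es, E ∈ binaryRels L A) : reverseAlong lt Es ∈ binaryRels L A := by
  induction Es generalizing lt with
  | nil => exact hlt
  | cons E Es ih =>
    exact ih (reverseOn_mem_binaryRels hlt (hE E (by simp))) fun F hF => hE F (by simp [hF])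

theorem weakOrders_subset_specialOrders : weakOrders L A lt ⊆ specialOrders L A lt :=
  fun _ ⟨Es, h1, h2, _, h4⟩ => ⟨Es, h1, h2, h4⟩

theorem isStrictTotalOrder_of_mem_specialOrders [IsStrictTotalOrder M lt]
    (h : r ∈ specialOrders L A lt) : IsStrictTotalOrder M r := by
  obtain ⟨Es, _, h2, rfl⟩ := h
  exact isStrictTotalOrder_reverseAlong h2

/-! ### Convex sets of the reversed orders -/

theorem mem_of_convex {B : BooleanSubalgebra (Set M)} [IsStrictTotalOrder M lt]
    (hB : ∀ C : Set M, (∀ a b, lt a b → b ∈ C → a ∈ C) → C ∈ B) {C : Set M}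
    (hC : IsConvex lt C) : C ∈ B := by
  refine mem_booleanSubalgebra_of_determined B
    {{x | ∃ y ∈ C, x = y ∨ lt x y}, {x | ∃ y ∈ C, lt y x ∨ y = x}ᶜ} ?_ C ?_
  · intro D hD
    rcases Finset.mem_insert.1 hD with rfl | hD
    · refine hB _ ?_
      rintro a b hab ⟨y, hy, rfl | hby⟩
      · exact ⟨_, hy, Or.inr hab⟩
      · exact ⟨y, hy, Or.inr (_root_.trans hab hby)⟩
    · rw [Finset.mem_singleton.1 hD]
      refine hB _ ?_
      rintro a b hab hb ⟨y, hy, hya | rfl⟩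
      · exact hb ⟨y, hy, Or.inl (_root_.trans hya hab)⟩
      · exact hb ⟨y, hy, Or.inl hab⟩
  · intro x y hxy hx
    obtain ⟨z, hz, hyz⟩ := (hxy {x | ∃ y ∈ C, x = y ∨ lt x y} (by simp)).1 ⟨x, hx, Or.inl rfl⟩
    have h2 := hxy {x | ∃ y ∈ C, lt y x ∨ y = x}ᶜ (by simp)
    have h3 : y ∈ {x | ∃ y ∈ C, lt y x ∨ y = x} := by
      by_contra h
      exact h2.2 h ⟨x, hx, Or.inr rfl⟩
    obtain ⟨t, ht, hty⟩ := h3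
    rcases hyz with rfl | hyz
    · exact hz
    · rcases hty with hty | rfl
      · exact hC t ht z hz y hty hyz
      · exact ht

theorem mem_of_convex_reverseOn {B : BooleanSubalgebra (Set M)} [IsStrictTotalOrder M lt]
    (hE : IsConvexEquivalence lt E) (hB : ∀ C, IsConvex lt C → C ∈ B) {C : Set M}
    (hC : IsConvex (reverseOn lt E) C) : C ∈ B := by
  have := isStrictTotalOrder_reverseOn hE
  refine mem_of_convex (lt := reverseOn lt E) (fun C hC => ?_) hC
  -- Here `C` is an initial segment of `<_E`. The classes contained in `C` form an `lt`-convex set,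
  -- and the rest of `C` lies in a single class, where reversal preserves convexity.
  refine mem_booleanSubalgebra_of_determined B
    {{x | ∀ y, E x y → y ∈ C}, {x | x ∈ C ∧ ¬ ∀ y, E x y → y ∈ C}} ?_ C ?_
  · intro D hD
    rcases Finset.mem_insert.1 hD with rfl | hD
    · refine hB _ fun a ha b hb c hac hcb y hcy => ?_
      by_cases hcb' : E c b
      · exact hb y (hE.1.trans (hE.1.symm hcb') hcy)
      · refine hC y b (Or.inr ⟨fun h => hcb' (hE.1.trans hcy h), ?_⟩) (hb b (hE.1.refl b))
        rcases trichotomous_of lt y b with h | rfl | h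
        · exact h
        · exact (hcb' hcy).elim
        · exact (hcb' (hE.equiv_of_between hcb h hcy)).elim
    · rw [Finset.mem_singleton.1 hD]
      refine hB _ ?_
      rintro a ⟨ha, ha'⟩ b ⟨hb, hb'⟩ c hac hcb
      have hab : E a b := by
        by_contra hab
        refine ha' fun y hay => hC y b (Or.inr ⟨fun h => hab (hE.1.trans hay h), ?_⟩) hb
        rcases trichotomous_of lt y b with h | rfl | h
        · exact h
        · exact (hab hay).elim
        · exact (hab (hE.equiv_of_between (_root_.trans hac hcb) h hay)).elim
      have hac' := hE.equiv_of_between hac hcb hab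
      refine ⟨hC c a (Or.inl ⟨hE.1.symm hac', hac⟩) ha, fun h => ha' fun y hay => ?_⟩
      exact h y (hE.1.trans (hE.1.symm hac') hay)
  · intro x y hxy hx
    have h1 := hxy {x | ∀ y, E x y → y ∈ C} (by simp)
    have h2 := hxy {x | x ∈ C ∧ ¬ ∀ y, E x y → y ∈ C} (by simp)
    by_cases hx' : ∀ y, E x y → y ∈ C
    · exact h1.1 hx' y (hE.1.refl y)
    · exact (h2.1 ⟨hx, hx'⟩).1

theorem reverseOn_reverseOn (hE : Equivalence E) : reverseOn (reverseOn lt E) E = lt := by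
  funext x y
  have : E x y ↔ E y x := ⟨hE.symm, hE.symm⟩
  by_cases h : E x y
  · simp [reverseOn, h, this.1 h]
  · simp [reverseOn, h]

theorem IsConvexEquivalence.reverseOn_self (hE : IsConvexEquivalence lt E) :
    IsConvexEquivalence (reverseOn lt E) E :=
  hE.reverseOn_of_refines hE fun _ _ h => h

theorem mem_of_convex_reverseAlong {B : BooleanSubalgebra (Set M)} [IsStrictTotalOrder M lt]
    {Es : List (M → M → Prop)} (hEs : IsAdmissible lt Es) (hB : ∀ C, IsConvex lt C → C ∈ B)
    {C : Set M} (hC : IsConvex (reverseAlong lt Es) C) : C ∈ B := by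
  induction Es generalizing lt with
  | nil => exact hB C hC
  | cons E Es ih =>
    have := isStrictTotalOrder_reverseOn hEs.1
    exact ih hEs.2 (fun C hC => mem_of_convex_reverseOn hEs.1 hB hC) hC

/-- Reversing twice along `E` restores the order, and `E` stays convex after the first reversal, so
the passage to `<_E⃗` can be undone one step at a time. -/
theorem mem_of_convex_of_reverseAlong {B : BooleanSubalgebra (Set M)} [IsStrictTotalOrder M lt]
    {Es : List (M → M → Prop)} (hEs : IsAdmissible lt Es)
    (hB : ∀ C, IsConvex (reverseAlong lt Es) C → C ∈ B)
    {C : Set M} (hC : IsConvex lt C) : C ∈ B := by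
  induction Es generalizing lt C with
  | nil => exact hB C hC
  | cons E Es ih =>
    have := isStrictTotalOrder_reverseOn hEs.1
    refine mem_of_convex_reverseOn (lt := reverseOn lt E) hEs.1.reverseOn_self
      (fun C hC => ih hEs.2 hB hC) ?_
    rwa [reverseOn_reverseOn hEs.1.1]

end ReverseOrders
end BinaryReducts

namespace BinaryReducts
open FirstOrder Set

/-! ### Comparing two linear orders with bounded alternation -/

section Inversions

variable {M : Type w} [LinearOrder M] (tl : M → M → Prop) (X : Set M) (E : M → M → Prop)

/-- There is a chain `y = y₀ < y₁ < … < yₖ` in `X` and in the `E`-class of `x` along which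
`tl yᵢ x` alternates, and which ends with `tl yₖ x`. -/
def inversionChain (x : M) : ℕ → M → Prop
  | 0, y => tl y x
  | k + 1, y => ∃ z, y < z ∧ z ∈ X ∧ E x z ∧ (tl z x ↔ ¬ tl y x) ∧ inversionChain x k z

/-- An inversion chain with `k` alternations starts at some `y > x`. -/
def HasInversionChain (k : ℕ) (x : M) : Prop :=
  ∃ y, x < y ∧ y ∈ X ∧ E x y ∧ inversionChain tl X E x k y

/-- Some `z ≥ y` in `X` and in the `E`-class of `x` is inverted with `x`. -/
def inversionHull (x y : M) : Prop := ∃ z, z ∈ X ∧ y ≤ z ∧ E x z ∧ tl z x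

/-- The elements of `X` at the top of a tower of `k` obstructions to the transitivity of the
inversion hull. -/
def obstructionSet : ℕ → Set M
  | 0 => X
  | k + 1 => {c | c ∈ X ∧ ∃ a, a ∈ obstructionSet k ∧ ∃ d, d ∈ X ∧ a < d ∧ d < c ∧ E a c ∧ tl c a ∧
      ¬ inversionHull tl X E d c}

variable {tl X E} {Y : Set M} {k m N : ℕ} {a b c d x y : M}

theorem HasInversionChain.pred (h : HasInversionChain tl X E (k + 1) x) :
    HasInversionChain tl X E k x := by
  obtain ⟨y, hxy, _, _, z, hyz, hz, hxz, _, hc⟩ := h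
  exact ⟨z, hxy.trans hyz, hz, hxz, hc⟩

theorem inversionChain.mono (hYX : Y ⊆ X) (h : inversionChain tl Y E x k y) :
    inversionChain tl X E x k y := by
  induction k generalizing y with
  | zero => exact h
  | succ k ih =>
    obtain ⟨z, hyz, hz, hxz, hs, hc⟩ := h
    exact ⟨z, hyz, hYX hz, hxz, hs, ih hc⟩

theorem HasInversionChain.mono (hYX : Y ⊆ X) (h : HasInversionChain tl Y E k x) :
    HasInversionChain tl X E k x :=
  let ⟨y, hxy, hy, hE, hc⟩ := h
  ⟨y, hxy, hYX hy, hE, hc.mono hYX⟩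

theorem inversionChain.altOn (hy : y ∈ X) (h : inversionChain tl X E x k y) :
    altOn (· < ·) X {z | tl z x} k y := by
  induction k generalizing y with
  | zero => exact hy
  | succ k ih =>
    obtain ⟨z, hyz, hz, _, hs, hc⟩ := h
    exact ⟨hy, z, hyz, hs, ih hz hc⟩

/-- If no point of `Y` at or above `c` is inverted with `x`, then the chain in `Y` ends below `c`.
It can be continued by `c`, which is not inverted, and by the witness from `X`, which is. That makes
`m + 2` alternations in `X`, too many. -/
theorem inversionHull_of_subset [IsStrictTotalOrder M tl] (hYX : Y ⊆ X) (hc : c ∈ Y)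
    (hE : E x c)
    (hx : HasInversionChain tl Y E m x) (hx' : ¬ HasInversionChain tl X E (m + 1) x)
    (h : inversionHull tl X E x c) : inversionHull tl Y E x c := by
  by_contra hno
  have hright : ∀ z ∈ Y, c ≤ z → E x z → ¬ tl z x := fun z hz hcz hEz htl =>
    hno ⟨z, hz, hcz, hEz, htl⟩
  obtain ⟨z, hz, hcz, hEz, htl⟩ := h
  have hcz' : c < z := by
    refine lt_of_le_of_ne hcz ?_
    rintro rfl
    exact hright _ hc le_rfl hE htl
  have key : ∀ k y, y ∈ Y → E x y → inversionChain tl Y E x k y →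
      inversionChain tl X E x (k + 2) y := by
    intro k
    induction k with
    | zero =>
      intro y hy hEy htly
      have hyc : y < c := by
        by_contra hcy
        exact hright y hy (not_lt.1 hcy) hEy htly
      exact ⟨c, hyc, hYX hc, hE, iff_of_false (hright c hc le_rfl hE) (not_not.2 htly),
        z, hcz', hz, hEz, iff_of_true htl (hright c hc le_rfl hE), htl⟩
    | succ k ih =>
      rintro y hy hEy ⟨t, hyt, ht, hEt, hs, hch⟩
      exact ⟨t, hyt, hYX ht, hEt, hs, ih t ht hEt hch⟩
  obtain ⟨y, hxy, hy, hEy, hch⟩ := hx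
  exact hx' (HasInversionChain.pred ⟨y, hxy, hYX hy, hEy, key m y hy hEy hch⟩)

theorem obstructionSet_subset : obstructionSet tl X E k ⊆ X := by
  cases k with
  | zero => exact fun _ h => h
  | succ k => exact fun _ h => h.1

/-- Each obstruction `a < d < c` below the top `c₀` of a tower adds two alternations to `{x | tl x
c₀}`. The point `d` precedes `c₀`, for otherwise `c₀` would witness the hull that fails at `d` and
`c`; the points `a` and `c` do not precede `c₀`. -/
theorem obstructionSet_eq_empty [IsStrictTotalOrder M tl] (hE : IsConvexEquivalence (· < ·) E)
    (hN : ∀ c x, ¬ altOn (· < ·) X {x | tl x c} N x) : c ∉ obstructionSet tl X E N := by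
  -- The top `c₀` stays fixed while the tower is descended; `j` counts the alternations collected
  -- above `c`.
  have key : ∀ c₀ ∈ X, ∀ k j c, c ∈ obstructionSet tl X E k → c ≤ c₀ → E c c₀ →
      (c₀ = c ∨ tl c₀ c) → altOn (· < ·) X {x | tl x c₀} j c →
      ∃ x, altOn (· < ·) X {x | tl x c₀} (j + 2 * k) x := by
    intro c₀ hc₀ k
    induction k with
    | zero => exact fun j c _ _ _ _ h => ⟨c, h⟩
    | succ k ih =>
      rintro j c ⟨hc, a, ha, d, hd, had, hdc, hac, hca, hU⟩ hcc₀ hEc htl halt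
      have hdc' : E d c := hE.equiv_of_between' had hdc hac
      have hEd : E d c₀ := hE.1.trans hdc' hEc
      have hdS : tl d c₀ := by
        rcases trichotomous_of tl d c₀ with h | h | h
        · exact h
        · exact absurd hdc (h ▸ not_lt.2 hcc₀)
        · exact (hU ⟨c₀, hc₀, hcc₀, hEd, h⟩).elim
      have hcS : ¬ tl c c₀ := by
        rcases htl with rfl | htl
        · exact irrefl_of tl c₀
        · exact asymm_of tl htl
      have hc₀a : tl c₀ a := by
        rcases htl with rfl | htl
        · exact hca
        · exact _root_.trans htl hca
      have haS : ¬ tl a c₀ := asymm_of tl hc₀a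
      obtain ⟨x, hx⟩ := ih (j + 2) a ha (had.trans hdc |>.le.trans hcc₀) (hE.1.trans hac hEc)
        (Or.inr hc₀a) ⟨obstructionSet_subset ha, d, had, iff_of_true hdS haS, hd, c, hdc,
          iff_of_false hcS (not_not.2 hdS), halt⟩
      exact ⟨x, by rwa [show j + 2 + 2 * k = j + 2 * (k + 1) by ring] at hx⟩
  intro hc
  have hcX := obstructionSet_subset hc
  obtain ⟨x, hx⟩ := key c hcX N 0 c hc le_rfl (hE.1.refl c) (Or.inl rfl) hcX
  exact hN c x (hx.anti (by omega))

/-! ### Extending an equivalence relation on a subset by convex hulls -/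

/-- The convex hull of a relation `G` on `Y`. -/
def convexHullRel (Y : Set M) (G : M → M → Prop) (x y : M) : Prop :=
  x = y ∨ ∃ s, s ∈ Y ∧ ∃ t, t ∈ Y ∧ G s t ∧ s ≤ x ∧ x ≤ t ∧ s ≤ y ∧ y ≤ t

variable {G : M → M → Prop}

/-- When two hull intervals meet, convexity of `G` relates their left endpoints, and transitivity
makes their union a hull interval. -/
theorem isConvexEquivalence_convexHullRel
    (htrans : ∀ a ∈ Y, ∀ b ∈ Y, ∀ c ∈ Y, G a b → G b c → G a c)
    (hconv : ∀ a ∈ Y, ∀ b ∈ Y, ∀ c ∈ Y, a ≤ b → b ≤ c → G a c → G a b) :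
    IsConvexEquivalence (· < ·) (convexHullRel Y G) := by
  have hsym : ∀ {x y}, convexHullRel Y G x y → convexHullRel Y G y x := by
    rintro x y (rfl | ⟨s, hs, t, ht, hG, h1, h2, h3, h4⟩)
    · exact Or.inl rfl
    · exact Or.inr ⟨s, hs, t, ht, hG, h3, h4, h1, h2⟩
  have key : ∀ x y z s t s' t', s ∈ Y → t ∈ Y → s' ∈ Y → t' ∈ Y → G s t → G s' t' → s ≤ x → x ≤ t →
      s ≤ y → y ≤ t → s' ≤ y → y ≤ t' → s' ≤ z → z ≤ t' → s ≤ s' → convexHullRel Y G x z := by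
    intro x y z s t s' t' hs ht hs' ht' hG hG' h1 h2 h3 h4 h5 h6 h7 h8 hss
    have hss' : G s s' := hconv s hs s' hs' t ht hss (h5.trans h4) hG
    rcases le_total t t' with htt | htt
    · exact Or.inr ⟨s, hs, t', ht', htrans s hs s' hs' t' ht' hss' hG', h1, h2.trans htt,
        hss.trans h7, h8⟩
    · exact Or.inr ⟨s, hs, t, ht, hG, h1, h2, hss.trans h7, h8.trans htt⟩
  refine isConvexEquivalence_of ⟨fun _ => Or.inl rfl, hsym, ?_⟩ ?_
  · rintro x y z (rfl | ⟨s, hs, t, ht, hG, h1, h2, h3, h4⟩) hyz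
    · exact hyz
    rcases hyz with rfl | ⟨s', hs', t', ht', hG', h5, h6, h7, h8⟩
    · exact Or.inr ⟨s, hs, t, ht, hG, h1, h2, h3, h4⟩
    rcases le_total s s' with hss | hss
    · exact key x y z s t s' t' hs ht hs' ht' hG hG' h1 h2 h3 h4 h5 h6 h7 h8 hss
    · exact hsym (key z y x s' t' s t hs' ht' hs ht hG' hG h7 h8 h5 h6 h3 h4 h1 h2 hss)
  · rintro a b c hab hbc (rfl | ⟨s, hs, t, ht, hG, h1, h2, h3, h4⟩)
    · exact absurd (hab.trans hbc) (lt_irrefl _)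
    · exact Or.inr ⟨s, hs, t, ht, hG, h1, h2, h1.trans hab.le, hbc.le.trans h4⟩

theorem convexHullRel_of_mem
    (htrans : ∀ a ∈ Y, ∀ b ∈ Y, ∀ c ∈ Y, G a b → G b c → G a c)
    (hsymm : ∀ a b, G a b → G b a)
    (hconv : ∀ a ∈ Y, ∀ b ∈ Y, ∀ c ∈ Y, a ≤ b → b ≤ c → G a c → G a b)
    (hx : x ∈ Y) (hy : y ∈ Y) (h : convexHullRel Y G x y) : x = y ∨ G x y := by
  rcases h with h | ⟨s, hs, t, ht, hG, h1, h2, h3, h4⟩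
  · exact Or.inl h
  · have hsx := hconv s hs x hx t ht h1 h2 hG
    have hsy := hconv s hs y hy t ht h3 h4 hG
    exact Or.inr (htrans x hx s hs y hy (hsymm _ _ hsx) hsy)

theorem convexHullRel_refines (hE : IsConvexEquivalence (· < ·) E) (hG : ∀ a b, G a b → E a b)
    (h : convexHullRel Y G x y) : E x y := by
  have hle : ∀ a b c, a ≤ b → b ≤ c → E a c → E a b := by
    intro a b c hab hbc hac
    rcases hab.eq_or_lt with rfl | hab
    · exact hE.1.refl _
    rcases hbc.eq_or_lt with rfl | hbc
    · exact hac
    exact hE.equiv_of_between hab hbc hac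
  rcases h with rfl | ⟨s, hs, t, ht, hst, h1, h2, h3, h4⟩
  · exact hE.1.refl _
  · exact hE.1.trans (hE.1.symm (hle s x t h1 h2 (hG _ _ hst))) (hle s y t h3 h4 (hG _ _ hst))

end Inversions

/-! ### Partitioning into pieces on which one order is obtained from the other by reversals -/

section Pieces

variable {M : Type w} (L : FirstOrder.Language.{u, v}) [L.Structure M] (A : Set M)

/-- `D` is `A`-definable and there is a decreasing sequence of `A`-definable `lt`-convex equivalence
relations refining `E` such that the associated order agrees with `tl` on the `E`-classes of `D`. -/
def IsAlignedPiece (lt tl E : M → M → Prop) (D : Set M) : Prop :=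
  D ∈ unarySets L A ∧ ∃ Es : List (M → M → Prop),
    (∀ F ∈ Es, F ∈ binaryRels L A ∧ IsConvexEquivalence lt F ∧ ∀ x y, F x y → E x y) ∧
    IsDecreasing Es ∧ ∀ x ∈ D, ∀ y ∈ D, E x y → (tl x y ↔ reverseAlong lt Es x y)

/-- `X` is a finite union of aligned pieces. -/
def IsAlignable (lt tl E : M → M → Prop) (X : Set M) : Prop :=
  ∃ F : Set (Set M), F.Finite ∧ (∀ x ∈ X, ∃ D ∈ F, x ∈ D) ∧
    ∀ D ∈ F, D ⊆ X ∧ IsAlignedPiece L A lt tl E D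

variable {L A} {lt tl E : M → M → Prop} {X Y : Set M}

theorem IsAlignable.of_finite_union {ι : Type*} {s : Set ι} (hs : s.Finite) {Y : ι → Set M}
    (h : ∀ i ∈ s, IsAlignable L A lt tl E (Y i)) (hsub : ∀ i ∈ s, Y i ⊆ X)
    (hcov : ∀ x ∈ X, ∃ i ∈ s, x ∈ Y i) : IsAlignable L A lt tl E X := by
  choose! F hF hFc hFp using h
  refine ⟨⋃ i ∈ s, F i, hs.biUnion hF, ?_, ?_⟩
  · intro x hx
    obtain ⟨i, hi, hxi⟩ := hcov x hx
    obtain ⟨D, hD, hxD⟩ := hFc i hi x hxi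
    exact ⟨D, Set.mem_biUnion hi hD, hxD⟩
  · intro D hD
    obtain ⟨i, hi, hDi⟩ := Set.mem_iUnion₂.1 hD
    exact ⟨(hFp i hi D hDi).1.trans (hsub i hi), (hFp i hi D hDi).2⟩

/-- An alignment inside the classes of `E₀`, up to a reversal, extends to an alignment inside the
classes of a coarser relation when both orders agree between the `E₀`-classes. -/
theorem IsAlignable.cons_reverse [IsStrictTotalOrder M tl] {E₀ : M → M → Prop}
    (hE₀ : IsConvexEquivalence lt E₀) (hE₀d : E₀ ∈ binaryRels L A)
    (hE : ∀ x y, E₀ x y → E x y)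
    (hout : ∀ x ∈ X, ∀ y ∈ X, E x y → ¬ E₀ x y → (tl x y ↔ lt x y))
    (h : IsAlignable L A lt (fun x y => tl y x) E₀ X) : IsAlignable L A lt tl E X := by
  obtain ⟨F, hF, hFc, hFp⟩ := h
  refine ⟨F, hF, hFc, fun D hD => ?_⟩
  obtain ⟨hDX, hDd, Es, hEs, hdec, hal⟩ := hFp D hD
  refine ⟨hDX, hDd, E₀ :: Es, ?_, ?_, ?_⟩
  · rintro G (_ | ⟨_, hG⟩)
    · exact ⟨hE₀d, hE₀, hE⟩
    · exact ⟨(hEs G hG).1, (hEs G hG).2.1, fun x y hxy => hE x y ((hEs G hG).2.2 x y hxy)⟩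
  · exact List.pairwise_cons.2 ⟨fun G hG => (hEs G hG).2.2, hdec⟩
  · intro x hx y hy hxy
    have heq : ∀ G ∈ Es, Equivalence G := fun G hG => (hEs G hG).2.1.1
    rw [reverseAlong_cons]
    by_cases h₀ : E₀ x y
    · have h₀' := hE₀.1.symm h₀
      refine (hal y hy x hx h₀').trans ?_
      rw [← reverseAlong_flip heq]
      exact reverseAlong_congr heq (by simp [reverseOn, h₀]) (by simp [reverseOn, h₀'])
    · rw [reverseAlong_of_not fun G hG h => h₀ ((hEs G hG).2.2 x y h),
        hout x (hDX hx) y (hDX hy) hxy h₀]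
      simp [reverseOn, h₀]

/-! ### Definability of the auxiliary relations -/

section

variable [LinearOrder M] {G : M → M → Prop}

theorem inversionChain_mem_binaryRels (hlt : (· < · : M → M → Prop) ∈ binaryRels L A)
    (htl : tl ∈ binaryRels L A) (hE : E ∈ binaryRels L A) (hX : X ∈ unarySets L A) (k : ℕ) :
    (fun x y => inversionChain tl X E x k y) ∈ binaryRels L A := by
  induction k with
  | zero => exact defPred_binary htl 1 0
  | succ k ih =>
    exact DefPred.ex ((defPred_binary hlt _ _).and ((defPred_unary hX _).and
      ((defPred_binary hE _ _).and (((defPred_binary htl _ _).iff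
        (defPred_binary htl _ _).not).and (defPred_binary ih _ _)))))

theorem hasInversionChain_mem_unarySets (hlt : (· < · : M → M → Prop) ∈ binaryRels L A)
    (htl : tl ∈ binaryRels L A) (hE : E ∈ binaryRels L A) (hX : X ∈ unarySets L A) (k : ℕ) :
    {x | HasInversionChain tl X E k x} ∈ unarySets L A :=
  DefPred.ex ((defPred_binary hlt _ _).and ((defPred_unary hX _).and ((defPred_binary hE _ _).and
    (defPred_binary (inversionChain_mem_binaryRels hlt htl hE hX k) _ _))))

theorem defPred_le {α : Type*} (hlt : (· < · : M → M → Prop) ∈ binaryRels L A) (i j : α) :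
    DefPred L A fun v : α → M => v i ≤ v j :=
  (defPred_binary hlt j i).not.congr fun _ => not_lt

theorem inversionHull_mem_binaryRels (hlt : (· < · : M → M → Prop) ∈ binaryRels L A)
    (htl : tl ∈ binaryRels L A) (hE : E ∈ binaryRels L A) (hX : X ∈ unarySets L A) :
    inversionHull tl X E ∈ binaryRels L A :=
  DefPred.ex ((defPred_unary hX _).and ((defPred_le hlt _ _).and ((defPred_binary hE _ _).and
    (defPred_binary htl _ _))))

theorem obstructionSet_mem_unarySets (hlt : (· < · : M → M → Prop) ∈ binaryRels L A)
    (htl : tl ∈ binaryRels L A) (hE : E ∈ binaryRels L A) (hX : X ∈ unarySets L A) (k : ℕ) :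
    obstructionSet tl X E k ∈ unarySets L A := by
  induction k with
  | zero => exact hX
  | succ k ih =>
    exact (defPred_unary hX _).and (DefPred.ex ((defPred_unary ih _).and (DefPred.ex
      ((defPred_unary hX _).and ((defPred_binary hlt _ _).and ((defPred_binary hlt _ _).and
        ((defPred_binary hE _ _).and ((defPred_binary htl _ _).and
          (defPred_binary (inversionHull_mem_binaryRels hlt htl hE hX) _ _).not))))))))

theorem convexHullRel_mem_binaryRels (hlt : (· < · : M → M → Prop) ∈ binaryRels L A)
    (hG : G ∈ binaryRels L A) (hY : Y ∈ unarySets L A) : convexHullRel Y G ∈ binaryRels L A :=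
  (DefPred.eq _ _).or (DefPred.ex ((defPred_unary hY _).and (DefPred.ex ((defPred_unary hY _).and
    ((defPred_binary hG _ _).and ((defPred_le hlt _ _).and ((defPred_le hlt _ _).and
      ((defPred_le hlt _ _).and (defPred_le hlt _ _)))))))))

/-- Two points related by the inversion hull in either direction. -/
def inversionRel (tl : M → M → Prop) (X : Set M) (E : M → M → Prop) (x y : M) : Prop :=
  x = y ∨ (x < y ∧ E x y ∧ inversionHull tl X E x y) ∨ (y < x ∧ E y x ∧ inversionHull tl X E y x)

theorem inversionRel_mem_binaryRels (hlt : (· < · : M → M → Prop) ∈ binaryRels L A)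
    (htl : tl ∈ binaryRels L A) (hE : E ∈ binaryRels L A) (hX : X ∈ unarySets L A) :
    inversionRel tl X E ∈ binaryRels L A :=
  (DefPred.eq _ _).or (((defPred_binary hlt _ _).and ((defPred_binary hE _ _).and
      (defPred_binary (inversionHull_mem_binaryRels hlt htl hE hX) _ _))).or
    ((defPred_binary hlt _ _).and ((defPred_binary hE _ _).and
      (defPred_binary (inversionHull_mem_binaryRels hlt htl hE hX) _ _))))

theorem inversionRel_symm (a b : M) (h : inversionRel tl X E a b) : inversionRel tl X E b a := by
  rcases h with h | h | h
  · exact Or.inl h.symm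
  · exact Or.inr (Or.inr h)
  · exact Or.inr (Or.inl h)

theorem inversionRel_refines (hE : Equivalence E) (a b : M) (h : inversionRel tl X E a b) :
    E a b := by
  rcases h with rfl | h | h
  · exact hE.refl _
  · exact h.2.1
  · exact hE.symm h.2.1

/-- The transitivity of the inversion hull among points without obstructions at which the hull is
already witnessed in `Y`. -/
structure InversionStable (tl : M → M → Prop) (X : Set M) (E : M → M → Prop) (Y Z : Set M) :
    Prop where
  subset_left : Y ⊆ X
  subset_right : Z ⊆ Y
  no_obstruction : ∀ a ∈ Y, ∀ c ∈ Y, ∀ d ∈ X, a < d → d < c → E a c → tl c a →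
    inversionHull tl X E d c
  hull_eq : ∀ x ∈ Z, ∀ c ∈ Y, E x c → inversionHull tl X E x c → inversionHull tl Y E x c

/-! ### Transitivity of the inversion hull away from obstructions -/

namespace InversionStable

variable {Z : Set M} {a b c : M}

/-- The witness `z` satisfies `tl z a` with `a < b < z`, and the absence of an obstruction supplies
a point beyond `z` inverted with `b`. This covers the case of `rel_trans` in which two points are
both related to a common smaller one. -/
theorem hull_left (h : InversionStable tl X E Y Z)
    (ha : a ∈ Z) (hc : c ∈ Y) (hab : a < b) (hbc : b < c) (hac : E a c)
    (hU : inversionHull tl X E a c) (hb : b ∈ X) : inversionHull tl X E b c := by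
  obtain ⟨z, hz, hcz, hEz, htl⟩ := h.hull_eq a ha c hc hac hU
  obtain ⟨t, ht, hzt, hEt, htl'⟩ := h.no_obstruction a (h.subset_right ha) z hz b hb hab
    (hbc.trans_le hcz) hEz htl
  exact ⟨t, ht, hcz.trans hzt, hEt, htl'⟩

/-- Let `z` and `y` witness the two hulls. If `z` falls short of `c`, then `b < z < y` with `tl y
b`; as this is no obstruction, some `t ≥ y` has `tl t z`, hence `tl t a`. Both witnesses must lie in
`Y` for this, whence the field `hull_eq`. -/
theorem hull_trans [IsStrictTotalOrder M tl] (h : InversionStable tl X E Y Z)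
    (hE : IsConvexEquivalence (· < ·) E) (ha : a ∈ Z) (hb : b ∈ Z) (hc : c ∈ Z)
    (hab : E a b) (hU : inversionHull tl X E a b) (hbc : E b c)
    (hU' : inversionHull tl X E b c) : inversionHull tl X E a c := by
  obtain ⟨z, hz, hbz, hEz, htl⟩ := h.hull_eq a ha b (h.subset_right hb) hab hU
  rcases le_or_gt c z with hcz | hzc
  · exact ⟨z, h.subset_left hz, hcz, hEz, htl⟩
  obtain ⟨y, hy, hcy, hEy, htl'⟩ := h.hull_eq b hb c (h.subset_right hc) hbc hU'
  rcases hbz.eq_or_lt with rfl | hbz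
  · exact ⟨y, h.subset_left hy, hcy, hE.1.trans hab hEy, _root_.trans htl' htl⟩
  · obtain ⟨t, ht, hyt, hEt, htl''⟩ := h.no_obstruction b (h.subset_right hb) y hy z
      (h.subset_left hz) hbz (hzc.trans_le hcy) hEy htl'
    exact ⟨t, ht, hcy.trans hyt, hE.1.trans hEz hEt, _root_.trans htl'' htl⟩

theorem hull_mono (hU : inversionHull tl X E a c) (hbc : b ≤ c) : inversionHull tl X E a b :=
  let ⟨z, hz, hcz, hEz, htl⟩ := hU
  ⟨z, hz, hbc.trans hcz, hEz, htl⟩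

theorem rel_conv (hE : IsConvexEquivalence (· < ·) E)
    (hab : a ≤ b) (hbc : b ≤ c) (hac : inversionRel tl X E a c) : inversionRel tl X E a b := by
  rcases hab.eq_or_lt with rfl | hab
  · exact Or.inl rfl
  rcases hbc.eq_or_lt with rfl | hbc
  · exact hac
  rcases hac with rfl | ⟨-, h1, h2⟩ | ⟨h1, -⟩
  · exact absurd (hab.trans hbc) (lt_irrefl _)
  · exact Or.inr (Or.inl ⟨hab, hE.equiv_of_between hab hbc h1, hull_mono h2 hbc.le⟩)
  · exact absurd (hab.trans hbc) (not_lt.2 h1.le)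

theorem rel_trans [IsStrictTotalOrder M tl] (h : InversionStable tl X E Y Z)
    (hE : IsConvexEquivalence (· < ·) E) (ha : a ∈ Z) (hb : b ∈ Z) (hc : c ∈ Z)
    (hab : inversionRel tl X E a b) (hbc : inversionRel tl X E b c) :
    inversionRel tl X E a c := by
  have hZX : Z ⊆ X := h.subset_right.trans h.subset_left
  have key : ∀ a ∈ Z, ∀ b ∈ Z, ∀ c ∈ Z, a < c → inversionRel tl X E a b →
      inversionRel tl X E b c → inversionRel tl X E a c := by
    intro a ha b hb c hc hac hab hbc
    have hEac := hE.1.trans (inversionRel_refines hE.1 _ _ hab) (inversionRel_refines hE.1 _ _ hbc)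
    refine Or.inr (Or.inl ⟨hac, hEac, ?_⟩)
    rcases hab with rfl | ⟨h1, h2, h3⟩ | ⟨h1, h2, h3⟩
    · rcases hbc with rfl | ⟨h4, h5, h6⟩ | ⟨h4, -⟩
      · exact absurd hac (lt_irrefl _)
      · exact h6
      · exact absurd hac h4.not_gt
    · rcases hbc with rfl | ⟨h4, h5, h6⟩ | ⟨h4, h5, h6⟩
      · exact h3
      · exact h.hull_trans hE ha hb hc h2 h3 h5 h6
      · exact hull_mono h3 h4.le
    · rcases hbc with rfl | ⟨h4, h5, h6⟩ | ⟨h4, -⟩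
      · exact absurd hac h1.not_gt
      · exact h.hull_left hb (h.subset_right hc) h1 hac h5 h6 (hZX ha)
      · exact absurd (hac.trans (h4.trans h1)) (lt_irrefl _)
  rcases lt_trichotomy a c with hac | rfl | hca
  · exact key a ha b hb c hc hac hab hbc
  · exact Or.inl rfl
  · exact inversionRel_symm _ _
      (key c hc b hb a ha hca (inversionRel_symm _ _ hbc) (inversionRel_symm _ _ hab))

end InversionStable

/-- If all `tl`-initial and `tl`-final segments have bounded alternation on `X`, then `X` is a finite
union of definable pieces on which `tl` is obtained from `<` by reversals. -/
theorem isAlignable_of_not_hasInversionChain (hlt : (· < · : M → M → Prop) ∈ binaryRels L A)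
    {N : ℕ} (m : ℕ) {tl E : M → M → Prop} {X : Set M} (htl : IsStrictTotalOrder M tl)
    (htld : tl ∈ binaryRels L A) (hE : IsConvexEquivalence (· < ·) E) (hEd : E ∈ binaryRels L A)
    (hX : X ∈ unarySets L A)
    (hN : ∀ c x, ¬ altOn (· < ·) X {x | tl x c} N x ∧ ¬ altOn (· < ·) X {x | tl c x} N x)
    (hm : ∀ x ∈ X, ¬ HasInversionChain tl X E m x) : IsAlignable L A (· < ·) tl E X := by
  -- With `m = 0` there are no inversions inside the `E`-classes, so the empty sequence aligns the
  -- two orders on `X`.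
  induction m generalizing tl E X with
  | zero =>
    refine ⟨{X}, Set.finite_singleton X, fun x hx => ⟨X, rfl, hx⟩, ?_⟩
    rintro D rfl
    refine ⟨subset_rfl, hX, [], by simp, List.Pairwise.nil, fun x hx y hy hxy => ?_⟩
    have key : ∀ x ∈ D, ∀ y ∈ D, E x y → x < y → tl x y := by
      intro x hx y hy hxy hlt
      rcases trichotomous_of tl x y with h | rfl | h
      · exact h
      · exact absurd hlt (lt_irrefl _)
      · exact (hm x hx ⟨y, hlt, hy, hxy, h⟩).elim
    refine ⟨fun h => ?_, fun h => key x hx y hy hxy h⟩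
    rcases lt_trichotomy x y with h' | rfl | h'
    · exact h'
    · exact (irrefl_of tl x h).elim
    · exact (asymm_of tl h (key y hy x hx (hE.1.symm hxy) h')).elim
  | succ m ih =>
    have hNmono : ∀ Y ⊆ X, ∀ c x, ¬ altOn (· < ·) Y {x | tl x c} N x ∧
        ¬ altOn (· < ·) Y {x | tl c x} N x := fun Y hY c x =>
      ⟨fun h => (hN c x).1 (h.mono hY), fun h => (hN c x).2 (h.mono hY)⟩
    have hCd := obstructionSet_mem_unarySets hlt htld hEd hX
    -- Layers by height in the obstruction towers: an obstruction with `a` in layer `k` would lift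
    -- `c` to height `k + 1`, so no layer contains both `a` and `c`.
    refine IsAlignable.of_finite_union (Set.finite_Iio N)
      (Y := fun k => obstructionSet tl X E k \ obstructionSet tl X E (k + 1)) ?_
      (fun k _ => Set.sdiff_subset.trans obstructionSet_subset) ?_
    · intro k _
      set Y := obstructionSet tl X E k \ obstructionSet tl X E (k + 1) with hY
      have hYX : Y ⊆ X := Set.sdiff_subset.trans obstructionSet_subset
      have hYd : Y ∈ unarySets L A :=
        (definableAlgebra L A).sdiff_mem (hCd k) (hCd (k + 1))
      have hWd := hasInversionChain_mem_unarySets hlt htld hEd hYd m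
      -- Off `Z` the induction hypothesis applies directly. On `Z` there are chains with `m`
      -- alternations in `Y` but none with `m + 1` in `X`, as `inversionHull_of_subset` requires.
      set Z := Y ∩ {x | HasInversionChain tl Y E m x} with hZ
      have hZY : Z ⊆ Y := Set.inter_subset_left
      have hZd : Z ∈ unarySets L A := (definableAlgebra L A).inf_mem hYd hWd
      refine IsAlignable.of_finite_union (Set.finite_univ (α := Bool))
        (Y := fun i => if i then Z else Y \ {x | HasInversionChain tl Y E m x}) ?_ ?_ ?_
      · rintro (_ | _) -
        · refine ih htl htld hE hEd ((definableAlgebra L A).sdiff_mem hYd hWd)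
            (hNmono _ (Set.sdiff_subset.trans hYX)) ?_
          exact fun x hx hc => hx.2 (hc.mono Set.sdiff_subset)
        · have hst : InversionStable tl X E Y Z := by
            refine ⟨hYX, hZY, ?_, ?_⟩
            · intro a ha c hc d hd had hdc hac hca
              by_contra hU
              exact hc.2 ⟨hYX hc, a, ha.1, d, hd, had, hdc, hac, hca, hU⟩
            · intro x hx c hc hxc hU
              exact inversionHull_of_subset hYX hc hxc hx.2 (hm x (hYX (hZY hx))) hU
          have htrans : ∀ a ∈ Z, ∀ b ∈ Z, ∀ c ∈ Z, inversionRel tl X E a b →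
              inversionRel tl X E b c → inversionRel tl X E a c :=
            fun a ha b hb c hc => hst.rel_trans hE ha hb hc
          have hconv : ∀ a ∈ Z, ∀ b ∈ Z, ∀ c ∈ Z, a ≤ b → b ≤ c → inversionRel tl X E a c →
              inversionRel tl X E a b := fun a _ b _ c _ => InversionStable.rel_conv hE
          have hE₀ := isConvexEquivalence_convexHullRel htrans hconv
          have hE₀d := convexHullRel_mem_binaryRels hlt
            (inversionRel_mem_binaryRels hlt htld hEd hX) hZd
          have hE₀E : ∀ x y, convexHullRel Z (inversionRel tl X E) x y → E x y := fun x y h =>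
            convexHullRel_refines hE (inversionRel_refines hE.1) h
          have hE₀U : ∀ x ∈ Z, ∀ y ∈ Z, x < y → convexHullRel Z (inversionRel tl X E) x y →
              E x y ∧ inversionHull tl X E x y := by
            intro x hx y hy hxy h
            rcases convexHullRel_of_mem htrans inversionRel_symm hconv hx hy h with
              h | h | h | h
            · exact absurd hxy (h ▸ lt_irrefl _)
            · exact absurd hxy (h ▸ lt_irrefl _)
            · exact h.2
            · exact absurd hxy h.1.not_gt
          have hout : ∀ x ∈ Z, ∀ y ∈ Z, E x y → ¬ convexHullRel Z (inversionRel tl X E) x y →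
              x < y → tl x y := by
            intro x hx y hy hxy h hlt
            rcases trichotomous_of tl x y with h' | rfl | h'
            · exact h'
            · exact absurd hlt (lt_irrefl _)
            · refine (h (Or.inr ⟨x, hx, y, hy, ?_, le_rfl, hlt.le, hlt.le, le_rfl⟩)).elim
              exact Or.inr (Or.inl ⟨hlt, hxy, y, hYX (hZY hy), le_rfl, hxy, h'⟩)
          refine IsAlignable.cons_reverse hE₀ hE₀d hE₀E ?_ ?_
          · intro x hx y hy hxy h
            refine ⟨fun h' => ?_, hout x hx y hy hxy h⟩
            rcases lt_trichotomy x y with h1 | rfl | h1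
            · exact h1
            · exact (irrefl_of tl x h').elim
            · exact (asymm_of tl h' (hout y hy x hx (hE.1.symm hxy)
                (fun h2 => h (hE₀.1.symm h2)) h1)).elim
          -- Inside the new classes the order is flipped, which exchanges the bounds on initial and
          -- final segments; hence `hN` is two-sided.
          · refine ih isStrictTotalOrder_flip (defPred_binary htld 1 0) hE₀ hE₀d hZd
              (fun c x => (hNmono Z (hZY.trans hYX) c x).symm) ?_
            intro x hx hch
            have hswap : ∀ y, x < y → (tl x y ↔ ¬ tl y x) := fun y hxy =>
              ⟨fun h => asymm_of tl h, fun h => (trichotomous_of tl x y).resolve_right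
                fun h' => h'.elim (fun h' => hxy.ne h') h⟩
            -- A chain for the flipped order ends at a point `y` not inverted for `tl`. As `y` is in
            -- the hull of `x`, there is an inverted point of `X` beyond it, which prolongs the
            -- chain by one alternation.
            have key : ∀ k y, y ∈ Z → x < y → convexHullRel Z (inversionRel tl X E) x y →
                inversionChain (fun x y => tl y x) Z (convexHullRel Z (inversionRel tl X E)) x k y →
                inversionChain tl X E x (k + 1) y := by
              intro k
              induction k with
              | zero =>
                intro y hy hxy hxy' htl'
                obtain ⟨-, z, hz, hyz, hEz, htlz⟩ := hE₀U x hx y hy hxy hxy'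
                have hyx : ¬ tl y x := asymm_of tl htl'
                exact ⟨z, lt_of_le_of_ne hyz (fun h => hyx (h ▸ htlz)), hz, hEz,
                  iff_of_true htlz hyx, htlz⟩
              | succ k ihk =>
                rintro y hy hxy hxy' ⟨z, hyz, hz, hxz, hs, hc⟩
                refine ⟨z, hyz, hYX (hZY hz), hE₀E _ _ hxz, ?_,
                  ihk z hz (hxy.trans hyz) hxz hc⟩
                simp only [hswap y hxy, hswap z (hxy.trans hyz)] at hs
                tauto
            obtain ⟨y, hxy, hy, hxy', hc⟩ := hch
            exact hm x (hYX (hZY hx))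
              ⟨y, hxy, hYX (hZY hy), hE₀E _ _ hxy', key m y hy hxy hxy' hc⟩
      · rintro (_ | _) -
        · exact Set.sdiff_subset
        · exact hZY
      · intro x hx
        by_cases hc : HasInversionChain tl Y E m x
        · exact ⟨true, trivial, hx, hc⟩
        · exact ⟨false, trivial, hx, hc⟩
    · intro x hx
      classical
      have hex : ∃ k, x ∉ obstructionSet tl X E k :=
        ⟨N, obstructionSet_eq_empty hE fun c x => (hN c x).1⟩
      obtain ⟨k, hk⟩ : ∃ k, Nat.find hex = k + 1 := by
        refine Nat.exists_eq_succ_of_ne_zero fun h => ?_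
        have := Nat.find_spec hex
        rw [h] at this
        exact this hx
      refine ⟨k, ?_, ?_, ?_⟩
      · have := Nat.find_min' hex (obstructionSet_eq_empty hE fun c x => (hN c x).1)
        exact Set.mem_Iio.2 (by omega)
      · exact not_not.1 (Nat.find_min hex (m := k) (by omega))
      · exact hk ▸ Nat.find_spec hex

end

/-- If all `tl`-initial and `tl`-final segments have bounded alternation on `X`, then `X` is a finite
union of definable pieces on which `tl` is obtained from `lt` by reversals. -/
theorem isAlignable_of_altOn [IsStrictTotalOrder M lt] [htl : IsStrictTotalOrder M tl]
    (hlt : lt ∈ binaryRels L A) (htld : tl ∈ binaryRels L A) (hX : X ∈ unarySets L A) {N : ℕ}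
    (hN : ∀ c x, ¬ altOn lt X {x | tl x c} N x ∧ ¬ altOn lt X {x | tl c x} N x) :
    IsAlignable L A lt tl (fun _ _ => True) X := by
  classical
  let _ : LinearOrder M := linearOrderOfSTO lt
  refine isAlignable_of_not_hasInversionChain hlt N htl htld
    ⟨⟨fun _ => trivial, fun _ => trivial, fun _ _ => trivial⟩, fun _ _ _ _ _ _ _ _ => trivial⟩
    (DefPred.const True) hX hN ?_
  rintro x - ⟨y, -, hy, -, hc⟩
  exact (hN x y).1 (hc.altOn hy)

end Pieces
end BinaryReducts

namespace BinaryReducts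
open FirstOrder Set

/-! ### Definability in reducts -/

section Reduct

variable {M : Type w} {U : Set (Set M)} {B : Set (M → M → Prop)}

/-- A family of predicates that contains the named relations and equality and is closed under
first-order operations contains all definable predicates of the reduct. -/
theorem reduct_induction (K : ∀ k : ℕ, ((Fin k → M) → Prop) → Prop)
    (hfalse : ∀ k, K k fun _ => False)
    (himp : ∀ k P Q, K k P → K k Q → K k fun v => P v → Q v)
    (heq : ∀ k (i j : Fin k), K k fun v => v i = v j)
    (hU : ∀ C ∈ U, ∀ k (i : Fin k), K k fun v => v i ∈ C)
    (hB : ∀ R ∈ B, ∀ k (i j : Fin k), K k fun v => R (v i) (v j))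
    (hall : ∀ k P, K (k + 1) P → K k fun v => ∀ x, P (Fin.snoc (α := fun _ => M) v x))
    (n : ℕ) (S : Set (Fin n → M)) (hS : (∅ : Set M).Definable (reductLanguage U B) S) :
    K n fun v => v ∈ S := by
  obtain ⟨φ, rfl⟩ := Set.empty_definable_iff.1 hS
  have key : ∀ (m : ℕ) (φ : (reductLanguage U B).BoundedFormula (Fin n) m),
      K (n + m) fun w => φ.Realize (fun i => w (Fin.castAdd m i)) (fun i => w (Fin.natAdd n i)) := by
    intro m φ
    have hterm : ∀ m (t : (reductLanguage U B).Term (Fin n ⊕ Fin m)), ∃ i : Fin (n + m),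
        ∀ w : Fin (n + m) → M, t.realize (Sum.elim (fun i => w (Fin.castAdd m i))
          (fun i => w (Fin.natAdd n i))) = w i := by
      intro m t
      cases t with
      | var i =>
        rcases i with i | i
        · exact ⟨Fin.castAdd m i, fun w => rfl⟩
        · exact ⟨Fin.natAdd n i, fun w => rfl⟩
      | func f _ => exact Empty.elim f
    have hcongr : ∀ k (P Q : (Fin k → M) → Prop), K k P → (∀ v, P v ↔ Q v) → K k Q :=
      fun k P Q h hPQ => (funext fun v => propext (hPQ v) : P = Q) ▸ h
    induction φ with
    | falsum => exact hfalse _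
    | equal t s =>
      obtain ⟨i, hi⟩ := hterm _ t
      obtain ⟨j, hj⟩ := hterm _ s
      exact hcongr _ _ _ (heq _ i j) fun w => iff_of_eq (congrArg₂ _ (hi w).symm (hj w).symm)
    | rel R ts =>
      cases R with
      | unary C =>
        obtain ⟨i, hi⟩ := hterm _ (ts 0)
        exact hcongr _ _ _ (hU C.1 C.2 _ i) fun w =>
          iff_of_eq (congrArg (fun x => x ∈ C.1) (hi w).symm)
      | binary R =>
        obtain ⟨i, hi⟩ := hterm _ (ts 0)
        obtain ⟨j, hj⟩ := hterm _ (ts 1)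
        exact hcongr _ _ _ (hB R.1 R.2 _ i j) fun w =>
          iff_of_eq (congrArg₂ R.1 (hi w).symm (hj w).symm)
    | imp _ _ ih ih' => exact himp _ _ _ ih ih'
    | all φ ih =>
      refine hcongr _ _ _ (hall _ _ ih) fun w => forall_congr' fun x => iff_of_eq ?_
      congr 1
      · funext i
        exact Fin.snoc_castSucc (α := fun _ => M) (x := x) (p := w) (i := Fin.castAdd _ i)
      · funext i
        refine Fin.lastCases ?_ (fun i => ?_) i
        · rw [Fin.snoc_last]
          exact Fin.snoc_last (α := fun _ => M) (x := x) (p := w)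
        · rw [Fin.snoc_castSucc]
          exact Fin.snoc_castSucc (α := fun _ => M) (x := x) (p := w) (i := Fin.natAdd n i)
  refine (congrArg (K n) (funext fun w => ?_)).mp (key 0 φ)
  exact congrArg (Language.BoundedFormula.Realize φ w) (Subsingleton.elim _ _)

theorem defPred_reduct_unary {α : Type*} {C : Set M} (hC : C ∈ U) (i : α) :
    DefPred (reductLanguage U B) ∅ fun v : α → M => v i ∈ C := by
  refine DefPred.iff_formula.2
    ⟨Language.Relations.formula (ReductRel.unary ⟨C, hC⟩ : (reductLanguage U B).Relations 1)
      ![Language.Term.var (Sum.inr i)], fun v => ?_⟩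
  exact Language.Formula.realize_rel

theorem defPred_reduct_binary {α : Type*} {R : M → M → Prop} (hR : R ∈ B) (i j : α) :
    DefPred (reductLanguage U B) ∅ fun v : α → M => R (v i) (v j) := by
  refine DefPred.iff_formula.2
    ⟨Language.Relations.formula (ReductRel.binary ⟨R, hR⟩ : (reductLanguage U B).Relations 2)
      ![Language.Term.var (Sum.inr i), Language.Term.var (Sum.inr j)], fun v => ?_⟩
  exact Language.Formula.realize_rel

theorem definable_reduct_of {U' : Set (Set M)} {B' : Set (M → M → Prop)}
    (hU : ∀ C ∈ U, C ∈ unarySets (reductLanguage U' B') (∅ : Set M))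
    (hB : ∀ R ∈ B, R ∈ binaryRels (reductLanguage U' B') (∅ : Set M)) (n : ℕ)
    (S : Set (Fin n → M)) (hS : (∅ : Set M).Definable (reductLanguage U B) S) :
    (∅ : Set M).Definable (reductLanguage U' B') S := by
  refine reduct_induction (fun k P => DefPred (reductLanguage U' B') ∅ P)
    (fun k => DefPred.const False) (fun k P Q => DefPred.imp) (fun k => DefPred.eq)
    (fun C hC k i => defPred_unary (hU C hC) i) (fun R hR k i j => defPred_binary (hB R hR) i j)
    ?_ n S hS
  intro k P hP
  refine DefPred.all ((hP.comp (Fin.snoc (α := fun _ => Fin k ⊕ Unit) Sum.inl (Sum.inr ()))).congr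
    fun v => iff_of_eq (congrArg _ (funext fun i => ?_)))
  refine Fin.lastCases ?_ (fun i => ?_) i <;> simp

theorem definitionallyEquivalent_of {U' : Set (Set M)} {B' : Set (M → M → Prop)}
    (hU : U' ⊆ U) (hB : B' ⊆ B)
    (hU' : ∀ C ∈ U, C ∈ unarySets (reductLanguage U' B') (∅ : Set M))
    (hB' : ∀ R ∈ B, R ∈ binaryRels (reductLanguage U' B') (∅ : Set M)) :
    DefinitionallyEquivalent (reductLanguage U B) (reductLanguage U' B') M := fun n S =>
  ⟨definable_reduct_of hU' hB' n S, definable_reduct_of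
    (fun _ hC => defPred_reduct_unary (hU hC) 0) (fun _ hR => defPred_reduct_binary (hB hR) 0 1) n S⟩

end Reduct

/-! ### Weakly quasi-o-minimal structures are weakly monotone -/

section WeaklyMonotone

variable {M : Type w} {L : FirstOrder.Language.{u, v}} [L.Structure M] {A : Set M}
  {lt tl : M → M → Prop} [IsStrictTotalOrder M lt]

theorem isAlignable_univ [IsStrictTotalOrder M tl] (hM : IsAleph0Saturated L M)
    (hlt : lt ∈ binaryRels L (∅ : Set M)) (hW : IsWeaklyQuasiOMinimalStructure L M lt)
    (hA : A.Finite) (htl : tl ∈ binaryRels L A) :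
    IsAlignable L A lt tl (fun _ _ => True) Set.univ := by
  obtain ⟨F, n, hF, hFc, hFn⟩ := exists_uniform_bound_binary hlt hM hW hA htl
  obtain ⟨G, m, hG, hGc, hGm⟩ := exists_uniform_bound_binary hlt hM hW hA
    (R := fun x y => tl y x) (defPred_binary htl 1 0)
  refine IsAlignable.of_finite_union (F ×ˢ G).finite_toSet (Y := fun p => p.1 ∩ p.2) ?_
    (fun _ _ => Set.subset_univ _) ?_
  · rintro ⟨X, Y⟩ hXY
    obtain ⟨hX, hY⟩ := Finset.mem_product.1 hXY
    refine isAlignable_of_altOn (N := max n m) (binaryRels_mono (Set.empty_subset A) hlt) htl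
      (unarySets_mono (Set.empty_subset A)
        ((definableAlgebra L (∅ : Set M)).inf_mem (hF X hX) (hG Y hY))) fun c x => ⟨?_, ?_⟩
    · exact fun h => hFn X hX c x ((h.mono Set.inter_subset_left).anti (le_max_left _ _))
    · exact fun h => hGm Y hY c x ((h.mono Set.inter_subset_right).anti (le_max_right _ _))
  · intro x _
    obtain ⟨X, hX, hxX⟩ := hFc x
    obtain ⟨Y, hY, hxY⟩ := hGc x
    exact ⟨(X, Y), Finset.mem_coe.2 (Finset.mem_product.2 ⟨hX, hY⟩), hxX, hxY⟩

/-- A definable relation whose fibres are initial segments is definable from definable unary sets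
and weakly monotone relations. -/
theorem mem_binaryRels_reduct_of_initial (hM : IsAleph0Saturated L M)
    (hlt : lt ∈ binaryRels L (∅ : Set M)) (hW : IsWeaklyQuasiOMinimalStructure L M lt)
    (hA : A.Finite) {S : M → M → Prop} (hS : S ∈ binaryRels L A)
    (hSi : ∀ x y b, lt x y → S y b → S x b) :
    S ∈ binaryRels (monotoneReduct L A lt (weakOrders L A lt)) (∅ : Set M) := by
  have hltA := binaryRels_mono (Set.empty_subset A) hlt
  have htot : ∀ b b', (∀ x, S x b → S x b') ∨ (∀ x, S x b' → S x b) := by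
    intro b b'
    by_contra! h
    obtain ⟨⟨x, hx, hx'⟩, y, hy, hy'⟩ := h
    rcases trichotomous_of lt x y with h | rfl | h
    · exact hx' (hSi _ _ _ h hy)
    · exact hx' hy
    · exact hy' (hSi _ _ _ h hx)
  -- Points are ordered by inclusion of their fibres, with ties broken by `lt`; initial segments are
  -- always comparable.
  let tl : M → M → Prop := fun b b' =>
    (∀ x, S x b → S x b') ∧ ((∀ x, S x b' → S x b) → lt b b')
  have htl : IsStrictTotalOrder M tl := by
    refine isStrictTotalOrder_of ?_ ?_ ?_
    · exact fun a h => irrefl_of lt a (h.2 h.1)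
    · rintro a b c ⟨h1, h2⟩ ⟨h3, h4⟩
      refine ⟨fun x hx => h3 x (h1 x hx), fun h => ?_⟩
      exact _root_.trans (h2 fun x hx => h x (h3 x hx)) (h4 fun x hx => h1 x (h x hx))
    · intro a b
      rcases trichotomous_of lt a b with h | h | h
      · by_cases hab : ∀ x, S x a → S x b
        · exact Or.inl ⟨hab, fun _ => h⟩
        · exact Or.inr (Or.inr ⟨(htot a b).resolve_left hab, fun h => (hab h).elim⟩)
      · exact Or.inr (Or.inl h)
      · by_cases hab : ∀ x, S x b → S x a
        · exact Or.inr (Or.inr ⟨hab, fun _ => h⟩)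
        · exact Or.inl ⟨(htot a b).resolve_right hab, fun h => (hab h).elim⟩
  have htld : tl ∈ binaryRels L A :=
    (DefPred.all ((defPred_binary hS _ _).imp (defPred_binary hS _ _))).and
      ((DefPred.all ((defPred_binary hS _ _).imp (defPred_binary hS _ _))).imp
        (defPred_binary hltA _ _))
  obtain ⟨F, hF, hFc, hFp⟩ := isAlignable_univ hM hlt hW hA htld
  choose! hD hDd Es hEs hdec hal using hFp
  -- The restriction of `S` to `b ∈ D`, closed upwards along the aligned order. It adds no pair with
  -- `b ∈ D`: there the aligned order is `tl`, along which fibres grow.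
  let T : Set M → M → M → Prop := fun D x b =>
    ∃ b', b' ∈ D ∧ (b' = b ∨ reverseAlong lt (Es D) b' b) ∧ S x b'
  have hadm : ∀ D ∈ F, IsAdmissible lt (Es D) := fun D hDF =>
    isAdmissible_of_isDecreasing (fun E hE => (hEs D hDF E hE).2.1) (hdec D hDF)
  have hT : ∀ D ∈ F, T D ∈ monotoneRels L A lt (weakOrders L A lt) := by
    intro D hDF
    have hod := reverseAlong_mem_binaryRels hltA fun E hE => (hEs D hDF E hE).1
    have := isStrictTotalOrder_reverseAlong (hadm D hDF)
    refine ⟨?_, _, ⟨Es D, fun E hE => (hEs D hDF E hE).1, hadm D hDF, hdec D hDF, rfl⟩, ?_⟩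
    · exact DefPred.ex ((defPred_unary (hDd D hDF) _).and (((DefPred.eq _ _).or
        (defPred_binary hod _ _)).and (defPred_binary hS _ _)))
    · rintro a a' b b' haa' ⟨c, hc, hcb', hS'⟩ hb'b
      refine ⟨c, hc, ?_, ?_⟩
      · rcases hcb' with rfl | h
        · exact hb'b
        · rcases hb'b with rfl | h'
          · exact Or.inr h
          · exact Or.inr (_root_.trans h h')
      · rcases haa' with rfl | h
        · exact hS'
        · exact hSi _ _ _ h hS'
  have hST : ∀ x b, S x b ↔ ∃ D ∈ hF.toFinset, b ∈ D ∧ (D ∈ F ∧ T D x b) := by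
    intro x b
    constructor
    · intro h
      obtain ⟨D, hDF, hb⟩ := hFc b trivial
      exact ⟨D, hF.mem_toFinset.2 hDF, hb, hDF, b, hb, Or.inl rfl, h⟩
    · rintro ⟨D, -, hb, hDF, b', hb', hbb', h⟩
      rcases hbb' with rfl | hbb'
      · exact h
      · exact ((hal D hDF b' hb' b hb trivial).2 hbb').1 x h
  refine DefPred.congr (P := fun v : Fin 2 → M => ∃ D ∈ hF.toFinset, v 1 ∈ D ∧
    (D ∈ F ∧ T D (v 0) (v 1))) ?_ fun v => (hST _ _).symm
  refine DefPred.finset_or _ fun D hD => ?_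
  have hDF := hF.mem_toFinset.1 hD
  exact (defPred_reduct_unary (hDd D hDF) 1).and ((DefPred.const _).and
    (defPred_reduct_binary (hT D hDF) 0 1))

/-- Let `k` be the largest number of alternations starting at `x` in its piece. Then `R x b` holds
exactly when some `y ≥ x` in the fibre starts `k` alternations: if `x` were outside the fibre,
putting it before `y` would give `k + 1`. -/
theorem isWeaklyMonotoneStructure_of_isWeaklyQuasiOMinimalStructure (hM : IsAleph0Saturated L M)
    (hlt : lt ∈ binaryRels L (∅ : Set M)) (hW : IsWeaklyQuasiOMinimalStructure L M lt) :
    IsWeaklyMonotoneStructure L M lt := by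
  intro A hA
  have hltA := binaryRels_mono (Set.empty_subset A) hlt
  refine definitionallyEquivalent_of subset_rfl (fun R hR => hR.1)
    (fun C hC => defPred_reduct_unary hC 0) fun R hR => ?_
  obtain ⟨F, n, hF, hFc, hFn⟩ := exists_uniform_bound_binary hlt hM hW hA hR
  -- Closing under smaller points makes the fibres of `I` and `J` initial segments. For `x ∈ X`, `I
  -- X k x b` still says that `x` itself starts `k` alternations.
  let I : Set M → ℕ → M → M → Prop := fun X k x b =>
    ∃ y, (x = y ∨ lt x y) ∧ altOn lt X {z | R z b} k y
  let J : Set M → ℕ → M → M → Prop := fun X k x b =>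
    ∃ y, (x = y ∨ lt x y) ∧ R y b ∧ altOn lt X {z | R z b} k y
  have hadef : ∀ X ∈ F, ∀ k, (fun y b => altOn lt X {z | R z b} k y) ∈ binaryRels L A :=
    fun X hX k => (DefPred.altOn (α := Unit) hltA (unarySets_mono (Set.empty_subset A) (hF X hX))
      (R := fun b x => R x (b ())) (defPred_binary hR _ _) k).comp
        (Sum.elim (fun _ => (1 : Fin 2)) fun _ => 0)
  have hle : ∀ {x y z : M}, lt x y → (y = z ∨ lt y z) → (x = z ∨ lt x z) := by
    rintro x y z h (rfl | h')
    · exact Or.inr h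
    · exact Or.inr (_root_.trans h h')
  have hI : ∀ X ∈ F, ∀ k,
      I X k ∈ binaryRels (monotoneReduct L A lt (weakOrders L A lt)) (∅ : Set M) := by
    intro X hX k
    refine mem_binaryRels_reduct_of_initial hM hlt hW hA ?_ ?_
    · exact DefPred.ex (((DefPred.eq _ _).or (defPred_binary hltA _ _)).and
        (defPred_binary (hadef X hX k) _ _))
    · rintro x y b hxy ⟨z, hz, h⟩
      exact ⟨z, hle hxy hz, h⟩
  have hJ : ∀ X ∈ F, ∀ k,
      J X k ∈ binaryRels (monotoneReduct L A lt (weakOrders L A lt)) (∅ : Set M) := by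
    intro X hX k
    refine mem_binaryRels_reduct_of_initial hM hlt hW hA ?_ ?_
    · exact DefPred.ex (((DefPred.eq _ _).or (defPred_binary hltA _ _)).and
        ((defPred_binary hR _ _).and (defPred_binary (hadef X hX k) _ _)))
    · rintro x y b hxy ⟨z, hz, h⟩
      exact ⟨z, hle hxy hz, h⟩
  have hRIJ : ∀ x b, R x b ↔ ∃ X ∈ F, x ∈ X ∧ ∃ k ∈ Finset.range n,
      I X k x b ∧ ¬ I X (k + 1) x b ∧ J X k x b := by
    intro x b
    have hIalt : ∀ X, x ∈ X → ∀ k, I X k x b → altOn lt X {z | R z b} k x :=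
      fun X hxX k ⟨y, hxy, hy⟩ => hy.of_le hxX hxy
    constructor
    · intro hxb
      obtain ⟨X, hX, hxX⟩ := hFc x
      classical
      have hex : ∃ k, ¬ altOn lt X {z | R z b} k x := ⟨n, hFn X hX b x⟩
      obtain ⟨k, hk⟩ : ∃ k, Nat.find hex = k + 1 := by
        refine Nat.exists_eq_succ_of_ne_zero fun h => ?_
        have := Nat.find_spec hex
        rw [h] at this
        exact this hxX
      have hk1 : ¬ altOn lt X {z | R z b} (k + 1) x := hk ▸ Nat.find_spec hex
      have hk0 : altOn lt X {z | R z b} k x := not_not.1 (Nat.find_min hex (m := k) (by omega))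
      refine ⟨X, hX, hxX, k, ?_, ⟨x, Or.inl rfl, hk0⟩, fun h => hk1 (hIalt X hxX _ h),
        ⟨x, Or.inl rfl, hxb, hk0⟩⟩
      have := Nat.find_min' hex (hFn X hX b x)
      exact Finset.mem_range.2 (by omega)
    · rintro ⟨X, -, hxX, k, -, -, h2, y, hxy, hyb, hy⟩
      by_contra hxb
      rcases hxy with rfl | hxy
      · exact hxb hyb
      · exact h2 ⟨x, Or.inl rfl, hxX, y, hxy, iff_of_true hyb hxb, hy⟩
  refine DefPred.congr (P := fun v : Fin 2 → M => ∃ X ∈ F, v 0 ∈ X ∧ ∃ k ∈ Finset.range n,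
    I X k (v 0) (v 1) ∧ ¬ I X (k + 1) (v 0) (v 1) ∧ J X k (v 0) (v 1)) ?_
    fun v => (hRIJ _ _).symm
  refine DefPred.finset_or _ fun X hX => DefPred.and ?_ (DefPred.finset_or _ fun k _ => ?_)
  · exact defPred_reduct_unary (unarySets_mono (Set.empty_subset A) (hF X hX)) 0
  · exact (defPred_binary (hI X hX k) 0 1).and ((defPred_binary (hI X hX (k + 1)) 0 1).not.and
      (defPred_binary (hJ X hX k) 0 1))

end WeaklyMonotone
end BinaryReducts

namespace BinaryReducts
open FirstOrder Set

/-! ### Sets determined by finitely many generators -/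

section Determined

variable {X Y : Type*}

/-- Membership in `P` is determined by membership in finitely many members of `G`. -/
def DetBy (G : Set (Set X)) (P : Set X) : Prop :=
  ∃ F : Finset (Set X), (∀ C ∈ F, C ∈ G) ∧ ∀ x y, (∀ C ∈ F, x ∈ C ↔ y ∈ C) → x ∈ P → y ∈ P

variable {G : Set (Set X)} {G' : Set (Set Y)} {P Q : Set X}

theorem DetBy.of_mem (h : P ∈ G) : DetBy G P :=
  ⟨{P}, by simpa using h, fun x y hxy hx => (hxy P (by simp)).1 hx⟩

theorem DetBy.of_determined (F : Finset (Set X)) (hF : ∀ C ∈ F, DetBy G C)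
    (h : ∀ x y, (∀ C ∈ F, x ∈ C ↔ y ∈ C) → x ∈ P → y ∈ P) : DetBy G P := by
  classical
  choose! F' hF' hdet using hF
  refine ⟨F.biUnion F', ?_, ?_⟩
  · intro C hC
    obtain ⟨D, hD, hCD⟩ := Finset.mem_biUnion.1 hC
    exact hF' D hD C hCD
  · intro x y hxy
    refine h x y fun C hC => ⟨hdet C hC x y fun D hD => hxy D ?_, hdet C hC y x fun D hD =>
      (hxy D ?_).symm⟩ <;> exact Finset.mem_biUnion.2 ⟨C, hC, hD⟩

theorem DetBy.compl (h : DetBy G P) : DetBy G Pᶜ :=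
  DetBy.of_determined {P} (by simpa using h) fun x y hxy hx =>
    fun hy => hx ((hxy P (by simp)).2 hy)

theorem DetBy.himp (hP : DetBy G P) (hQ : DetBy G Q) : DetBy G {x | x ∈ P → x ∈ Q} := by
  classical
  refine DetBy.of_determined {P, Q} (by simp [hP, hQ]) fun x y hxy hx hy => ?_
  exact (hxy Q (by simp)).1 (hx ((hxy P (by simp)).2 hy))

theorem DetBy.preimage (h : DetBy G P) (f : Y → X) (hG : ∀ C ∈ G, DetBy G' (f ⁻¹' C)) :
    DetBy G' (f ⁻¹' P) := by
  classical
  obtain ⟨F, hF, hdet⟩ := h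
  refine DetBy.of_determined (F.image fun C => f ⁻¹' C) ?_ fun x y hxy => ?_
  · intro C hC
    obtain ⟨D, hD, rfl⟩ := Finset.mem_image.1 hC
    exact hG D (hF D hD)
  · exact hdet _ _ fun C hC => hxy _ (Finset.mem_image_of_mem _ hC)

theorem DetBy.mem (h : DetBy G P) {B : BooleanSubalgebra (Set X)} (hG : ∀ C ∈ G, C ∈ B) :
    P ∈ B :=
  let ⟨F, hF, hdet⟩ := h
  mem_booleanSubalgebra_of_determined B F (fun C hC => hG C (hF C hC)) P hdet

theorem exists_minimal_of_total {ι : Type*} {s : Finset ι} (hs : s.Nonempty) (f : ι → Set X)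
    (htot : ∀ i ∈ s, ∀ j ∈ s, f i ⊆ f j ∨ f j ⊆ f i) : ∃ i ∈ s, ∀ j ∈ s, f i ⊆ f j := by
  classical
  induction hs using Finset.Nonempty.cons_induction with
  | singleton a => exact ⟨a, by simp, by simp⟩
  | cons a s ha hs ih =>
    obtain ⟨i, hi, hmin⟩ := ih fun i hi j hj => htot i (by simp [hi]) j (by simp [hj])
    rcases htot a (by simp) i (by simp [hi]) with h | h
    · refine ⟨a, by simp, fun j hj => ?_⟩
      rcases Finset.mem_cons.1 hj with rfl | hj
      · exact subset_rfl
      · exact h.trans (hmin j hj)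
    · refine ⟨i, by simp [hi], fun j hj => ?_⟩
      rcases Finset.mem_cons.1 hj with rfl | hj
      · exact h
      · exact hmin j hj

end Determined

/-! ### Monotone relations between two reversed orders -/

section Conversion

variable {M : Type w} {L : FirstOrder.Language.{u, v}} [L.Structure M] {A : Set M}
  {lt : M → M → Prop}

/-- The special relations of the reduct, as sets of pairs. -/
def specialPairs (L : FirstOrder.Language.{u, v}) [L.Structure M] (A : Set M)
    (lt : M → M → Prop) : Set (Set (M × M)) :=
  {S | ∃ T ∈ monotoneRels L A lt (specialOrders L A lt), S = {p | T p.1 p.2}}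

theorem lt_mem_specialOrders : lt ∈ specialOrders L A lt := ⟨[], by simp, trivial, rfl⟩

/-- The pairs `(a, b)` such that `R` holds at `(a', b)` for some but not for all `a'` in the
`E`-class of `a`. -/
def criticalRel (R E : M → M → Prop) (a b : M) : Prop :=
  (∃ a', E a a' ∧ R a' b) ∧ ¬ ∀ a', E a a' → R a' b

section Critical

variable {r s R E : M → M → Prop} [IsStrictTotalOrder M r]

theorem lt_of_lt_of_not_equiv (hE : IsConvexEquivalence r E) {a a' b : M} (h : r a b)
    (hab : ¬ E a b) (haa' : E a a') : r a' b := by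
  rcases trichotomous_of r a' b with h' | rfl | h'
  · exact h'
  · exact (hab haa').elim
  · exact (hab (hE.equiv_of_between h h' haa')).elim

/-- Between different classes the reversed order agrees with `r`, so one point of the later class
satisfying `R` forces all of the earlier class to do so. -/
theorem forall_of_exists_of_lt (hE : IsConvexEquivalence r E)
    (hR : IsMonotoneRel (reverseOn r E) s R) {a b c : M} (h : r a c) (hac : ¬ E a c)
    (hc : ∃ c', E c c' ∧ R c' b) : ∀ a', E a a' → R a' b := by
  obtain ⟨c', hcc', hc'⟩ := hc
  intro a' haa'
  refine hR a' c' b b (Or.inr (Or.inr ⟨fun h' => ?_, ?_⟩)) hc' (Or.inl rfl)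
  · exact hac (hE.1.trans haa' (hE.1.trans h' (hE.1.symm hcc')))
  · have h1 := lt_of_lt_of_not_equiv hE h hac haa'
    have hne : ¬ E c' a' := fun h' => hac (hE.1.trans haa' (hE.1.trans (hE.1.symm h')
      (hE.1.symm hcc')))
    rcases trichotomous_of r a' c' with h' | h' | h'
    · exact h'
    · exact (hne (h' ▸ hE.1.refl _)).elim
    · exact (hne (hE.equiv_of_between h' h1 (hE.1.symm hcc'))).elim

theorem IsMonotoneRel.forall_equiv (hE : IsConvexEquivalence r E)
    (hR : IsMonotoneRel (reverseOn r E) s R) :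
    IsMonotoneRel r s fun a b => ∀ a', E a a' → R a' b := by
  intro a c b' b hac hc hb c' hac'
  by_cases hE' : E a c
  · exact hR c' c' b' b (Or.inl rfl) (hc c' (hE.1.trans (hE.1.symm hE') hac')) hb
  · rcases hac with rfl | hac
    · exact (hE' (hE.1.refl _)).elim
    · exact hR c' c' b' b (Or.inl rfl) (forall_of_exists_of_lt hE hR hac hE'
        ⟨c, hE.1.refl c, hc c (hE.1.refl c)⟩ c' hac') hb

theorem IsMonotoneRel.exists_equiv (hE : IsConvexEquivalence r E)
    (hR : IsMonotoneRel (reverseOn r E) s R) :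
    IsMonotoneRel r s fun a b => ∃ a', E a a' ∧ R a' b := by
  rintro a c b' b hac ⟨c', hcc', hc⟩ hb
  by_cases hE' : E a c
  · exact ⟨c', hE.1.trans hE' hcc', hR c' c' b' b (Or.inl rfl) hc hb⟩
  · rcases hac with rfl | hac
    · exact (hE' (hE.1.refl _)).elim
    · exact ⟨a, hE.1.refl a, hR a a b' b (Or.inl rfl)
        (forall_of_exists_of_lt hE hR hac hE' ⟨c', hcc', hc⟩ a (hE.1.refl a)) hb⟩

theorem criticalRel.of_equiv (hE : Equivalence E) {a a' b : M} (haa' : E a a')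
    (h : criticalRel R E a b) : criticalRel R E a' b := by
  obtain ⟨⟨c, hc, hcb⟩, h2⟩ := h
  exact ⟨⟨c, hE.trans (hE.symm haa') hc, hcb⟩, fun h => h2 fun d hd =>
    h d (hE.trans (hE.symm haa') hd)⟩

/-- For fixed `b` only one class is critical: a class below one that meets the fibre is contained in
the fibre. -/
theorem criticalRel.equiv (hE : IsConvexEquivalence r E)
    (hR : IsMonotoneRel (reverseOn r E) s R) {a a' b : M}
    (h : criticalRel R E a b) (h' : criticalRel R E a' b) : E a a' := by
  by_contra haa'
  rcases trichotomous_of r a a' with h1 | rfl | h1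
  · exact h.2 (forall_of_exists_of_lt hE hR h1 haa' h'.1)
  · exact haa' (hE.1.refl a)
  · exact h'.2 (forall_of_exists_of_lt hE hR h1 (fun h => haa' (hE.1.symm h)) h.1)

/-- Two points with the same critical class. -/
def sameCritical (R E : M → M → Prop) (b b' : M) : Prop :=
  b = b' ∨ ∃ a, criticalRel R E a b ∧ criticalRel R E a b'

/-- Uniqueness of the critical class gives transitivity. Convexity holds since both "some point of
the class" and "every point of the class" are monotone in `b`. -/
theorem isConvexEquivalence_sameCritical [IsStrictTotalOrder M s] (hE : IsConvexEquivalence r E)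
    (hR : IsMonotoneRel (reverseOn r E) s R) : IsConvexEquivalence s (sameCritical R E) := by
  refine isConvexEquivalence_of ⟨fun _ => Or.inl rfl, ?_, ?_⟩ ?_
  · rintro x y (rfl | ⟨a, h1, h2⟩)
    · exact Or.inl rfl
    · exact Or.inr ⟨a, h2, h1⟩
  · rintro x y z (rfl | ⟨a, h1, h2⟩) (rfl | ⟨a', h3, h4⟩)
    · exact Or.inl rfl
    · exact Or.inr ⟨a', h3, h4⟩
    · exact Or.inr ⟨a, h1, h2⟩
    · exact Or.inr ⟨a, h1, h4.of_equiv hE.1 (h3.equiv hE hR h2)⟩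
  · rintro x y z hxy hyz (rfl | ⟨a, h1, h2⟩)
    · exact (asymm_of s hxy hyz).elim
    · refine Or.inr ⟨a, h1, ?_, fun h => h2.2 ?_⟩
      · exact hR.exists_equiv hE a a y x (Or.inl rfl) h1.1 (Or.inr hxy)
      · exact hR.forall_equiv hE a a z y (Or.inl rfl) h (Or.inr hyz)

/-- The relation says that the class lies in the fibre, or is critical with `R a b` false. Inside a
critical class `R` is initial for the reversed order, so its negation is initial for `r`; the
negation shrinks as `b` grows along `s`, so it grows once `s` is reversed among points with that
critical class. -/
theorem IsMonotoneRel.reverse_critical (hE : IsConvexEquivalence r E)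
    (hR : IsMonotoneRel (reverseOn r E) s R) :
    IsMonotoneRel r (reverseOn s (sameCritical R E)) fun a b =>
      (∃ a', E a a' ∧ R a' b) ∧ (R a b → ∀ a', E a a' → R a' b) := by
  have hfst : ∀ a a' b, (a = a' ∨ r a a') →
      ((∃ c, E a' c ∧ R c b) ∧ (R a' b → ∀ c, E a' c → R c b)) →
      ((∃ c, E a c ∧ R c b) ∧ (R a b → ∀ c, E a c → R c b)) := by
    rintro a a' b (rfl | haa') ⟨⟨c, hc, hcb⟩, h2⟩
    · exact ⟨⟨c, hc, hcb⟩, h2⟩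
    by_cases hE' : E a a'
    · refine ⟨⟨c, hE.1.trans hE' hc, hcb⟩, fun hab d hd => ?_⟩
      refine h2 ?_ d (hE.1.trans (hE.1.symm hE') hd)
      exact hR a' a b b (Or.inr (Or.inl ⟨hE.1.symm hE', haa'⟩)) hab (Or.inl rfl)
    · have h := forall_of_exists_of_lt hE hR haa' hE' ⟨c, hc, hcb⟩
      exact ⟨⟨a, hE.1.refl a, h a (hE.1.refl a)⟩, fun _ => h⟩
  intro a a' b b' haa' h hb
  refine hfst a a' b haa' ?_
  obtain ⟨h1, h2⟩ := h
  rcases hb with rfl | ⟨hF, hb⟩ | ⟨hF, hb⟩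
  · exact ⟨h1, h2⟩
  · rcases hF with rfl | ⟨d, hd, hd'⟩
    · exact ⟨h1, h2⟩
    by_cases hda : E d a'
    · refine ⟨(hd'.of_equiv hE.1 hda).1, fun h3 => ?_⟩
      have h4 := h2 (hR a' a' b' b (Or.inl rfl) h3 (Or.inr hb))
      exact ((hd.of_equiv hE.1 hda).2 h4).elim
    · have had : r a' d := by
        rcases trichotomous_of r a' d with h | rfl | h
        · exact h
        · exact (hda (hE.1.refl _)).elim
        · exact (hd.2 (forall_of_exists_of_lt hE hR h hda h1)).elim
      have h4 := forall_of_exists_of_lt hE hR had (fun h => hda (hE.1.symm h)) hd'.1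
      exact ⟨⟨a', hE.1.refl _, h4 _ (hE.1.refl _)⟩, fun _ => h4⟩
  · refine ⟨hR.exists_equiv hE a' a' b b' (Or.inl rfl) h1 (Or.inr hb), fun _ => ?_⟩
    by_cases h3 : ∀ c, E a' c → R c b'
    · exact hR.forall_equiv hE a' a' b b' (Or.inl rfl) h3 (Or.inr hb)
    · by_contra h4
      exact hF (Or.inr ⟨a', ⟨h1, h3⟩,
        hR.exists_equiv hE a' a' b b' (Or.inl rfl) h1 (Or.inr hb), h4⟩)

end Critical

/-! ### Quantifier elimination in the special reduct -/

/-- The sets of `k`-tuples named by the special reduct. -/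
def specialAtoms (L : FirstOrder.Language.{u, v}) [L.Structure M] (A : Set M)
    (lt : M → M → Prop) (k : ℕ) : Set (Set (Fin k → M)) :=
  {S | (∃ C ∈ unarySets L A, ∃ i, S = {v | v i ∈ C}) ∨
    ∃ T ∈ monotoneRels L A lt (specialOrders L A lt), ∃ i j, S = {v | T (v i) (v j)}}

/-- The sets of pairs `(v, x)` named by the special reduct, where `v` and `x` are only compared by
relations whose fibres over `v` are initial segments. -/
def specialFibreAtoms (L : FirstOrder.Language.{u, v}) [L.Structure M] (A : Set M)
    (lt : M → M → Prop) (k : ℕ) : Set (Set ((Fin k → M) × M)) :=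
  {S | (∃ a ∈ specialAtoms L A lt k, S = {p | p.1 ∈ a}) ∨ (∃ C ∈ unarySets L A, S = {p | p.2 ∈ C}) ∨
    ∃ T ∈ monotoneRels L A lt (specialOrders L A lt), ∃ i, S = {p | T p.2 (p.1 i)}}

theorem exists_finite_fibre_data {k : ℕ} (F : Finset (Set ((Fin k → M) × M)))
    (hF : ∀ S ∈ F, S ∈ specialFibreAtoms L A lt k) :
    ∃ (As : Finset (Set (Fin k → M))) (Cs : Finset (Set M))
      (Ts : Finset ((M → M → Prop) × Fin k)),
      (∀ a ∈ As, a ∈ specialAtoms L A lt k) ∧ (∀ C ∈ Cs, C ∈ unarySets L A) ∧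
      (∀ t ∈ Ts, t.1 ∈ monotoneRels L A lt (specialOrders L A lt)) ∧
      ∀ p q : (Fin k → M) × M, (∀ a ∈ As, p.1 ∈ a ↔ q.1 ∈ a) → (∀ C ∈ Cs, p.2 ∈ C ↔ q.2 ∈ C) →
        (∀ t ∈ Ts, t.1 p.2 (p.1 t.2) ↔ t.1 q.2 (q.1 t.2)) → ∀ S ∈ F, p ∈ S ↔ q ∈ S := by
  classical
  induction F using Finset.induction_on with
  | empty => exact ⟨∅, ∅, ∅, by simp, by simp, by simp, by simp⟩
  | insert S F _ ih =>
    obtain ⟨As, Cs, Ts, hAs, hCs, hTs, h⟩ := ih fun S hS => hF S (by simp [hS])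
    rcases hF S (by simp) with ⟨a, ha, rfl⟩ | ⟨C, hC, rfl⟩ | ⟨T, hT, i, rfl⟩
    · refine ⟨insert a As, Cs, Ts, ?_, hCs, hTs, fun p q h1 h2 h3 S hS => ?_⟩
      · simpa [ha] using hAs
      · rcases Finset.mem_insert.1 hS with rfl | hS
        · exact h1 a (by simp)
        · exact h p q (fun a ha => h1 a (by simp [ha])) h2 h3 S hS
    · refine ⟨As, insert C Cs, Ts, hAs, ?_, hTs, fun p q h1 h2 h3 S hS => ?_⟩
      · simpa [hC] using hCs
      · rcases Finset.mem_insert.1 hS with rfl | hS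
        · exact h2 C (by simp)
        · exact h p q h1 (fun a ha => h2 a (by simp [ha])) h3 S hS
    · refine ⟨As, Cs, insert (T, i) Ts, hAs, hCs, ?_, fun p q h1 h2 h3 S hS => ?_⟩
      · intro t ht
        rcases Finset.mem_insert.1 ht with rfl | ht
        · exact hT
        · exact hTs t ht
      · rcases Finset.mem_insert.1 hS with rfl | hS
        · exact h3 (T, i) (by simp)
        · exact h p q h1 h2 (fun a ha => h3 a (by simp [ha])) S hS

theorem const_mem_monotoneRels (p : Prop) :
    (fun _ _ => p) ∈ monotoneRels L A lt (specialOrders L A lt) :=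
  ⟨DefPred.const p, lt, lt_mem_specialOrders, fun _ _ _ _ _ h _ => h⟩

theorem DetBy.specialAtoms_of_pairs {R : M → M → Prop} {k : ℕ}
    (h : DetBy (specialPairs L A lt) {p | R p.1 p.2}) (i j : Fin k) :
    DetBy (specialAtoms L A lt k) {v : Fin k → M | R (v i) (v j)} := by
  refine h.preimage (fun v : Fin k → M => (v i, v j)) ?_
  rintro _ ⟨T, hT, rfl⟩
  exact DetBy.of_mem (Or.inr ⟨T, hT, i, j, rfl⟩)

theorem isWeaklySpecialStructure_of_isWeaklyMonotoneStructure
    (hS : IsWeaklyMonotoneStructure L M lt) : IsWeaklySpecialStructure L M lt := by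
  intro A hA
  have h : ∀ R ∈ binaryRels L A, R ∈ binaryRels
      (monotoneReduct L A lt (specialOrders L A lt)) (∅ : Set M) := by
    intro R hR
    refine definable_reduct_of (fun C hC => defPred_reduct_unary hC 0) (fun T hT => ?_) 2 _
      ((hS A hA 2 _).1 (defPred_reduct_binary hR 0 1))
    exact defPred_reduct_binary (B := monotoneRels L A lt (specialOrders L A lt))
      ⟨hT.1, hT.2.imp fun r hr => ⟨weakOrders_subset_specialOrders hr.1, hr.2⟩⟩ 0 1
  exact definitionallyEquivalent_of subset_rfl (fun R hR => hR.1)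
    (fun C hC => defPred_reduct_unary hC 0) h

variable [IsStrictTotalOrder M lt]

/-- Every definable relation that is monotone between two special orders is determined by special
relations. -/
theorem detBy_specialPairs {r s R : M → M → Prop}
    (hr : r ∈ specialOrders L A lt) (hs : s ∈ specialOrders L A lt) (hR : R ∈ binaryRels L A)
    (hm : IsMonotoneRel r s R) : DetBy (specialPairs L A lt) {p | R p.1 p.2} := by
  classical
  obtain ⟨Es, hEs, hadm, rfl⟩ := hr
  -- The last reversal `E` of the first order is traded for one more reversal, along `sameCritical R
  -- E`, of the second.
  induction Es using List.reverseRecOn generalizing s R with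
  | nil => exact DetBy.of_mem ⟨R, ⟨hR, s, hs, hm⟩, rfl⟩
  | append_singleton Es E ih =>
    obtain ⟨hadm', hE⟩ := isAdmissible_concat_iff.1 hadm
    have hEd := hEs E (by simp)
    have hso := isStrictTotalOrder_of_mem_specialOrders hs
    have := isStrictTotalOrder_reverseAlong hadm'
    rw [reverseAlong_concat] at hm
    have ih' := fun {s R} => ih (s := s) (R := R) (hEs := fun F hF => hEs F (by simp [hF]))
      (hadm := hadm')
    have hex : (fun a b => ∃ a', E a a' ∧ R a' b) ∈ binaryRels L A :=
      DefPred.ex ((defPred_binary hEd _ _).and (defPred_binary hR _ _))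
    have hall : (fun a b => ∀ a', E a a' → R a' b) ∈ binaryRels L A :=
      DefPred.all ((defPred_binary hEd _ _).imp (defPred_binary hR _ _))
    have hcrit : criticalRel R E ∈ binaryRels L A :=
      DefPred.and (mem_binaryRels_iff.1 hex) (mem_binaryRels_iff.1 hall).not
    have hsame : sameCritical R E ∈ binaryRels L A :=
      (DefPred.eq _ _).or (DefPred.ex ((defPred_binary hcrit _ _).and (defPred_binary hcrit _ _)))
    have hs' : reverseOn s (sameCritical R E) ∈ specialOrders L A lt := by
      obtain ⟨Fs, hFs, hFadm, rfl⟩ := hs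
      refine ⟨Fs ++ [sameCritical R E], ?_, isAdmissible_concat_iff.2
        ⟨hFadm, isConvexEquivalence_sameCritical hE hm⟩, (reverseAlong_concat Fs).symm⟩
      intro F hF
      rcases List.mem_append.1 hF with hF | hF
      · exact hFs F hF
      · exact List.mem_singleton.1 hF ▸ hsame
    refine DetBy.of_determined
      {{p | ∃ a', E p.1 a' ∧ R a' p.2}, {p | ∀ a', E p.1 a' → R a' p.2},
        {p | (∃ a', E p.1 a' ∧ R a' p.2) ∧ (R p.1 p.2 → ∀ a', E p.1 a' → R a' p.2)}} ?_ ?_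
    · intro C hC
      simp only [Finset.mem_insert, Finset.mem_singleton] at hC
      rcases hC with rfl | rfl | rfl
      · exact ih' hs hex (hm.exists_equiv hE)
      · exact ih' hs hall (hm.forall_equiv hE)
      · exact ih' hs' (DefPred.and (mem_binaryRels_iff.1 hex) ((mem_binaryRels_iff.1 hR).imp
          (mem_binaryRels_iff.1 hall))) (hm.reverse_critical hE)
    · rintro ⟨a, b⟩ ⟨a', b'⟩ hp hab
      have h1 := hp {p | ∃ a', E p.1 a' ∧ R a' p.2} (by simp)
      have h2 := hp {p | ∀ a', E p.1 a' → R a' p.2} (by simp)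
      have h3 := hp {p | (∃ a', E p.1 a' ∧ R a' p.2) ∧ (R p.1 p.2 → ∀ a', E p.1 a' → R a' p.2)}
        (by simp)
      simp only [Set.mem_ofPred_eq] at h1 h2 h3 hab ⊢
      by_cases hu : ∀ c, E a c → R c b
      · exact h2.1 hu a' (hE.1.refl a')
      · by_contra hab'
        have := h3.2 ⟨h1.1 ⟨a, hE.1.refl a, hab⟩, fun h => (hab' h).elim⟩
        exact hu (this.2 hab)

/-- Negation and exchange of variables turn an `(lt, r)`-monotone relation into an `(r,
lt)`-monotone one, to which `detBy_specialPairs` applies. -/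
theorem detBy_specialPairs_swap {T : M → M → Prop}
    (hT : T ∈ monotoneRels L A lt (specialOrders L A lt)) :
    DetBy (specialPairs L A lt) {p | T p.2 p.1} := by
  obtain ⟨hTd, r, hr, hm⟩ := hT
  have hro := isStrictTotalOrder_of_mem_specialOrders hr
  have h := detBy_specialPairs (R := fun a b => ¬ T b a) hr lt_mem_specialOrders
    (mem_binaryRels_iff.2 (defPred_binary hTd 1 0).not) ?_
  · simpa [Set.compl_ofPred] using h.compl
  · intro a a' b b' haa' h hbb' h'
    exact h (hm b' b a' a hbb' h' haa')

theorem detBy_specialFibreAtoms {k : ℕ} {S : Set (Fin (k + 1) → M)}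
    (hS : DetBy (specialAtoms L A lt (k + 1)) S) :
    DetBy (specialFibreAtoms L A lt k)
      {p : (Fin k → M) × M | Fin.snoc (α := fun _ => M) p.1 p.2 ∈ S} := by
  refine hS.preimage (fun p : (Fin k → M) × M => Fin.snoc (α := fun _ => M) p.1 p.2) ?_
  rintro _ (⟨C, hC, i, rfl⟩ | ⟨T, hT, i, j, rfl⟩)
  · refine Fin.lastCases ?_ (fun i => ?_) i
    · exact DetBy.of_mem (Or.inr (Or.inl ⟨C, hC, by ext; simp⟩))
    · exact DetBy.of_mem (Or.inl ⟨_, Or.inl ⟨C, hC, i, rfl⟩, by ext; simp⟩)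
  · refine Fin.lastCases ?_ (fun i => ?_) i <;> refine Fin.lastCases ?_ (fun j => ?_) j
    · exact DetBy.of_mem (Or.inr (Or.inl ⟨{x | T x x}, defPred_binary hT.1 0 0, by ext; simp⟩))
    · exact DetBy.of_mem (Or.inr (Or.inr ⟨T, hT, j, by ext; simp⟩))
    · have h := (detBy_specialPairs_swap hT).preimage (G' := specialFibreAtoms L A lt k)
        (fun p : (Fin k → M) × M => (p.2, p.1 i)) ?_
      · convert h using 1
        ext; simp
      · rintro _ ⟨T, hT, rfl⟩
        exact DetBy.of_mem (Or.inr (Or.inr ⟨T, hT, i, rfl⟩))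
    · exact DetBy.of_mem (Or.inl ⟨_, Or.inr ⟨T, hT, i, j, rfl⟩, by ext; simp⟩)

/-- The points whose membership in the members of `Cs` is given by `Cs'`. -/
def patternSet (Cs Cs' : Finset (Set M)) : Set M := {x | ∀ C ∈ Cs, x ∈ C ↔ C ∈ Cs'}

/-- As a relation from `v t'.2` to `v t.2` this is monotone between the special orders of `t'` and
`t`, because the fibres of each grow along its order. -/
theorem detBy_exists_between {k : ℕ} {Q : Set M} (hQ : Q ∈ unarySets L A)
    {t t' : (M → M → Prop) × Fin k}
    (ht : t.1 ∈ monotoneRels L A lt (specialOrders L A lt))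
    (ht' : t'.1 ∈ monotoneRels L A lt (specialOrders L A lt)) :
    DetBy (specialAtoms L A lt k) {v | ∃ x ∈ Q, t.1 x (v t.2) ∧ ¬ t'.1 x (v t'.2)} := by
  obtain ⟨T, i⟩ := t
  obtain ⟨T', j⟩ := t'
  obtain ⟨hTd, r, hr, hm⟩ := ht
  obtain ⟨hTd', r', hr', hm'⟩ := ht'
  have hro := isStrictTotalOrder_of_mem_specialOrders hr
  have hro' := isStrictTotalOrder_of_mem_specialOrders hr'
  refine DetBy.specialAtoms_of_pairs (R := fun b' b => ∃ x ∈ Q, T x b ∧ ¬ T' x b') ?_ j i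
  refine detBy_specialPairs (R := fun b' b => ∃ x ∈ Q, T x b ∧ ¬ T' x b') hr' hr ?_ ?_
  · exact DefPred.ex ((defPred_unary hQ _).and ((defPred_binary hTd _ _).and
      (defPred_binary hTd' _ _).not))
  · rintro a a' b b' haa' ⟨x, hx, h1, h2⟩ hb
    exact ⟨x, hx, hm x x b b' (Or.inl rfl) h1 hb, fun h => h2 (hm' x x a' a (Or.inl rfl) h haa')⟩

/-- Fibres over `v` are initial segments of `lt`, hence nested. A prescribed finite pattern of
memberships is met by any point of the right unary type inside the smallest required fibre and
outside the largest forbidden one. -/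
theorem detBy_exists {k : ℕ} {P : Set ((Fin k → M) × M)}
    (hP : DetBy (specialFibreAtoms L A lt k) P) :
    DetBy (specialAtoms L A lt k) {v | ∃ x, (v, x) ∈ P} := by
  classical
  rcases k.eq_zero_or_pos with rfl | hk
  · exact ⟨∅, by simp, fun x y _ hx => Subsingleton.elim x y ▸ hx⟩
  obtain ⟨F, hF, hdet⟩ := hP
  obtain ⟨As, Cs, Ts, hAs, hCs, hTs, hfin⟩ := exists_finite_fibre_data F hF
  -- The constant relations ensure that there is always a required and a forbidden fibre; the index
  -- `0` attached to them is a dummy.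
  let Ts' := insert (fun _ _ => True, ⟨0, hk⟩) (insert (fun _ _ => False, ⟨0, hk⟩) Ts)
  have hTs' : ∀ t ∈ Ts', t.1 ∈ monotoneRels L A lt (specialOrders L A lt) := by
    intro t ht
    rcases Finset.mem_insert.1 ht with rfl | ht
    · exact const_mem_monotoneRels _
    rcases Finset.mem_insert.1 ht with rfl | ht
    · exact const_mem_monotoneRels _
    · exact hTs t ht
  have hpat : ∀ Cs', patternSet Cs Cs' ∈ unarySets L A := fun Cs' =>
    DefPred.finset_and Cs fun C hC => (defPred_unary (hCs C hC) 0).iff (DefPred.const _)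
  refine DetBy.of_determined (As ∪ (Cs.powerset ×ˢ (Ts' ×ˢ Ts')).image fun d =>
    {v | ∃ x ∈ patternSet Cs d.1, d.2.1.1 x (v d.2.1.2) ∧ ¬ d.2.2.1 x (v d.2.2.2)}) ?_ ?_
  · intro C hC
    rcases Finset.mem_union.1 hC with hC | hC
    · exact DetBy.of_mem (hAs C hC)
    · obtain ⟨⟨Cs', t, t'⟩, hd, rfl⟩ := Finset.mem_image.1 hC
      simp only [Finset.mem_product] at hd
      exact detBy_exists_between (hpat _) (hTs' _ hd.2.1) (hTs' _ hd.2.2)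
  · rintro v v' hv ⟨x, hx⟩
    let f : (M → M → Prop) × Fin k → Set M := fun t => {y | t.1 y (v' t.2)}
    have hinit : ∀ t ∈ Ts', ∀ y z, lt y z → z ∈ f t → y ∈ f t := by
      intro t ht y z hyz hz
      obtain ⟨-, r, -, hm⟩ := hTs' t ht
      exact hm y z _ _ (Or.inr hyz) hz (Or.inl rfl)
    have htot : ∀ t ∈ Ts', ∀ t' ∈ Ts', f t ⊆ f t' ∨ f t' ⊆ f t := by
      intro t ht t' ht'
      by_contra! h
      obtain ⟨y, hy, hy'⟩ := Set.not_subset.1 h.1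
      obtain ⟨z, hz, hz'⟩ := Set.not_subset.1 h.2
      rcases trichotomous_of lt y z with h | rfl | h
      · exact hy' (hinit t' ht' _ _ h hz)
      · exact hy' hz
      · exact hz' (hinit t ht _ _ h hy)
    -- The extremal fibres are chosen at `v'`, though the lists of required and forbidden ones are
    -- read off from `x` at `v`.
    obtain ⟨t, ht, hmin⟩ := exists_minimal_of_total (s := Ts'.filter fun t => t.1 x (v t.2))
      ⟨(fun _ _ => True, ⟨0, hk⟩), by simp [Ts']⟩ f fun i hi j hj =>
        htot i (Finset.mem_filter.1 hi).1 j (Finset.mem_filter.1 hj).1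
    obtain ⟨t', ht', hmax⟩ := exists_minimal_of_total (s := Ts'.filter fun t => ¬ t.1 x (v t.2))
      ⟨(fun _ _ => False, ⟨0, hk⟩), by simp [Ts']⟩ (fun t => (f t)ᶜ) fun i hi j hj => by
        simpa only [Set.compl_subset_compl] using
          htot j (Finset.mem_filter.1 hj).1 i (Finset.mem_filter.1 hi).1
    obtain ⟨htT, htx⟩ := Finset.mem_filter.1 ht
    obtain ⟨htT', htx'⟩ := Finset.mem_filter.1 ht'
    have hx' := (hv {v | ∃ y ∈ patternSet Cs (Cs.filter fun C => x ∈ C),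
      t.1 y (v t.2) ∧ ¬ t'.1 y (v t'.2)} ?_).1 ⟨x, ?_, htx, htx'⟩
    · obtain ⟨x', hx'Q, hx't, hx't'⟩ := hx'
      refine ⟨x', hdet (v, x) (v', x') (hfin _ _ (fun a ha => hv a (by simp [ha])) ?_ ?_) hx⟩
      · intro C hC
        have := hx'Q C hC
        simp only [Finset.mem_filter, hC, true_and] at this
        exact this.symm
      · intro s hs
        have hs' : s ∈ Ts' := by simp [Ts', hs]
        by_cases hsx : s.1 x (v s.2)
        · exact iff_of_true hsx (hmin s (Finset.mem_filter.2 ⟨hs', hsx⟩) hx't)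
        · exact iff_of_false hsx (hmax s (Finset.mem_filter.2 ⟨hs', hsx⟩) hx't')
    · refine Finset.mem_union_right _ (Finset.mem_image.2
        ⟨(Cs.filter fun C => x ∈ C, t, t'), ?_, rfl⟩)
      simp only [Finset.mem_product, Finset.mem_powerset]
      exact ⟨Finset.filter_subset _ _, htT, htT'⟩
    · intro C hC
      simp [hC]

/-- Definable sets of the special reduct are Boolean combinations of named sets. -/
theorem detBy_specialAtoms_of_definable (hlt : lt ∈ binaryRels L A) (n : ℕ) (S : Set (Fin n → M))
    (hS : (∅ : Set M).Definable (monotoneReduct L A lt (specialOrders L A lt)) S) :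
    DetBy (specialAtoms L A lt n) S := by
  have hle : (fun x y => x = y ∨ lt x y) ∈ monotoneRels L A lt (specialOrders L A lt) := by
    refine ⟨(DefPred.eq _ _).or (defPred_binary hlt _ _), lt, lt_mem_specialOrders, ?_⟩
    have htr : ∀ {x y z : M}, (x = y ∨ lt x y) → (y = z ∨ lt y z) → (x = z ∨ lt x z) := by
      rintro x y z (rfl | h) (rfl | h')
      · exact Or.inl rfl
      · exact Or.inr h'
      · exact Or.inr h
      · exact Or.inr (_root_.trans h h')
    exact fun a a' b b' h1 h2 h3 => htr h1 (htr h2 h3)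
  refine reduct_induction (fun k P => DetBy (specialAtoms L A lt k) {v | P v})
    ?_ (fun k P Q => DetBy.himp) ?_ ?_ ?_ ?_ n S hS
  · exact fun k => ⟨∅, by simp, fun _ _ _ h => h⟩
  · intro k i j
    classical
    -- Equality is not among the atoms; it is recovered from the two non-strict inequalities by
    -- antisymmetry.
    refine DetBy.of_determined {{v | v i = v j ∨ lt (v i) (v j)}, {v | v j = v i ∨ lt (v j) (v i)}}
      ?_ ?_
    · intro C hC
      simp only [Finset.mem_insert, Finset.mem_singleton] at hC
      rcases hC with rfl | rfl
      · exact DetBy.of_mem (Or.inr ⟨_, hle, i, j, rfl⟩)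
      · exact DetBy.of_mem (Or.inr ⟨_, hle, j, i, rfl⟩)
    · intro v v' hv hvij
      have h1 := (hv {v | v i = v j ∨ lt (v i) (v j)} (by simp)).1 (Or.inl hvij)
      have h2 := (hv {v | v j = v i ∨ lt (v j) (v i)} (by simp)).1 (Or.inl hvij.symm)
      rcases h1 with h1 | h1
      · exact h1
      rcases h2 with h2 | h2
      · exact h2.symm
      · exact (asymm_of lt h1 h2).elim
  · exact fun C hC k i => DetBy.of_mem (Or.inl ⟨C, hC, i, rfl⟩)
  · exact fun R hR k i j => DetBy.of_mem (Or.inr ⟨R, hR, i, j, rfl⟩)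
  · intro k P hP
    have h := (detBy_exists (detBy_specialFibreAtoms hP.compl)).compl
    convert h using 1
    ext v
    simp

/-! ### Weakly special structures are weakly quasi-o-minimal -/

/-- Only atoms in two variables matter. With one variable fixed, a monotone relation cuts out an
initial segment of `lt` or a final segment of a special order; the latter is a Boolean combination
of `lt`-convex sets. -/
theorem fibre_mem_closure (hlt : lt ∈ binaryRels L A)
    (hS : DefinitionallyEquivalent (fullBinaryReduct L A)
      (monotoneReduct L A lt (specialOrders L A lt)) M)
    {R : M → M → Prop} (hR : R ∈ binaryRels L A) (a : M) :
    {y | R a y} ∈ BooleanSubalgebra.closure {C | IsConvex lt C ∨ C ∈ definableAlgebra L A} := by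
  set B := BooleanSubalgebra.closure {C : Set M | IsConvex lt C ∨ C ∈ definableAlgebra L A}
  have hsub : ∀ C, IsConvex lt C ∨ C ∈ definableAlgebra L A → C ∈ B := fun C hC =>
    BooleanSubalgebra.subset_closure hC
  have hconst : ∀ p : Prop, {_y : M | p} ∈ B := by
    intro p
    by_cases hp : p
    · simp only [hp]
      exact B.top_mem
    · simp only [hp]
      exact B.bot_mem
  have hdef := detBy_specialAtoms_of_definable hlt 2 {v | R (v 0) (v 1)}
    ((hS 2 _).1 (defPred_reduct_binary hR 0 1))
  refine (hdef.preimage (G' := (B : Set (Set M))) (fun y => ![a, y]) ?_).mem fun _ h => h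
  rintro _ (⟨C, hC, i, rfl⟩ | ⟨T, ⟨hT, r, ⟨Es, hEs, hadm, rfl⟩, hm⟩, i, j, rfl⟩)
  · refine DetBy.of_mem ?_
    fin_cases i
    · exact hconst (a ∈ C)
    · exact hsub _ (Or.inr hC)
  · refine DetBy.of_mem ?_
    fin_cases i <;> fin_cases j
    · exact hconst (T a a)
    · refine mem_of_convex_reverseAlong hadm (fun C hC => hsub C (Or.inl hC)) ?_
      exact fun x hx y hy z hxz hzy => hm a a z x (Or.inl rfl) hx (Or.inr hxz)
    · refine hsub _ (Or.inl ?_)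
      exact fun x hx y hy z hxz hzy => hm z y a a (Or.inr hzy) hy (Or.inl rfl)
    · exact hsub _ (Or.inr (defPred_binary hT 0 0))

/-- Parameters are removed one at a time: a set definable over `A ∪ {a}` is the fibre at `a` of an
`A`-definable binary relation. -/
theorem isWeaklyQuasiOMinimalStructure_of_isWeaklySpecialStructure
    (hlt : lt ∈ binaryRels L (∅ : Set M)) (hS : IsWeaklySpecialStructure L M lt) :
    IsWeaklyQuasiOMinimalStructure L M lt := by
  have key : ∀ A : Set M, A.Finite → ∀ D ∈ unarySets L A,
      D ∈ BooleanSubalgebra.closure {C | IsConvex lt C ∨ C ∈ definableAlgebra L ∅} := by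
    intro A hA
    induction A, hA using Set.Finite.induction_on with
    | empty => exact fun D hD => BooleanSubalgebra.subset_closure (Or.inr hD)
    | @insert a A _ hA ih =>
      intro D hD
      obtain ⟨Q, hQ, hQD⟩ := DefPred.exists_extension hD
      have hR : (fun x y => Q (Sum.elim (fun _ => y) fun _ => x)) ∈ binaryRels L A := by
        refine (hQ.comp (Sum.elim (fun _ => (1 : Fin 2)) fun _ => 0)).congr fun v => ?_
        refine iff_of_eq (congrArg Q (funext fun i => ?_))
        rcases i with i | i <;> rfl
      have h := fibre_mem_closure (binaryRels_mono (Set.empty_subset A) hlt) (hS A hA) hR a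
      have hD' : {y | Q (Sum.elim (fun _ => y) fun _ => a)} = D := by
        ext y
        exact hQD fun _ => y
      rw [hD'] at h
      refine BooleanSubalgebra.closure_le.2 ?_ h
      rintro C (hC | hC)
      · exact BooleanSubalgebra.subset_closure (Or.inl hC)
      · exact ih C hC
  intro D hD
  obtain ⟨A, -, hA⟩ := Set.definable_iff_finitely_definable.1 hD
  exact key A A.finite_toSet D hA

end Conversion
end BinaryReducts

namespace BinaryReducts
open FirstOrder Set

/-! ### Transfer of weak quasi-o-minimality between models -/

section Transfer

variable {L : FirstOrder.Language.{u, v}}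

theorem UnifDef.ex_tuple {α β : Type*} [Finite β]
    {P : ∀ (M : Type w) [L.Structure M], (α → M) → (β → M) → Prop}
    (hP : UnifDef.{u, v, w} L fun M _ (w : α ⊕ β → M) =>
      P M (fun i => w (Sum.inl i)) (fun i => w (Sum.inr i))) :
    UnifDef.{u, v, w} L fun M _ v => ∃ z, P M v z := by
  obtain ⟨φ, hφ⟩ := hP
  refine ⟨φ.iExs β, fun M _ v => ?_⟩
  rw [Language.Formula.realize_iExs]
  exact exists_congr fun z => hφ M _

theorem UnifDef.all_tuple {α β : Type*} [Finite β]
    {P : ∀ (M : Type w) [L.Structure M], (α → M) → (β → M) → Prop}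
    (hP : UnifDef.{u, v, w} L fun M _ (w : α ⊕ β → M) =>
      P M (fun i => w (Sum.inl i)) (fun i => w (Sum.inr i))) :
    UnifDef.{u, v, w} L fun M _ v => ∀ z, P M v z :=
  (UnifDef.ex_tuple (P := fun M _ v z => ¬ P M v z) hP.not).not.congr fun _ _ _ => by
    push Not; rfl

theorem defPred_formula {M : Type w} [L.Structure M] {α : Type*} (φ : L.Formula α) :
    DefPred L (∅ : Set M) fun v => φ.Realize v :=
  Set.empty_definable_iff.2 ⟨φ, rfl⟩

theorem relOf_mem_binaryRels {M : Type w} [L.Structure M] (lt : L.Formula (Fin 2)) :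
    relOf lt M ∈ binaryRels L (∅ : Set M) :=
  (defPred_formula lt).congr fun v => iff_of_eq (congrArg _ (funext fun i => by
    fin_cases i <;> rfl))

theorem unifDef_relOf {α : Type*} (lt : L.Formula (Fin 2)) (i j : α) :
    UnifDef.{u, v, w} L fun M _ v => relOf lt M (v i) (v j) :=
  (unifDef_formula lt ![i, j]).congr fun M _ v => iff_of_eq (congrArg _ (funext fun i => by
    fin_cases i <;> rfl))

theorem unifDef_altOn (lt : L.Formula (Fin 2)) (θ : L.Formula (Fin 1)) {β : Type*}
    (φ : L.Formula (β ⊕ Unit)) (n : ℕ) :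
    UnifDef.{u, v, w} L fun M _ (v : β ⊕ Unit → M) =>
      altOn (relOf lt M) {x | θ.Realize fun _ => x}
        {x | φ.Realize (Sum.elim (fun i => v (Sum.inl i)) fun _ => x)} n (v (Sum.inr ())) := by
  have hφ : ∀ i : (β ⊕ Unit) ⊕ Unit, UnifDef.{u, v, w} L fun M _ (v : (β ⊕ Unit) ⊕ Unit → M) =>
      φ.Realize (Sum.elim (fun i => v (Sum.inl (Sum.inl i))) fun _ => v i) := fun i =>
    (unifDef_formula φ (Sum.elim (fun i => Sum.inl (Sum.inl i)) fun _ => i)).congr fun M _ v =>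
      iff_of_eq (congrArg _ (funext fun j => by rcases j with j | j <;> rfl))
  induction n with
  | zero => exact unifDef_formula θ fun _ => Sum.inr ()
  | succ n ih =>
    refine (unifDef_formula θ fun _ => Sum.inr ()).and (UnifDef.ex
      (P := fun M _ v y => relOf lt M (v (Sum.inr ())) y ∧ _ ∧ _)
      ((unifDef_relOf lt _ _).and (UnifDef.and ?_ ?_)))
    · exact (hφ (Sum.inr ())).iff (hφ (Sum.inl (Sum.inr ()))).not
    · exact ih.comp (Sum.elim (fun i => Sum.inl (Sum.inl i)) fun _ => Sum.inr ())

/-- With the parameters of `D` turned into variables, the uniform cover and bound found in `M` are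
expressed by one sentence, which completeness carries to `N`. -/
theorem IsWeaklyQuasiOMinimalStructure.transfer {T : L.Theory} (hT : T.IsComplete)
    {lt : L.Formula (Fin 2)} (hlt : DefinesLinearOrder.{u, v, w} T lt)
    (M N : Language.Theory.ModelType.{u, v, max u v w} T) (hM : IsAleph0Saturated L M)
    (hW : IsWeaklyQuasiOMinimalStructure L M (relOf lt M)) :
    IsWeaklyQuasiOMinimalStructure L N (relOf lt N) := by
  classical
  have := hlt M
  have := hlt N
  intro D hD
  obtain ⟨A, -, hA⟩ := Set.definable_iff_finitely_definable.1 hD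
  obtain ⟨φ, hφ⟩ := (DefPred.iff_formula (P := fun v : Fin 1 → N => v 0 ∈ D)).1 hA
  obtain ⟨k, ⟨e⟩⟩ := Finite.exists_equiv_fin (A : Set N)
  let ψ : L.Formula (Fin k ⊕ Unit) :=
    φ.relabel (Sum.elim (fun a => Sum.inl (e a)) fun _ => Sum.inr ())
  have hψ : {x : N | ψ.Realize (Sum.elim (fun i => (e.symm i : N)) fun _ => x)} = D := by
    ext x
    refine Iff.trans ?_ (hφ fun _ => x)
    refine Language.Formula.realize_relabel.trans (iff_of_eq (congrArg _ (funext fun j => ?_)))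
    rcases j with j | j
    · simp
    · rfl
  obtain ⟨F, n, hF, hFc, hFn⟩ := exists_uniform_bound (A := ∅) (k := k)
    (R := fun b x => ψ.Realize (Sum.elim b fun _ => x)) (relOf_mem_binaryRels lt) hM hW
    Set.finite_empty ((defPred_formula ψ).congr fun v => iff_of_eq (congrArg _ (funext fun j => by
      rcases j with j | j <;> rfl)))
  have hF' : ∀ X ∈ F, ∃ θ : L.Formula (Fin 1), {x : M | θ.Realize fun _ => x} = X := by
    intro X hX
    obtain ⟨θ, hθ⟩ := Set.empty_definable_iff.1 (hF X hX)
    exact ⟨θ, Set.ext fun x => (Set.ext_iff.1 hθ fun _ => x).symm⟩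
  choose! θ hθ using hF'
  let Θ := F.toList.map θ
  have hΘ : ∀ ϑ, ϑ ∈ Θ ↔ ∃ X ∈ F, θ X = ϑ := by simp [Θ]
  have hunif : UnifDef.{u, v, max u v w} L fun K _ (_ : Empty → K) =>
      (∀ x : Unit → K, ¬ ∀ ϑ ∈ Θ, ¬ ϑ.Realize fun _ => x ()) ∧
      ∀ b : Fin k → K, ∀ x : Unit → K, ∀ ϑ ∈ Θ, ¬ altOn (relOf lt K) {x | ϑ.Realize fun _ => x}
        {x | ψ.Realize (Sum.elim b fun _ => x)} n (x ()) := by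
    refine UnifDef.and (UnifDef.all_tuple (UnifDef.not (UnifDef.list_all Θ fun ϑ _ => ?_)))
      (UnifDef.all_tuple (UnifDef.all_tuple (UnifDef.list_all Θ fun ϑ _ => ?_)))
    · exact (unifDef_formula ϑ fun _ => Sum.inr ()).not
    · exact ((unifDef_altOn lt ϑ ψ n).comp
        (Sum.elim (fun i => Sum.inl (Sum.inr i)) Sum.inr)).not
  obtain ⟨h1, h2⟩ := hunif.transfer hT M N ⟨fun x h => by
    obtain ⟨X, hX, hxX⟩ := hFc (x ())
    rw [← hθ X hX] at hxX
    exact h (θ X) ((hΘ _).2 ⟨X, hX, rfl⟩) hxX, fun b x ϑ hϑ => by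
    obtain ⟨X, hX, rfl⟩ := (hΘ _).1 hϑ
    rw [hθ X hX]
    exact hFn b X hX (x ())⟩
  refine mem_closure_convex_iff.2
    ⟨(Θ.map fun ϑ => {x : N | ϑ.Realize fun _ => x}).toFinset, n, ?_, ?_, ?_⟩
  · intro X hX
    obtain ⟨ϑ, -, rfl⟩ := List.mem_map.1 (List.mem_toFinset.1 hX)
    exact (mem_definableAlgebra L _).2 ((defPred_formula ϑ).congr fun v => iff_of_eq
      (congrArg _ (funext fun i => congrArg v (Subsingleton.elim _ _))))
  · intro x
    have := h1 fun _ => x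
    push Not at this
    obtain ⟨ϑ, hϑ, h⟩ := this
    exact ⟨_, List.mem_toFinset.2 (List.mem_map_of_mem hϑ), h⟩
  · intro X hX x
    obtain ⟨ϑ, hϑ, rfl⟩ := List.mem_map.1 (List.mem_toFinset.1 hX)
    exact hψ ▸ h2 _ (fun _ => x) ϑ hϑ

end Transfer
end BinaryReducts

namespace BinaryReducts
open FirstOrder Set

/-! ### Existence of `ℵ₀`-saturated models -/

section Existence

variable {L : FirstOrder.Language.{u, v}}

/-- A set of formulas in one variable over `M` that is finitely satisfiable in `M`. -/
def IsFinSatisfied {M : Type w} [L.Structure M] (p : Set (L.Formula (M ⊕ Unit))) : Prop :=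
  ∀ q : Finset (L.Formula (M ⊕ Unit)), (∀ φ ∈ q, φ ∈ p) →
    ∃ a : M, ∀ φ ∈ q, φ.Realize (Sum.elim id fun _ => a)

/-- Compactness for the elementary diagram of `M` together with a new constant for each finitely
satisfied set; finitely many conditions are met in `M` itself. -/
theorem exists_elementary_extension_realizing (M : Type (max u v w)) [L.Structure M] [Nonempty M] :
    ∃ (N : Type (max u v w)) (_ : L.Structure N) (_ : Nonempty N) (f : M ↪ₑ[L] N),
      ∀ p : Set (L.Formula (M ⊕ Unit)), IsFinSatisfied p →
        ∃ a : N, ∀ φ ∈ p, φ.Realize (Sum.elim f fun _ => a) := by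
  classical
  let P := {p : Set (L.Formula (M ⊕ Unit)) // IsFinSatisfied p}
  let γ := M ⊕ P
  let S : Set (L.Formula γ) := {φ | (∃ ψ : L.Formula M, ψ.Realize id ∧ φ = ψ.relabel Sum.inl) ∨
    ∃ (p : P) (ψ : L.Formula (M ⊕ Unit)), ψ ∈ p.1 ∧
      φ = ψ.relabel (Sum.elim Sum.inl fun _ => Sum.inr p)}
  let T : L[[γ]].Theory := {σ | Language.Formula.equivSentence.symm σ ∈ S}
  have hT : T.IsSatisfiable := by
    refine Language.Theory.isSatisfiable_iff_isFinitelySatisfiable.2 fun T₀ hT₀ => ?_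
    let F : P → L.Formula (M ⊕ Unit) → L[[γ]].Sentence := fun p ψ =>
      Language.Formula.equivSentence (ψ.relabel (Sum.elim Sum.inl fun _ => Sum.inr p))
    have hp : ∀ p : P, ∃ a : M, ∀ σ ∈ T₀, (∃ ψ ∈ p.1, F p ψ = σ) →
        ∃ ψ, F p ψ = σ ∧ ψ.Realize (Sum.elim id fun _ => a) := by
      intro p
      choose! ψ hψp hψ using fun (σ : L[[γ]].Sentence) (h : ∃ ψ ∈ p.1, F p ψ = σ) => h
      obtain ⟨a, ha⟩ := p.2 ((T₀.filter fun σ => ∃ ψ ∈ p.1, F p ψ = σ).image ψ) fun φ hφ => by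
        obtain ⟨σ, hσ, rfl⟩ := Finset.mem_image.1 hφ
        exact hψp σ (Finset.mem_filter.1 hσ).2
      exact ⟨a, fun σ hσ h => ⟨ψ σ, hψ σ h, ha _ (Finset.mem_image_of_mem _
        (Finset.mem_filter.2 ⟨hσ, h⟩))⟩⟩
    choose a ha using hp
    let g : γ → M := Sum.elim id a
    let _ := Language.constantsOn.structure g
    have : M ⊨ (T₀ : L[[γ]].Theory) := by
      refine ⟨fun σ hσ => ?_⟩
      rcases hT₀ hσ with ⟨ψ, hψ, h⟩ | ⟨p, ψ, hψ, h⟩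
      · rw [← Language.Formula.realize_equivSentence_symm_con, h,
          Language.Formula.realize_relabel]
        exact hψ
      · obtain ⟨ψ', rfl, hψ'⟩ := ha p σ hσ ⟨ψ, hψ, by
          rw [← Equiv.eq_symm_apply, h]⟩
        rw [Language.Formula.realize_equivSentence, Language.Formula.realize_relabel]
        refine (iff_of_eq (congrArg _ (funext fun i => ?_))).1 hψ'
        rcases i with i | i <;> rfl
    exact Language.Theory.Model.isSatisfiable M
  obtain ⟨K⟩ := hT
  let _ : L.Structure K := (L.lhomWithConstants γ).reduct K
  have : (L.lhomWithConstants γ).IsExpansionOn K := inferInstance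
  let g : γ → K := fun c => (L.con c : K)
  have hg : ∀ φ ∈ S, φ.Realize g := by
    intro φ hφ
    have h : (Language.Formula.equivSentence φ) ∈ T := by simpa [T] using hφ
    have := Language.Theory.realize_sentence_of_mem (M := K) T h
    rwa [Language.Formula.realize_equivSentence] at this
  have hel : ∀ ψ : L.Formula M, ψ.Realize id → ψ.Realize fun x => g (Sum.inl x) := by
    intro ψ hψ
    have := hg _ (Or.inl ⟨ψ, hψ, rfl⟩)
    rwa [Language.Formula.realize_relabel] at this
  refine ⟨K, inferInstance, inferInstance, ⟨fun x => g (Sum.inl x), ?_⟩, ?_⟩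
  · intro n φ x
    have h : ∀ φ : L.Formula (Fin n), φ.Realize x → φ.Realize fun i => g (Sum.inl (x i)) := by
      intro φ hφ
      have := hel (φ.relabel x) (by rwa [Language.Formula.realize_relabel])
      rwa [Language.Formula.realize_relabel] at this
    refine ⟨fun hφ => ?_, h φ⟩
    by_contra hφ'
    exact (Language.Formula.realize_not.1 (h φ.not (Language.Formula.realize_not.2 hφ'))) hφ
  · intro p hp
    refine ⟨g (Sum.inr ⟨p, hp⟩), fun φ hφ => ?_⟩
    have := hg _ (Or.inr ⟨⟨p, hp⟩, φ, hφ, rfl⟩)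
    rw [Language.Formula.realize_relabel] at this
    refine (iff_of_eq (congrArg _ (funext fun i => ?_))).1 this
    rcases i with i | i <;> rfl

/-- A subset of formulas that is finitely satisfiable in an elementary extension is finitely
satisfiable in the small model. -/
theorem IsFinSatisfied.of_elementary {M N : Type*} [L.Structure M] [L.Structure N] (f : M ↪ₑ[L] N)
    {p : Set (L.Formula (M ⊕ Unit))}
    (h : ∀ q : Finset (L.Formula (M ⊕ Unit)), (∀ φ ∈ q, φ ∈ p) →
      ∃ a : N, ∀ φ ∈ q, φ.Realize (Sum.elim f fun _ => a)) : IsFinSatisfied p := by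
  intro q hq
  obtain ⟨a, ha⟩ := h q hq
  have hN : ((Language.Formula.iInf fun φ : q => φ.1).iExs Unit : L.Formula M).Realize f := by
    rw [Language.Formula.realize_iExs]
    exact ⟨fun _ => a, Language.Formula.realize_iInf.2 fun φ => ha _ φ.2⟩
  have hM := (f.map_formula _ id).1 hN
  rw [Language.Formula.realize_iExs] at hM
  obtain ⟨b, hb⟩ := hM
  exact ⟨b (), fun φ hφ => Language.Formula.realize_iInf.1 hb ⟨φ, hφ⟩⟩

/-- The union of an elementary chain in which every structure realizes all types over the preceding
one is `ℵ₀`-saturated. -/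
theorem isAleph0Saturated_of_chain {N : Type w} [L.Structure N] {G : ℕ → Type w}
    [∀ i, L.Structure (G i)] (g : ∀ i, G i ↪ₑ[L] N) (hmono : ∀ i, range (g i) ⊆ range (g (i + 1)))
    (hcov : ∀ z, ∃ i, z ∈ range (g i))
    (hreal : ∀ i (p : Set (L.Formula (G i ⊕ Unit))), IsFinSatisfied p →
      ∃ a : N, ∀ φ ∈ p, φ.Realize (Sum.elim (g i) fun _ => a)) : IsAleph0Saturated L N := by
  classical
  have hmono' : Monotone fun i => range (g i) := monotone_nat_of_le_succ hmono
  intro A hA p hp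
  obtain ⟨i, hi⟩ : ∃ i, A ⊆ range (g i) := by
    have := hA.to_subtype
    choose i hi using hcov
    obtain ⟨m, hm⟩ := (hA.image i).bddAbove
    exact ⟨m, fun a ha => hmono' (hm (mem_image_of_mem i ha)) (hi a)⟩
  choose b hb using fun a : A => hi a.2
  let F : L[[A]].Formula (Fin 1) → L.Formula (G i ⊕ Unit) := fun φ =>
    Language.Formula.relabel (Sum.elim (fun a => Sum.inl (b a)) fun _ => Sum.inr ())
      (Language.BoundedFormula.constantsVarsEquiv φ : L.Formula (A ⊕ Fin 1))
  have hF : ∀ φ (a : N), (F φ).Realize (Sum.elim (g i) fun _ => a) ↔ φ.Realize fun _ => a := by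
    intro φ a
    refine Language.Formula.realize_relabel.trans (Iff.trans (iff_of_eq (congrArg _ ?_))
      Language.BoundedFormula.realize_constantsVarsEquiv)
    funext j
    rcases j with j | j
    · exact hb j
    · rfl
  obtain ⟨a, ha⟩ := hreal i (F '' p) <| IsFinSatisfied.of_elementary (g i) fun q hq => by
    choose! ψ hψp hψ using hq
    obtain ⟨a, ha⟩ := hp (q.image ψ) fun φ hφ => by
      obtain ⟨χ, hχ, rfl⟩ := Finset.mem_image.1 hφ
      exact hψp χ hχ
    refine ⟨a, fun φ hφ => ?_⟩
    rw [← hψ φ hφ, hF]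
    exact ha _ (Finset.mem_image_of_mem ψ hφ)
  exact ⟨a, fun φ hφ => (hF φ a).1 (ha _ (mem_image_of_mem F hφ))⟩

/-! ### Limits of elementary chains -/

section Chain

variable {G : ℕ → Type w} [∀ i, L.Structure (G i)] (f : ∀ n, G n ↪ₑ[L] G (n + 1))

/-- The direct limit of an elementary chain. -/
abbrev chainLimit : Type w :=
  Language.DirectLimit G fun i j h =>
    Language.DirectedSystem.natLERec (fun n => (f n).toEmbedding) i j h

/-- The embedding of a member of an elementary chain into its limit. -/
noncomputable def chainLimitOf (i : ℕ) : G i ↪[L] chainLimit f :=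
  Language.DirectLimit.of L ℕ G (fun i j h =>
    Language.DirectedSystem.natLERec (fun n => (f n).toEmbedding) i j h) i

theorem exists_chainLimitOf (z : chainLimit f) : ∃ i x, chainLimitOf f i x = z :=
  Language.DirectLimit.exists_of z

theorem chainLimitOf_succ (i : ℕ) (x : G i) :
    chainLimitOf f (i + 1) (f i x) = chainLimitOf f i x := by
  have := Language.DirectLimit.of_f (L := L) (G := G) (f := fun i j h =>
    Language.DirectedSystem.natLERec (fun n => (f n).toEmbedding) i j h)
    (hij := Nat.le_succ i) (x := x)
  refine Eq.trans (congrArg _ ?_) this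
  rw [Language.DirectedSystem.coe_natLERec]
  exact (Nat.leRecOn_succ' (C := G) (next := fun {k} => f k) x).symm

theorem exists_chainEmbedding {i j : ℕ} (h : i ≤ j) :
    ∃ e : G i ↪ₑ[L] G j, ∀ x, chainLimitOf f j (e x) = chainLimitOf f i x := by
  induction j, h using Nat.le_induction with
  | base => exact ⟨Language.ElementaryEmbedding.refl L (G i), fun x => rfl⟩
  | succ j h ih =>
    obtain ⟨e, he⟩ := ih
    exact ⟨(f j).comp e, fun x => (chainLimitOf_succ f j (e x)).trans (he x)⟩

/-- In the quantifier step, an arbitrary element of the limit and the parameters are moved to a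
common stage, which is an elementary extension of stage `i`. -/
theorem realize_chainLimitOf {α : Type*} {n : ℕ} (φ : L.BoundedFormula α n) (i : ℕ) (v : α → G i)
    (xs : Fin n → G i) :
    φ.Realize (chainLimitOf f i ∘ v) (chainLimitOf f i ∘ xs) ↔ φ.Realize v xs := by
  induction φ generalizing i with
  | falsum => exact Iff.rfl
  | equal t s =>
    exact (Language.BoundedFormula.IsAtomic.equal t s).isQF.realize_embedding (chainLimitOf f i)
  | rel R ts =>
    exact (Language.BoundedFormula.IsAtomic.rel R ts).isQF.realize_embedding (chainLimitOf f i)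
  | imp _ _ ih ih' => exact imp_congr (ih i v xs) (ih' i v xs)
  | all φ ih =>
    constructor
    · intro h x
      refine (ih i v (Fin.snoc xs x)).1 ?_
      rw [Fin.comp_snoc]
      exact h _
    · intro h z
      obtain ⟨j, x, rfl⟩ := exists_chainLimitOf f z
      obtain ⟨e, he⟩ := exists_chainEmbedding f (le_max_left i j)
      obtain ⟨e', he'⟩ := exists_chainEmbedding f (le_max_right i j)
      have h' := (e.map_boundedFormula φ.all v xs).2 h (e' x)
      have := (ih _ _ _).2 h'
      rw [Fin.comp_snoc, he', ← Function.comp_assoc, ← Function.comp_assoc] at this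
      have hcomp : chainLimitOf f (max i j) ∘ e = chainLimitOf f i := funext he
      rwa [hcomp] at this

end Chain

theorem exists_isAleph0Saturated_of_chain {T : L.Theory}
    (G : ℕ → Language.Theory.ModelType.{u, v, w} T) (e : ∀ n, G n ↪ₑ[L] G (n + 1))
    (he : ∀ n (p : Set (L.Formula (G n ⊕ Unit))), IsFinSatisfied p →
      ∃ a : G (n + 1), ∀ φ ∈ p, φ.Realize (Sum.elim (e n) fun _ => a)) :
    ∃ N : Language.Theory.ModelType.{u, v, w} T, IsAleph0Saturated L N := by
  let g : ∀ n : ℕ, (G n).Carrier ↪ₑ[L] chainLimit (G := fun n => G n) e := fun n =>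
    ⟨chainLimitOf (G := fun n => G n) e n, fun k φ x => by
      refine Iff.trans (iff_of_eq (congrArg (Language.BoundedFormula.Realize φ _)
        (Subsingleton.elim _ _)))
        (realize_chainLimitOf (G := fun n => G n) e φ n x default)⟩
  have hge : ∀ n x, g (n + 1) (e n x) = g n x := chainLimitOf_succ (G := fun n => G n) e
  have : Nonempty (chainLimit (G := fun n => G n) e) := ⟨g 0 Classical.ofNonempty⟩
  have : chainLimit (G := fun n => G n) e ⊨ T := ((g 0).theory_model_iff T).1 inferInstance
  refine ⟨Language.Theory.ModelType.of T (chainLimit (G := fun n => G n) e), ?_⟩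
  refine isAleph0Saturated_of_chain (G := fun n => G n) g ?_ ?_ ?_
  · rintro i _ ⟨x, rfl⟩
    exact ⟨e i x, hge i x⟩
  · intro z
    obtain ⟨i, x, h⟩ := exists_chainLimitOf (G := fun n => G n) e z
    exact ⟨i, x, h⟩
  · intro i p hp
    obtain ⟨a, ha⟩ := he i p hp
    refine ⟨g (i + 1) a, fun φ hφ => ?_⟩
    have := ((g (i + 1)).map_formula φ _).2 (ha φ hφ)
    refine (iff_of_eq (congrArg _ (funext fun j => ?_))).1 this
    rcases j with j | j
    · exact hge i j
    · rfl

theorem exists_isAleph0Saturated_model {T : L.Theory}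
    (M : Language.Theory.ModelType.{u, v, max u v w} T) :
    ∃ N : Language.Theory.ModelType.{u, v, max u v w} T, IsAleph0Saturated L N := by
  have hstep : ∀ K : Language.Theory.ModelType.{u, v, max u v w} T,
      ∃ (K' : Language.Theory.ModelType.{u, v, max u v w} T) (f : K ↪ₑ[L] K'),
      ∀ p : Set (L.Formula (K ⊕ Unit)), IsFinSatisfied p →
        ∃ a : K', ∀ φ ∈ p, φ.Realize (Sum.elim f fun _ => a) := by
    intro K
    obtain ⟨N, _, _, f, hf⟩ := exists_elementary_extension_realizing.{u, v, w} (L := L) K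
    have : N ⊨ T := (f.theory_model_iff T).1 inferInstance
    exact ⟨Language.Theory.ModelType.of T N, f, hf⟩
  choose S f hf using hstep
  let G : ℕ → Language.Theory.ModelType.{u, v, max u v w} T := fun n => Nat.rec M (fun _ => S) n
  exact exists_isAleph0Saturated_of_chain G (fun n => f (G n)) fun n => hf (G n)

end Existence
end BinaryReducts

namespace BinaryReducts
open FirstOrder Set

/-! ### Independence of the linear order -/

section Independence

variable {M : Type w} {L : FirstOrder.Language.{u, v}} [L.Structure M] {lt tl : M → M → Prop}

/-- The sets whose trace on `D` belongs to a Boolean algebra that contains `D`. -/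
def traceAlgebra (B : BooleanSubalgebra (Set M)) (D : Set M) (hD : D ∈ B) :
    BooleanSubalgebra (Set M) where
  carrier := {S | S ∩ D ∈ B}
  supClosed' := fun S hS S' hS' => by
    have h : (S ∪ S') ∩ D = S ∩ D ∪ S' ∩ D := Set.union_inter_distrib_right S S' D
    exact (congrArg (· ∈ B) h).mpr (B.sup_mem hS hS')
  infClosed' := fun S hS S' hS' => by
    have h : (S ∩ S') ∩ D = S ∩ D ∩ (S' ∩ D) := Set.inter_inter_distrib_right S S' D
    exact (congrArg (· ∈ B) h).mpr (B.inf_mem hS hS')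
  compl_mem' := fun {S} hS => by
    have h : Sᶜ ∩ D = (S ∩ D)ᶜ ∩ D := by
      rw [Set.compl_inter, Set.union_inter_distrib_right, Set.compl_inter_self, Set.union_empty]
    exact (congrArg (· ∈ B) h).mpr (B.inf_mem (B.compl_mem hS) hD)
  bot_mem' := (congrArg (· ∈ B) (Set.empty_inter D)).mpr B.bot_mem

/-- It suffices to treat an `lt`-convex set on each piece aligning `tl` with `lt`. Undoing the
reversals reduces it to `<_E⃗`-convex sets, and on the piece `<_E⃗` is `tl`. -/
theorem IsWeaklyQuasiOMinimalStructure.change_order [IsStrictTotalOrder M lt]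
    [IsStrictTotalOrder M tl] (hM : IsAleph0Saturated L M)
    (hlt : lt ∈ binaryRels L (∅ : Set M)) (htl : tl ∈ binaryRels L (∅ : Set M))
    (hW : IsWeaklyQuasiOMinimalStructure L M lt) : IsWeaklyQuasiOMinimalStructure L M tl := by
  classical
  intro D hD
  refine BooleanSubalgebra.closure_le.2 ?_ (hW D hD)
  set B := BooleanSubalgebra.closure {C : Set M | IsConvex tl C ∨ C ∈ definableAlgebra L ∅}
  have hsub : ∀ C, IsConvex tl C ∨ C ∈ definableAlgebra L ∅ → C ∈ B := fun C hC =>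
    BooleanSubalgebra.subset_closure hC
  rintro C (hC | hC)
  swap
  · exact hsub C (Or.inr hC)
  obtain ⟨F, hF, hFc, hFp⟩ := isAlignable_univ hM hlt hW Set.finite_empty htl
  have hpiece : ∀ D ∈ F, D ∈ B ∧ C ∩ D ∈ B := by
    intro D hDF
    obtain ⟨-, hDd, Es, hEs, hdec, hal⟩ := hFp D hDF
    have hDB := hsub D (Or.inr hDd)
    refine ⟨hDB, ?_⟩
    have hadm : IsAdmissible lt Es :=
      isAdmissible_of_isDecreasing (fun E hE => (hEs E hE).2.1) hdec
    refine mem_of_convex_of_reverseAlong (B := traceAlgebra B D hDB) hadm (fun C' hC' => ?_) hC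
    -- The `tl`-convex hull of the trace: it is convex in all of `M` and has the same trace on `D`.
    let H : Set M := {z | (∃ a ∈ C' ∩ D, a = z ∨ tl a z) ∧ ∃ b ∈ C' ∩ D, z = b ∨ tl z b}
    have hH : IsConvex tl H := by
      rintro x ⟨⟨a, ha, hax⟩, -⟩ y ⟨-, b, hb, hyb⟩ z hxz hzy
      refine ⟨⟨a, ha, Or.inr ?_⟩, b, hb, Or.inr ?_⟩
      · rcases hax with rfl | hax
        · exact hxz
        · exact _root_.trans hax hxz
      · rcases hyb with rfl | hyb
        · exact hzy
        · exact _root_.trans hzy hyb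
    have heq : C' ∩ D = H ∩ D := by
      ext z
      refine ⟨fun hz => ⟨⟨⟨z, hz, Or.inl rfl⟩, z, hz, Or.inl rfl⟩, hz.2⟩, ?_⟩
      rintro ⟨⟨⟨a, ha, haz⟩, b, hb, hzb⟩, hzD⟩
      refine ⟨?_, hzD⟩
      rcases haz with rfl | haz
      · exact ha.1
      rcases hzb with rfl | hzb
      · exact hb.1
      exact hC' a ha.1 b hb.1 z ((hal a ha.2 z hzD trivial).1 haz)
        ((hal z hzD b hb.2 trivial).1 hzb)
    change C' ∩ D ∈ B
    rw [heq]
    exact B.inf_mem (hsub H (Or.inl hH)) hDB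
  refine mem_booleanSubalgebra_of_determined B
    (hF.toFinset ∪ hF.toFinset.image fun D => C ∩ D) ?_ C ?_
  · intro X hX
    rcases Finset.mem_union.1 hX with hX | hX
    · exact (hpiece X (hF.mem_toFinset.1 hX)).1
    · obtain ⟨D, hD, rfl⟩ := Finset.mem_image.1 hX
      exact (hpiece D (hF.mem_toFinset.1 hD)).2
  · intro x y hxy hx
    obtain ⟨D, hDF, hxD⟩ := hFc x trivial
    exact ((hxy (C ∩ D) (Finset.mem_union_right _ (Finset.mem_image_of_mem _
      (hF.mem_toFinset.2 hDF)))).1 ⟨hx, hxD⟩).1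

end Independence

/-! ### Theories -/

section Main

variable {L : FirstOrder.Language.{u, v}} {T : L.Theory} {lt tl : L.Formula (Fin 2)}

theorem isWeaklyQuasiOMinimalWrt_of_structure (hT : T.IsComplete)
    (hlt : DefinesLinearOrder.{u, v, w} T lt) (M : Language.Theory.ModelType.{u, v, max u v w} T)
    (hM : IsAleph0Saturated L M) (hW : IsWeaklyQuasiOMinimalStructure L M (relOf lt M)) :
    IsWeaklyQuasiOMinimalWrt.{u, v, w} T lt := fun N =>
  hW.transfer.{u, v, w} hT hlt M N hM

theorem tfae_isWeaklyQuasiOMinimalWrt (hT : T.IsComplete)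
    (hlt : DefinesLinearOrder.{u, v, w} T lt)
    (hsat : ∃ M : Language.Theory.ModelType.{u, v, max u v w} T, IsAleph0Saturated L M) :
    List.TFAE [IsWeaklyQuasiOMinimalWrt.{u, v, w} T lt, IsWeaklyMonotoneWrt.{u, v, w} T lt,
      IsWeaklySpecialWrt.{u, v, w} T lt] := by
  tfae_have 1 → 2 := by
    intro h
    obtain ⟨M, hM⟩ := hsat
    have := hlt M
    exact ⟨M, hM, isWeaklyMonotoneStructure_of_isWeaklyQuasiOMinimalStructure hM
      (relOf_mem_binaryRels lt) (h M)⟩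
  tfae_have 2 → 3 := fun ⟨M, hM, h⟩ =>
    ⟨M, hM, isWeaklySpecialStructure_of_isWeaklyMonotoneStructure h⟩
  tfae_have 3 → 1 := by
    rintro ⟨M, hM, h⟩
    have := hlt M
    exact isWeaklyQuasiOMinimalWrt_of_structure hT hlt M hM
      (isWeaklyQuasiOMinimalStructure_of_isWeaklySpecialStructure (relOf_mem_binaryRels lt) h)
  tfae_finish

theorem IsWeaklyQuasiOMinimalWrt.change_order (hT : T.IsComplete)
    (hlt : DefinesLinearOrder.{u, v, w} T lt) (htl : DefinesLinearOrder.{u, v, w} T tl)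
    (hsat : ∃ M : Language.Theory.ModelType.{u, v, max u v w} T, IsAleph0Saturated L M)
    (h : IsWeaklyQuasiOMinimalWrt.{u, v, w} T lt) : IsWeaklyQuasiOMinimalWrt.{u, v, w} T tl := by
  obtain ⟨M, hM⟩ := hsat
  have := hlt M
  have := htl M
  exact isWeaklyQuasiOMinimalWrt_of_structure hT htl M hM
    (IsWeaklyQuasiOMinimalStructure.change_order hM (relOf_mem_binaryRels lt)
      (relOf_mem_binaryRels tl) (h M))

end Main
end BinaryReducts

/-! ### The theorem for complete theories -/

theorem theorem1 {L : FirstOrder.Language.{u, v}} (T : L.Theory) (hT : T.IsComplete)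
    (hinf : ∃ M : FirstOrder.Language.Theory.ModelType.{u, v, max u v w} T, Infinite M) :
    (∀ lt : L.Formula (Fin 2), BinaryReducts.DefinesLinearOrder.{u, v, w} T lt →
      List.TFAE [
        BinaryReducts.IsWeaklyQuasiOMinimalWrt.{u, v, w} T lt,
        BinaryReducts.IsWeaklyMonotoneWrt.{u, v, w} T lt,
        BinaryReducts.IsWeaklySpecialWrt.{u, v, w} T lt]) ∧
    (BinaryReducts.IsWeaklyQuasiOMinimal.{u, v, w} T ↔
      BinaryReducts.IsWeaklyMonotone.{u, v, w} T) ∧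
    (∀ lt lt' : L.Formula (Fin 2), BinaryReducts.DefinesLinearOrder.{u, v, w} T lt →
      BinaryReducts.DefinesLinearOrder.{u, v, w} T lt' →
      (BinaryReducts.IsWeaklyQuasiOMinimalWrt.{u, v, w} T lt ↔
        BinaryReducts.IsWeaklyQuasiOMinimalWrt.{u, v, w} T lt') ∧
      (BinaryReducts.IsWeaklyMonotoneWrt.{u, v, w} T lt ↔
        BinaryReducts.IsWeaklyMonotoneWrt.{u, v, w} T lt')) := by
  obtain ⟨M₀, -⟩ := hinf
  have hsat := BinaryReducts.exists_isAleph0Saturated_model.{u, v, w} M₀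
  have htfae := fun lt (hlt : BinaryReducts.DefinesLinearOrder.{u, v, w} T lt) =>
    BinaryReducts.tfae_isWeaklyQuasiOMinimalWrt hT hlt hsat
  have hwqm := fun lt hlt => (htfae lt hlt).out 0 1
  have hiff := fun lt lt' (hlt : BinaryReducts.DefinesLinearOrder.{u, v, w} T lt)
      (hlt' : BinaryReducts.DefinesLinearOrder.{u, v, w} T lt') =>
    Iff.intro (BinaryReducts.IsWeaklyQuasiOMinimalWrt.change_order hT hlt hlt' hsat)
      (BinaryReducts.IsWeaklyQuasiOMinimalWrt.change_order hT hlt' hlt hsat)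
  refine ⟨htfae, exists_congr fun lt => and_congr_right fun hlt => hwqm lt hlt,
    fun lt lt' hlt hlt' => ⟨hiff lt lt' hlt hlt', ?_⟩⟩
  exact (hwqm lt hlt).symm.trans ((hiff lt lt' hlt hlt').trans (hwqm lt' hlt'))
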